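/- Let $\mathcal P=(0,1)^2$ and let $s\ge 5$ be an integer. For $m\ge 0$ let $H^m_{per}(\mathcal P)$ be the Hilbert space of real functions on $(0,1)\times\mathbb R$, of period $1$ in $x_2$, whose weak derivatives of order at most $m$ are in $L^2(\mathcal P)$, with $\|u\|^2=\sum_{|\alpha|\le m}\|\partial^\alpha u\|^2_{L^2(\mathcal P)}$; for $m\ge 2$ let $H^m_{0,per}(\mathcal P)$ be the subspace of those functions that vanish at $x_1=0$ and $x_1=1$. Put $Y=H^s_{0,per}(\mathcal P)$, $V=H^{s+2}_{0,per}(\mathcal P)\subset Y$, with topological duals $Y^*$, $V^*$; the restriction of functionals from $Y$ to $V$ maps $Y^*$ into $V^*$. Let $a=(a_1,a_2)=a(x,z)$ be an $\mathbb R^2$-valued function of class $C^{s+1}$ of $x=(x_1,x_2)\in[0,1]\times\mathbb R$ and $z\in\mathbb R^2$, of period $1$ in $x_2$, and let $\lambda_1,\lambda_2>0$. Then: (i) For every $w\in Y$, $a_1(x,\nabla w)$ and $a_2(x,\nabla w)$ belong to $H^{s-1}_{per}(\mathcal P)$; hence $\operatorname{div}(a(x,\nabla w))\in H^{s-2}_{per}(\mathcal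 P)$ and the functional $Aw\in V^*$, $$Aw=(\partial_{x_1}^s)^*\,\partial_{x_1}^{s-2}\operatorname{div}(a(x,\nabla w))-\lambda_1(-1)^s\,\partial_{x_2}^s\operatorname{div}\partial_{x_2}\,\partial_{x_2}^{s-1}(a(x,\nabla w))-\lambda_2\operatorname{div}(a(x,\nabla w)),$$ is well defined, where $(\partial_{x_1}^s)^*:L^2(\mathcal P)\to V^*$ is the dual of $\partial_{x_1}^s:V\to L^2(\mathcal P)$, $\partial_{x_2}^s\operatorname{div}\partial_{x_2}:L^2(\mathcal P)^2\to V^*$ is the dual of $(-1)^s\partial_{x_2}\nabla\partial_{x_2}^s:V\to L^2(\mathcal P)^2$, and, in the last term, $\operatorname{div}:L^2(\mathcal P)^2\to V^*$ is the dual of $-\nabla:V\to L^2(\mathcal P)^2$; that is, for all $v\in V$, $$\langle v,Aw\rangle=\int_{\mathcal P}(\partial_{x_1}^sv)\,\partial_{x_1}^{s-2}\operatorname{div}(a(x,\nabla w))\,dx-\lambda_1\int_{\mathcal P}(\partial_{x_2}\nabla\partial_{x_2}^sv)\cdot\partial_{x_2}^{s-1}(a(x,\nabla w))\,dx+\lambda_2\int_{\mathcal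 P}\nabla v\cdot a(x,\nabla w)\,dx .$$ (ii) Let $w\in Y$ and $h\in H^s_{per}(\mathcal P)$, and define $f\in Y^*\subset V^*$ by $$\langle v,f\rangle=\int_{\mathcal P}(\partial_{x_1}^sv)(\partial_{x_1}^{s-2}h)\,dx-\lambda_1\int_{\mathcal P}(\partial_{x_2}^sv)(\partial_{x_2}^sh)\,dx-\lambda_2\int_{\mathcal P}vh\,dx\qquad(v\in Y).$$ If $Aw=f$ in $V^*$, then $\operatorname{div}(a(x,\nabla w))=h$. (iii) The linear map $$-(\partial_{x_1}^s)^*\partial_{x_1}^{s-2}+\lambda_1(-1)^s\partial_{x_2}^{2s}+\lambda_2:\ H^{s-2}_{per}(\mathcal P)\to V^*,$$ which sends $g$ to the functional $v\mapsto-\int_{\mathcal P}(\partial_{x_1}^sv)(\partial_{x_1}^{s-2}g)\,dx+\lambda_1\int_{\mathcal P}(\partial_{x_2}^{s+2}v)(\partial_{x_2}^{s-2}g)\,dx+\lambda_2\int_{\mathcal P}vg\,dx$, is injective. -/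

import Mathlib

open MeasureTheory Set
open scoped ContDiff

noncomputable section

namespace ToyProblem

/-- The periodicity cell `(0,1) × (0,1)`. -/
def cell : Set (ℝ × ℝ) := Ioo (0 : ℝ) 1 ×ˢ Ioo (0 : ℝ) 1

/-- Lebesgue measure on the cell. -/
abbrev cellMeasure : Measure (ℝ × ℝ) := volume.restrict cell

/-- The real Hilbert space `L²` of the cell. -/
abbrev L2 : Type := Lp ℝ 2 cellMeasure

/-- Classical partial derivative in the first variable. -/
def pdOne (φ : ℝ × ℝ → ℝ) : ℝ × ℝ → ℝ := fun x => deriv (fun t => φ (t, x.2)) x.1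

/-- Classical partial derivative in the second variable. -/
def pdTwo (φ : ℝ × ℝ → ℝ) : ℝ × ℝ → ℝ := fun x => deriv (fun t => φ (x.1, t)) x.2

/-- Classical partial derivative of multi-index `α = (α₁, α₂)`. -/
def pd (α : ℕ × ℕ) (φ : ℝ × ℝ → ℝ) : ℝ × ℝ → ℝ := pdOne^[α.1] (pdTwo^[α.2] φ)

/-- Test functions: smooth, of period `1` in `x₂`, vanishing for `x₁` outside a compact subset
of `(0,1)`. -/
structure IsTest (φ : ℝ × ℝ → ℝ) : Prop where
  smooth : ContDiff ℝ ∞ φ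
  periodic : ∀ x₁ x₂ : ℝ, φ (x₁, x₂ + 1) = φ (x₁, x₂)
  supported : ∃ δ : ℝ, 0 < δ ∧ ∀ x : ℝ × ℝ, φ x ≠ 0 → δ ≤ x.1 ∧ x.1 ≤ 1 - δ

/-- `g` is the weak derivative `∂^α f` on the strip `(0,1) × ℝ`, where `f, g ∈ L²(cell)` stand for
functions on the strip that have period `1` in `x₂`. -/
def IsWeakDeriv (α : ℕ × ℕ) (f g : L2) : Prop :=
  ∀ φ : ℝ × ℝ → ℝ, IsTest φ →
    ∫ x in cell, f x * pd α φ x = (-1 : ℝ) ^ (α.1 + α.2) * ∫ x in cell, g x * φ x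

/-- Multi-indices of order at most `m`. -/
def multiIdx (m : ℕ) : Finset (ℕ × ℕ) :=
  (Finset.range (m + 1) ×ˢ Finset.range (m + 1)).filter fun α => α.1 + α.2 ≤ m

lemma mem_multiIdx {m : ℕ} {α : ℕ × ℕ} (h : α.1 + α.2 ≤ m) : α ∈ multiIdx m := by
  simp only [multiIdx, Finset.mem_filter, Finset.mem_product, Finset.mem_range]
  omega

lemma le_of_mem_multiIdx {m : ℕ} {α : ℕ × ℕ} (h : α ∈ multiIdx m) : α.1 + α.2 ≤ m := by
  simp only [multiIdx, Finset.mem_filter] at h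
  exact h.2

/-- Families of `L²` functions indexed by the multi-indices of order at most `m`, with the Hilbert
norm `‖U‖² = ∑ ‖U α‖²`. -/
abbrev Jet (m : ℕ) : Type := PiLp 2 (fun _ : multiIdx m => L2)

/-- The entry of a family at the multi-index `α`. -/
def Jet.entry {m : ℕ} (α : ℕ × ℕ) (h : α.1 + α.2 ≤ m) : Jet m →L[ℝ] L2 :=
  PiLp.proj (𝕜 := ℝ) 2 (fun _ : multiIdx m => L2) ⟨α, mem_multiIdx h⟩

lemma integrable_mul_of_bounded (f : L2) {ψ : ℝ × ℝ → ℝ} (hψ : Continuous ψ) :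
    IntegrableOn (fun x => f x * ψ x) cell := by
  have hK : IsCompact (Icc (0 : ℝ) 1 ×ˢ Icc (0 : ℝ) 1) := isCompact_Icc.prod isCompact_Icc
  obtain ⟨C, hC⟩ := hK.exists_bound_of_continuousOn hψ.continuousOn
  have : IsFiniteMeasure cellMeasure := by
    refine ⟨?_⟩
    rw [Measure.restrict_apply_univ]
    refine lt_of_le_of_lt (measure_mono ?_) hK.measure_lt_top
    exact prod_mono Ioo_subset_Icc_self Ioo_subset_Icc_self
  have hf : Integrable (fun x => f x) cellMeasure := (Lp.memLp f).integrable (by norm_num)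
  refine Integrable.mul_bdd (c := C) hf hψ.aestronglyMeasurable ?_
  refine (ae_restrict_iff' (measurableSet_Ioo.prod measurableSet_Ioo)).2 (ae_of_all _ ?_)
  intro x hx
  exact hC x (prod_mono Ioo_subset_Icc_self Ioo_subset_Icc_self hx)

lemma contDiff_pdOne {φ : ℝ × ℝ → ℝ} (h : ContDiff ℝ ∞ φ) : ContDiff ℝ ∞ (pdOne φ) := by
  have e : pdOne φ = fun x => fderiv ℝ φ x (1, 0) := by
    funext x
    have h1 : HasFDerivAt φ (fderiv ℝ φ x) ((x.1, x.2) : ℝ × ℝ) :=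
      (h.differentiable (by simp) x).hasFDerivAt
    have h2 : HasDerivAt (fun t : ℝ => (t, x.2)) ((1, 0) : ℝ × ℝ) x.1 :=
      (hasDerivAt_id x.1).prodMk (hasDerivAt_const x.1 x.2)
    exact (h1.comp_hasDerivAt x.1 h2).deriv
  rw [e]
  exact (h.fderiv_right (by simp)).clm_apply contDiff_const

lemma contDiff_pdTwo {φ : ℝ × ℝ → ℝ} (h : ContDiff ℝ ∞ φ) : ContDiff ℝ ∞ (pdTwo φ) := by
  have e : pdTwo φ = fun x => fderiv ℝ φ x (0, 1) := by
    funext x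
    have h1 : HasFDerivAt φ (fderiv ℝ φ x) ((x.1, x.2) : ℝ × ℝ) :=
      (h.differentiable (by simp) x).hasFDerivAt
    have h2 : HasDerivAt (fun t : ℝ => (x.1, t)) ((0, 1) : ℝ × ℝ) x.2 :=
      (hasDerivAt_const x.2 x.1).prodMk (hasDerivAt_id x.2)
    exact (h1.comp_hasDerivAt x.2 h2).deriv
  rw [e]
  exact (h.fderiv_right (by simp)).clm_apply contDiff_const

lemma contDiff_pd {φ : ℝ × ℝ → ℝ} (h : ContDiff ℝ ∞ φ) (α : ℕ × ℕ) : ContDiff ℝ ∞ (pd α φ) := by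
  have h2 : ∀ n, ContDiff ℝ ∞ (pdTwo^[n] φ) := by
    intro n
    induction n with
    | zero => simpa using h
    | succ n ih => rw [Function.iterate_succ_apply']; exact contDiff_pdTwo ih
  have h1 : ∀ n, ContDiff ℝ ∞ (pdOne^[n] (pdTwo^[α.2] φ)) := by
    intro n
    induction n with
    | zero => simpa using h2 α.2
    | succ n ih => rw [Function.iterate_succ_apply']; exact contDiff_pdOne ih
  exact h1 α.1

lemma integral_add_mul (f g : L2) {ψ : ℝ × ℝ → ℝ} (hψ : Continuous ψ) :
    ∫ x in cell, (f + g : L2) x * ψ x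
      = (∫ x in cell, f x * ψ x) + ∫ x in cell, g x * ψ x := by
  rw [← integral_add (integrable_mul_of_bounded f hψ) (integrable_mul_of_bounded g hψ)]
  refine integral_congr_ae ?_
  filter_upwards [Lp.coeFn_add f g] with x hx
  rw [hx, Pi.add_apply, add_mul]

lemma integral_smul_mul (c : ℝ) (f : L2) (ψ : ℝ × ℝ → ℝ) :
    ∫ x in cell, (c • f : L2) x * ψ x = c * ∫ x in cell, f x * ψ x := by
  rw [← integral_const_mul]
  refine integral_congr_ae ?_
  filter_upwards [Lp.coeFn_smul c f] with x hx
  rw [hx, Pi.smul_apply, smul_eq_mul, mul_assoc]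

lemma integral_zero_mul (ψ : ℝ × ℝ → ℝ) : ∫ x in cell, (0 : L2) x * ψ x = 0 := by
  rw [integral_congr_ae (g := fun _ => (0 : ℝ)), integral_zero]
  filter_upwards [Lp.coeFn_zero ℝ 2 cellMeasure] with x hx
  rw [hx, Pi.zero_apply, zero_mul]

/-- The Sobolev space `H^m_per`. An element is the family `(∂^α u)_{|α| ≤ m}` of all weak
derivatives of a function `u`, so that the norm is `‖u‖² = ∑_{|α| ≤ m} ‖∂^α u‖²_{L²}`. -/
def HPer (m : ℕ) : Submodule ℝ (Jet m) where
  carrier := {U | ∀ (α : ℕ × ℕ) (h : α.1 + α.2 ≤ m),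
    IsWeakDeriv α (Jet.entry (0, 0) (Nat.zero_le m) U) (Jet.entry α h U)}
  add_mem' := by
    intro U W hU hW α h φ hφ
    rw [map_add, map_add, integral_add_mul _ _ (contDiff_pd hφ.smooth α).continuous,
      integral_add_mul _ _ hφ.smooth.continuous, hU α h φ hφ, hW α h φ hφ, mul_add]
  zero_mem' := by
    intro α h φ _
    rw [map_zero, map_zero, integral_zero_mul, integral_zero_mul, mul_zero]
  smul_mem' := by
    intro c U hU α h φ hφ
    rw [map_smul, map_smul, integral_smul_mul, integral_smul_mul, hU α h φ hφ]
    ring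

/-- The homogeneous Dirichlet condition at `x₁ = 0` and `x₁ = 1`, for (classes of) functions of
period `1` in `x₂` that are continuous up to the boundary. -/
def Dirichlet (f : L2) : Prop :=
  ∃ g : ℝ × ℝ → ℝ, ContinuousOn g (Icc (0 : ℝ) 1 ×ˢ univ) ∧
    (∀ x₁ x₂ : ℝ, g (x₁, x₂ + 1) = g (x₁, x₂)) ∧
    (∀ x₂ : ℝ, g (0, x₂) = 0 ∧ g (1, x₂) = 0) ∧
    f =ᵐ[cellMeasure] g

/-- The space `H^m_{0,per}` for `m ≥ 2`: the functions in `H^m_per` (they are then continuous up to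
the boundary) that vanish at `x₁ = 0` and `x₁ = 1`. -/
def HPerZero (m : ℕ) : Submodule ℝ (Jet m) where
  carrier := {U | U ∈ HPer m ∧ Dirichlet (Jet.entry (0, 0) (Nat.zero_le m) U)}
  add_mem' := by
    rintro U W ⟨hU, g, gc, gp, gz, ge⟩ ⟨hW, k, kc, kp, kz, ke⟩
    refine ⟨(HPer m).add_mem hU hW, g + k, gc.add kc, fun x₁ x₂ => ?_, fun x₂ => ?_, ?_⟩
    · simp [gp, kp]
    · simp [gz x₂, kz x₂]
    · rw [map_add]
      exact (Lp.coeFn_add _ _).trans (ge.add ke)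
  zero_mem' := by
    refine ⟨(HPer m).zero_mem, 0, continuousOn_const, fun _ _ => rfl, fun _ => ⟨rfl, rfl⟩, ?_⟩
    rw [map_zero]
    exact Lp.coeFn_zero ℝ 2 cellMeasure
  smul_mem' := by
    rintro c U ⟨hU, g, gc, gp, gz, ge⟩
    refine ⟨(HPer m).smul_mem c hU, c • g, gc.const_smul c, fun x₁ x₂ => ?_, fun x₂ => ?_, ?_⟩
    · simp [gp]
    · simp [gz x₂]
    · rw [map_smul]
      exact (Lp.coeFn_smul _ _).trans (ge.const_smul c)

/-- The derivative `∂^α`, `|α| ≤ m`, as a bounded operator into `L²`, on a space of functions with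
weak derivatives up to order `m`. -/
def D {m : ℕ} (S : Submodule ℝ (Jet m)) (α : ℕ × ℕ) (h : α.1 + α.2 ≤ m) : S →L[ℝ] L2 :=
  (Jet.entry α h).comp S.subtypeL

/-- The inclusion into `L²`, that is, `∂^{(0,0)}`. -/
def toL2 {m : ℕ} (S : Submodule ℝ (Jet m)) : S →L[ℝ] L2 := D S (0, 0) (Nat.zero_le m)

/-- Forgetting the derivatives of order greater than `m`. -/
def Jet.truncate {m n : ℕ} (h : m ≤ n) : Jet n →ₗ[ℝ] Jet m where
  toFun U := WithLp.toLp 2 fun α =>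
    Jet.entry (α : ℕ × ℕ) ((le_of_mem_multiIdx α.2).trans h) U
  map_add' U W := by ext1 α; simp
  map_smul' c U := by ext1 α; simp

lemma Jet.entry_truncate {m n : ℕ} (h : m ≤ n) (U : Jet n) (α : ℕ × ℕ) (hα : α.1 + α.2 ≤ m) :
    Jet.entry α hα (Jet.truncate h U) = Jet.entry α (hα.trans h) U := rfl

lemma Jet.norm_truncate_le {m n : ℕ} (h : m ≤ n) (U : Jet n) : ‖Jet.truncate h U‖ ≤ ‖U‖ := by
  rw [PiLp.norm_eq_of_L2, PiLp.norm_eq_of_L2]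
  refine Real.sqrt_le_sqrt ?_
  let e : multiIdx m → multiIdx n :=
    fun α => ⟨α, mem_multiIdx ((le_of_mem_multiIdx α.2).trans h)⟩
  have he : Function.Injective e := by
    intro α β hαβ
    exact Subtype.ext (congrArg (fun γ : multiIdx n => (γ : ℕ × ℕ)) hαβ)
  calc ∑ α, ‖Jet.truncate h U α‖ ^ 2 = ∑ α, ‖U (e α)‖ ^ 2 := rfl
    _ = ∑ β ∈ Finset.univ.map ⟨e, he⟩, ‖U β‖ ^ 2 := by rw [Finset.sum_map]; rfl
    _ ≤ ∑ β, ‖U β‖ ^ 2 :=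
        Finset.sum_le_sum_of_subset_of_nonneg (Finset.subset_univ _) fun _ _ _ => by positivity

/-- The standard injection `H^n_{0,per} → H^m_{0,per}`, `m ≤ n`. -/
def inj {m n : ℕ} (h : m ≤ n) : HPerZero n →L[ℝ] HPerZero m :=
  LinearMap.mkContinuous
    (((Jet.truncate h).comp (HPerZero n).subtype).codRestrict (HPerZero m) fun U =>
      ⟨fun α hα => U.2.1 α (hα.trans h), U.2.2⟩)
    1 fun U => by
      rw [one_mul]
      exact Jet.norm_truncate_le h (U : Jet n)

/-- The dual operator `T^* : L² → S'` of a bounded operator `T : S → L²`, with `L²` identified to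
its own dual. -/
def dualOp {m : ℕ} {S : Submodule ℝ (Jet m)} (T : S →L[ℝ] L2) : L2 →ₗ[ℝ] StrongDual ℝ S where
  toFun g := (innerSL ℝ g).comp T
  map_add' f g := by ext v; simp
  map_smul' c g := by ext v; simp

lemma dualOp_apply {m : ℕ} {S : Submodule ℝ (Jet m)} (T : S →L[ℝ] L2) (g : L2) (v : S) :
    dualOp T g v = ∫ x in cell, T v x * g x := by
  change inner ℝ g (T v) = _
  rw [L2.inner_def]
  rfl

open Classical in
/-- The weak derivative `∂^α f ∈ L²` (zero if there is none in `L²`). -/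
def weakDeriv (α : ℕ × ℕ) (f : L2) : L2 :=
  if h : ∃ g : L2, IsWeakDeriv α f g then h.choose else 0

open Classical in
/-- The class in `L²` of a function on the cell (zero if it is not square integrable). -/
def classL2 (f : ℝ × ℝ → ℝ) : L2 :=
  if h : MemLp f 2 cellMeasure then h.toLp f else 0

/-- The vector field `x ↦ a(x, ∇w(x))`. -/
def field (a : (ℝ × ℝ) × (ℝ × ℝ) → ℝ × ℝ) {s : ℕ} (hs : 5 ≤ s) (w : HPerZero s) :
    ℝ × ℝ → ℝ × ℝ :=
  fun x => a (x, (D (HPerZero s) (1, 0) (by simp; omega) w x,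
    D (HPerZero s) (0, 1) (by simp; omega) w x))

/-- `a₁(x, ∇w)` as an element of `L²`. -/
def fieldOne (a : (ℝ × ℝ) × (ℝ × ℝ) → ℝ × ℝ) {s : ℕ} (hs : 5 ≤ s) (w : HPerZero s) : L2 :=
  classL2 fun x => (field a hs w x).1

/-- `a₂(x, ∇w)` as an element of `L²`. -/
def fieldTwo (a : (ℝ × ℝ) × (ℝ × ℝ) → ℝ × ℝ) {s : ℕ} (hs : 5 ≤ s) (w : HPerZero s) : L2 :=
  classL2 fun x => (field a hs w x).2

/-- `div (a(x, ∇w))` as an element of `L²`. -/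
def divField (a : (ℝ × ℝ) × (ℝ × ℝ) → ℝ × ℝ) {s : ℕ} (hs : 5 ≤ s) (w : HPerZero s) : L2 :=
  weakDeriv (1, 0) (fieldOne a hs w) + weakDeriv (0, 1) (fieldTwo a hs w)

/-- The distributional divergence `div : L² × L² → V'`, dual of `-∇ : V → L² × L²`, where
`V = H^{s+2}_{0,per}`. -/
def divDual (s : ℕ) (g₁ g₂ : L2) : StrongDual ℝ (HPerZero (s + 2)) :=
  -(dualOp (D (HPerZero (s + 2)) (1, 0) (by simp)) g₁
    + dualOp (D (HPerZero (s + 2)) (0, 1) (by simp)) g₂)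

/-- `∂₂^s div ∂₂ : L² × L² → V'`, dual of `(-1)^s ∂₂ ∇ ∂₂^s : V → L² × L²`, where
`V = H^{s+2}_{0,per}`. -/
def dTwoDivDTwoDual (s : ℕ) (g₁ g₂ : L2) : StrongDual ℝ (HPerZero (s + 2)) :=
  (-1 : ℝ) ^ s • (dualOp (D (HPerZero (s + 2)) (1, s + 1) (by simp; omega)) g₁
    + dualOp (D (HPerZero (s + 2)) (0, s + 2) (by simp)) g₂)

/-- The operator `A : H^s_{0,per} → V'`, `V = H^{s+2}_{0,per}`,
`A w = (∂₁^s)^* ∂₁^{s-2} div (a(x,∇w)) - λ₁ (-1)^s ∂₂^s div ∂₂ (∂₂^{s-1} (a(x,∇w)))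
- λ₂ div (a(x,∇w))`. -/
def opA (a : (ℝ × ℝ) × (ℝ × ℝ) → ℝ × ℝ) {s : ℕ} (hs : 5 ≤ s) (lam₁ lam₂ : ℝ)
    (w : HPerZero s) : StrongDual ℝ (HPerZero (s + 2)) :=
  dualOp (D (HPerZero (s + 2)) (s, 0) (by simp)) (weakDeriv (s - 2, 0) (divField a hs w))
    - (lam₁ * (-1) ^ s) • dTwoDivDTwoDual s
        (weakDeriv (0, s - 1) (fieldOne a hs w)) (weakDeriv (0, s - 1) (fieldTwo a hs w))
    - lam₂ • divDual s (fieldOne a hs w) (fieldTwo a hs w)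

/-- The functional `f ∈ (H^s_{0,per})'` built from `h ∈ H^s_per`,
`⟨v, f⟩ = ∫ ∂₁^s v ∂₁^{s-2} h - λ₁ ∫ ∂₂^s v ∂₂^s h - λ₂ ∫ v h`. -/
def rhs (s : ℕ) (lam₁ lam₂ : ℝ) (h : HPer s) : StrongDual ℝ (HPerZero s) :=
  dualOp (D (HPerZero s) (s, 0) (by simp)) (D (HPer s) (s - 2, 0) (by simp) h)
    - lam₁ • dualOp (D (HPerZero s) (0, s) (by simp)) (D (HPer s) (0, s) (by simp) h)
    - lam₂ • dualOp (toL2 (HPerZero s)) (toL2 (HPer s) h)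

/-- The injection `(H^s_{0,per})' → (H^{s+2}_{0,per})'` dual to the standard one. -/
def injDual (s : ℕ) (f : StrongDual ℝ (HPerZero s)) : StrongDual ℝ (HPerZero (s + 2)) :=
  f.comp (inj (Nat.le_add_right s 2))

/-- The linear map `-(∂₁^s)^* ∂₁^{s-2} + λ₁ (-1)^s ∂₂^{2s} + λ₂ : H^{s-2}_per → V'`,
`V = H^{s+2}_{0,per}`. Here `∂₂^{2s} = ∂₂^{s+2} ∂₂^{s-2}`, where `∂₂^{s+2} : L² → V'` is the dual
of `(-1)^{s+2} ∂₂^{s+2} : V → L²`. -/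
def linMap (s : ℕ) (lam₁ lam₂ : ℝ) : HPer (s - 2) →ₗ[ℝ] StrongDual ℝ (HPerZero (s + 2)) :=
  -((dualOp (D (HPerZero (s + 2)) (s, 0) (by simp))).comp
      (D (HPer (s - 2)) (s - 2, 0) (by simp)).toLinearMap)
    + (lam₁ * (-1) ^ s) •
      (dualOp ((-1 : ℝ) ^ (s + 2) • D (HPerZero (s + 2)) (0, s + 2) (by simp))).comp
        (D (HPer (s - 2)) (0, s - 2) (by simp)).toLinearMap
    + lam₂ • (dualOp (toL2 (HPerZero (s + 2)))).comp (toL2 (HPer (s - 2))).toLinearMap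

end ToyProblem

end

open MeasureTheory Set
open scoped ContDiff

noncomputable section

namespace ToyProblem

/-! Regularity. The components of `∇w` have `m = s - 1 ≥ 4` weak derivatives in `L²`, and
superposition with a smooth enough function keeps them (`hasH_superpose`). The proof is an induction
on the order: the chain rule produces products of a superposition with a derivative of `∇w`, and
`HasH.mul` controls these. Both the product rule and the chain rule rest on one approximation
result, `MixedReg.exists_approx`: a function `u` with `∂₁u`, `∂₂u`, `∂₁∂₂u` in `L²` is a limit of
smooth functions, in `L²` with first derivatives and boundedly at every point of the cell.
Boundedness is the elementary estimate of `sup |v|` by the `L¹` norms of `v`, `∂₁v`, `∂₂v`, `∂₁∂₂v`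
(`SmoothPer.abs_le`). Density needs no mollification: an element orthogonal to all smooth functions
is tested with `cos (nπx₁) cos (2πk x₂ + θ)`, integration by parts leaves a positive multiple of its
Fourier coefficient, and this system is complete by Stone–Weierstrass on a cylinder.

Uniqueness. Statements (ii) and (iii) become the same problem for a function `g`, which is `div a(x,
∇w) - h` in (ii) and the given element in (iii). Take `v = φ(x₁) cos (2πk x₂ + θ)` with `φ(0) = φ(1)
= 0`. Since the cosine is an eigenfunction of `∂₂^{2s}`, the Fourier mode `G` of `g` satisfies `∫
G^{(s-2)} φ^{(s)} = c ∫ G φ`, where `c = λ₁(2πk)^{2s} + λ₂ > 0`. The choice `-φ'' = G` gives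
`φ^{(s)} = -G^{(s-2)}`, so `-‖G^{(s-2)}‖² = c‖φ'‖²`; both sides vanish and `G = 0`. The decisive
point is that `φ` has to vanish only to first order at the ends, which the Dirichlet condition in
`V` permits.

`G` is not smooth, so `eq_zero_of_boundary_problem` runs this computation on functions `χₙ → G`,
smooth up to the boundary, with `χₙ^{(m)} → G^{(m)}`, `m = s - 2`. They are `m`-fold primitives
corrected by a polynomial, which the du Bois-Reymond lemma supplies. `eq_zero_of_modes` passes from
the modes back to `g`. -/

/-! ### Calculus on the strip -/

/-- Smooth functions of period `1` in `x₂`. -/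
structure SmoothPer (v : ℝ × ℝ → ℝ) : Prop where
  smooth : ContDiff ℝ ∞ v
  periodic : ∀ x₁ x₂ : ℝ, v (x₁, x₂ + 1) = v (x₁, x₂)

lemma IsTest.smoothPer {φ : ℝ × ℝ → ℝ} (h : IsTest φ) : SmoothPer φ := ⟨h.smooth, h.periodic⟩

lemma hasDerivAt_pdOne {φ : ℝ × ℝ → ℝ} {x : ℝ × ℝ} (h : DifferentiableAt ℝ φ x) :
    HasDerivAt (fun t => φ (t, x.2)) (fderiv ℝ φ x (1, 0)) x.1 := by
  have h1 : HasFDerivAt φ (fderiv ℝ φ x) ((x.1, x.2) : ℝ × ℝ) := h.hasFDerivAt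
  exact h1.comp_hasDerivAt x.1 ((hasDerivAt_id x.1).prodMk (hasDerivAt_const x.1 x.2))

lemma hasDerivAt_pdTwo {φ : ℝ × ℝ → ℝ} {x : ℝ × ℝ} (h : DifferentiableAt ℝ φ x) :
    HasDerivAt (fun t => φ (x.1, t)) (fderiv ℝ φ x (0, 1)) x.2 := by
  have h1 : HasFDerivAt φ (fderiv ℝ φ x) ((x.1, x.2) : ℝ × ℝ) := h.hasFDerivAt
  exact h1.comp_hasDerivAt x.2 ((hasDerivAt_const x.2 x.1).prodMk (hasDerivAt_id x.2))

lemma pdOne_eq_fderiv {φ : ℝ × ℝ → ℝ} {x : ℝ × ℝ} (h : DifferentiableAt ℝ φ x) :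
    pdOne φ x = fderiv ℝ φ x (1, 0) := (hasDerivAt_pdOne h).deriv

lemma pdTwo_eq_fderiv {φ : ℝ × ℝ → ℝ} {x : ℝ × ℝ} (h : DifferentiableAt ℝ φ x) :
    pdTwo φ x = fderiv ℝ φ x (0, 1) := (hasDerivAt_pdTwo h).deriv

lemma pdOne_mul {φ ψ : ℝ × ℝ → ℝ} {x : ℝ × ℝ} (h : DifferentiableAt ℝ φ x)
    (h' : DifferentiableAt ℝ ψ x) :
    pdOne (fun y => φ y * ψ y) x = pdOne φ x * ψ x + φ x * pdOne ψ x := by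
  rw [pdOne_eq_fderiv h, pdOne_eq_fderiv h']
  exact ((hasDerivAt_pdOne h).mul (hasDerivAt_pdOne h')).deriv

lemma pdTwo_mul {φ ψ : ℝ × ℝ → ℝ} {x : ℝ × ℝ} (h : DifferentiableAt ℝ φ x)
    (h' : DifferentiableAt ℝ ψ x) :
    pdTwo (fun y => φ y * ψ y) x = pdTwo φ x * ψ x + φ x * pdTwo ψ x := by
  rw [pdTwo_eq_fderiv h, pdTwo_eq_fderiv h']
  exact ((hasDerivAt_pdTwo h).mul (hasDerivAt_pdTwo h')).deriv

lemma continuous_pdOne {w : ℝ × ℝ → ℝ} (hw : ContDiff ℝ 1 w) : Continuous (pdOne w) := by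
  have e : pdOne w = fun x => fderiv ℝ w x (1, 0) :=
    funext fun x => pdOne_eq_fderiv (hw.differentiable (by simp) x)
  rw [e]
  exact (hw.continuous_fderiv (by simp)).clm_apply continuous_const

lemma continuous_pdTwo {w : ℝ × ℝ → ℝ} (hw : ContDiff ℝ 1 w) : Continuous (pdTwo w) := by
  have e : pdTwo w = fun x => fderiv ℝ w x (0, 1) :=
    funext fun x => pdTwo_eq_fderiv (hw.differentiable (by simp) x)
  rw [e]
  exact (hw.continuous_fderiv (by simp)).clm_apply continuous_const

lemma cell_subset : cell ⊆ Icc (0 : ℝ) 1 ×ˢ Icc (0 : ℝ) 1 :=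
  prod_mono Ioo_subset_Icc_self Ioo_subset_Icc_self

lemma measurableSet_cell : MeasurableSet cell := measurableSet_Ioo.prod measurableSet_Ioo

lemma cellMeasure_eq_prod :
    cellMeasure = (volume.restrict (Ioo (0 : ℝ) 1)).prod (volume.restrict (Ioo (0 : ℝ) 1)) := by
  rw [Measure.prod_restrict]
  rfl

instance : IsProbabilityMeasure (volume.restrict (Ioo (0 : ℝ) 1)) :=
  ⟨by simp⟩

instance : IsProbabilityMeasure cellMeasure := by
  rw [cellMeasure_eq_prod]
  infer_instance

lemma integrableOn_cell_of_continuous {w : ℝ × ℝ → ℝ} (hw : Continuous w) :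
    IntegrableOn w cell :=
  (hw.continuousOn.integrableOn_compact (isCompact_Icc.prod isCompact_Icc)).mono_set cell_subset

lemma integral_cell_eq {w : ℝ × ℝ → ℝ} (hw : IntegrableOn w cell) :
    ∫ x in cell, w x = ∫ t in Ioo (0 : ℝ) 1, ∫ y in Ioo (0 : ℝ) 1, w (t, y) :=
  setIntegral_prod w hw

lemma integral_cell_eq_symm {w : ℝ × ℝ → ℝ} (hw : IntegrableOn w cell) :
    ∫ x in cell, w x = ∫ y in Ioo (0 : ℝ) 1, ∫ t in Ioo (0 : ℝ) 1, w (t, y) := by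
  have hw' : Integrable w
      ((volume.restrict (Ioo (0 : ℝ) 1)).prod (volume.restrict (Ioo (0 : ℝ) 1))) := by
    rw [← cellMeasure_eq_prod]; exact hw
  change ∫ x, w x ∂cellMeasure = _
  rw [cellMeasure_eq_prod, integral_prod_symm _ hw']

lemma integral_Ioo_deriv {f f' : ℝ → ℝ} (h : ∀ t, HasDerivAt f (f' t) t) (hc : Continuous f') :
    ∫ t in Ioo (0 : ℝ) 1, f' t = f 1 - f 0 := by
  rw [← integral_Ioc_eq_integral_Ioo, ← intervalIntegral.integral_of_le zero_le_one]
  exact intervalIntegral.integral_eq_sub_of_hasDerivAt (fun t _ => h t)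
    (hc.intervalIntegrable _ _)

lemma integral_pdOne_eq_zero {w : ℝ × ℝ → ℝ} (hw : ContDiff ℝ 1 w)
    (h : ∀ y, w (1, y) = w (0, y)) : ∫ x in cell, pdOne w x = 0 := by
  have hc := continuous_pdOne hw
  rw [integral_cell_eq_symm (integrableOn_cell_of_continuous hc)]
  refine integral_eq_zero_of_ae (ae_of_all _ fun y => ?_)
  have := integral_Ioo_deriv (f := fun t => w (t, y)) (f' := fun t => pdOne w (t, y))
    (fun t => by
      have hd := hw.differentiable (by simp) (t, y)
      rw [pdOne_eq_fderiv hd]; exact hasDerivAt_pdOne hd)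
    (hc.comp (by fun_prop))
  simpa [h y] using this

lemma integral_pdTwo_eq_zero {w : ℝ × ℝ → ℝ} (hw : ContDiff ℝ 1 w)
    (h : ∀ t, w (t, 1) = w (t, 0)) : ∫ x in cell, pdTwo w x = 0 := by
  have hc := continuous_pdTwo hw
  rw [integral_cell_eq (integrableOn_cell_of_continuous hc)]
  refine integral_eq_zero_of_ae (ae_of_all _ fun t => ?_)
  have := integral_Ioo_deriv (f := fun y => w (t, y)) (f' := fun y => pdTwo w (t, y))
    (fun y => by
      have hd := hw.differentiable (by simp) (t, y)
      rw [pdTwo_eq_fderiv hd]; exact hasDerivAt_pdTwo hd)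
    (hc.comp (by fun_prop))
  simpa [h t] using this

lemma pdTwo_pdOne {φ : ℝ × ℝ → ℝ} (h : ContDiff ℝ ∞ φ) : pdTwo (pdOne φ) = pdOne (pdTwo φ) := by
  have hd := h.differentiable (by simp)
  have e1 : pdOne φ = fun x => fderiv ℝ φ x (1, 0) := funext fun x => pdOne_eq_fderiv (hd x)
  have e2 : pdTwo φ = fun x => fderiv ℝ φ x (0, 1) := funext fun x => pdTwo_eq_fderiv (hd x)
  have hd1 := (contDiff_pdOne h).differentiable (by simp)
  have hd2 := (contDiff_pdTwo h).differentiable (by simp)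
  have hf : Differentiable ℝ (fderiv ℝ φ) :=
    (h.fderiv_right (m := ∞) (by simp)).differentiable (by simp)
  funext x
  rw [pdTwo_eq_fderiv (hd1 x), pdOne_eq_fderiv (hd2 x), e1, e2,
    fderiv_clm_apply (hf x) (differentiableAt_const _),
    fderiv_clm_apply (hf x) (differentiableAt_const _)]
  have hs : IsSymmSndFDerivAt ℝ φ x :=
    h.contDiffAt.isSymmSndFDerivAt (by
      rw [minSmoothness_of_isRCLikeNormedField]; exact WithTop.coe_le_coe.2 (le_top : (2 : ℕ∞) ≤ ⊤))
  simpa using hs.eq (0, 1) (1, 0)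

lemma SmoothPer.pdOne {v : ℝ × ℝ → ℝ} (h : SmoothPer v) : SmoothPer (pdOne v) := by
  refine ⟨contDiff_pdOne h.smooth, fun x₁ x₂ => ?_⟩
  simp only [ToyProblem.pdOne, h.periodic]

lemma SmoothPer.pdTwo {v : ℝ × ℝ → ℝ} (h : SmoothPer v) : SmoothPer (pdTwo v) := by
  refine ⟨contDiff_pdTwo h.smooth, fun x₁ x₂ => ?_⟩
  simp only [ToyProblem.pdTwo]
  rw [← deriv_comp_add_const]
  simp only [h.periodic]

lemma SmoothPer.pd {v : ℝ × ℝ → ℝ} (h : SmoothPer v) (α : ℕ × ℕ) : SmoothPer (pd α v) := by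
  have h2 : ∀ n, SmoothPer (ToyProblem.pdTwo^[n] v) := by
    intro n
    induction n with
    | zero => simpa using h
    | succ n ih => rw [Function.iterate_succ_apply']; exact ih.pdTwo
  have h1 : ∀ n, SmoothPer (ToyProblem.pdOne^[n] (ToyProblem.pdTwo^[α.2] v)) := by
    intro n
    induction n with
    | zero => simpa using h2 α.2
    | succ n ih => rw [Function.iterate_succ_apply']; exact ih.pdOne
  exact h1 α.1

lemma IsTest.pdOne {φ : ℝ × ℝ → ℝ} (h : IsTest φ) : IsTest (pdOne φ) := by
  refine ⟨h.smoothPer.pdOne.smooth, h.smoothPer.pdOne.periodic, ?_⟩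
  obtain ⟨δ, hδ, hs⟩ := h.supported
  refine ⟨δ, hδ, fun x hx => ?_⟩
  by_contra hcon
  refine hx ?_
  have hev : (fun t => φ (t, x.2)) =ᶠ[nhds x.1] fun _ => (0 : ℝ) := by
    have ho : IsOpen {t : ℝ | ¬ (δ ≤ t ∧ t ≤ 1 - δ)} :=
      (isClosed_Icc (a := δ) (b := 1 - δ)).isOpen_compl
    filter_upwards [ho.mem_nhds hcon] with t ht
    by_contra h0
    exact ht (hs _ h0)
  simp [ToyProblem.pdOne, hev.deriv_eq]

lemma IsTest.pdTwo {φ : ℝ × ℝ → ℝ} (h : IsTest φ) : IsTest (pdTwo φ) := by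
  refine ⟨h.smoothPer.pdTwo.smooth, h.smoothPer.pdTwo.periodic, ?_⟩
  obtain ⟨δ, hδ, hs⟩ := h.supported
  refine ⟨δ, hδ, fun x hx => ?_⟩
  by_contra hcon
  refine hx ?_
  have hz : (fun t => φ (x.1, t)) = fun _ => (0 : ℝ) := by
    funext t
    by_contra h0
    exact hcon (hs (x.1, t) h0)
  simp [ToyProblem.pdTwo, hz]

lemma pdTwo_iterate_pdOne {φ : ℝ × ℝ → ℝ} (h : ContDiff ℝ ∞ φ) (n : ℕ) :
    pdTwo^[n] (pdOne φ) = pdOne (pdTwo^[n] φ) := by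
  induction n with
  | zero => rfl
  | succ n ih =>
    rw [Function.iterate_succ_apply', ih, Function.iterate_succ_apply', pdTwo_pdOne]
    exact contDiff_pd h (0, n)

lemma pd_pdOne {φ : ℝ × ℝ → ℝ} (h : ContDiff ℝ ∞ φ) (α : ℕ × ℕ) :
    pd α (pdOne φ) = pd (α.1 + 1, α.2) φ := by
  simp only [pd]
  rw [pdTwo_iterate_pdOne h, Function.iterate_succ_apply]

lemma pd_pdTwo (φ : ℝ × ℝ → ℝ) (α : ℕ × ℕ) : pd α (pdTwo φ) = pd (α.1, α.2 + 1) φ := by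
  simp only [pd]
  rw [Function.iterate_succ_apply]

lemma pd_zero_zero (φ : ℝ × ℝ → ℝ) : pd (0, 0) φ = φ := rfl

lemma pd_one_zero (φ : ℝ × ℝ → ℝ) : pd (1, 0) φ = pdOne φ := rfl

lemma pd_zero_one (φ : ℝ × ℝ → ℝ) : pd (0, 1) φ = pdTwo φ := rfl

lemma pd_add {φ : ℝ × ℝ → ℝ} (h : ContDiff ℝ ∞ φ) (α β : ℕ × ℕ) :
    pd (α + β) φ = pd α (pd β φ) := by
  obtain ⟨a, b⟩ := α
  obtain ⟨c, d⟩ := β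
  induction d generalizing φ with
  | zero =>
    induction c generalizing φ with
    | zero => rfl
    | succ c ih =>
      rw [← pd_pdOne h (c, 0), ← ih (contDiff_pdOne h)]
      exact (pd_pdOne h (a + c, b)).symm
  | succ d ih =>
    rw [← pd_pdTwo φ (c, d), ← ih (contDiff_pdTwo h)]
    exact (pd_pdTwo φ (a + c, b + d)).symm

lemma IsTest.pd {φ : ℝ × ℝ → ℝ} (h : IsTest φ) (α : ℕ × ℕ) : IsTest (pd α φ) := by
  obtain ⟨a, b⟩ := α
  induction b generalizing φ with
  | zero =>
    induction a generalizing φ with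
    | zero => exact h
    | succ a ih => rw [← pd_pdOne h.smooth (a, 0)]; exact ih h.pdOne
  | succ b ih => rw [← pd_pdTwo φ (a, b)]; exact ih h.pdTwo

lemma SmoothPer.mul {v w : ℝ × ℝ → ℝ} (hv : SmoothPer v) (hw : SmoothPer w) :
    SmoothPer fun x => v x * w x :=
  ⟨hv.smooth.mul hw.smooth, fun x₁ x₂ => by rw [hv.periodic, hw.periodic]⟩

lemma SmoothPer.add {v w : ℝ × ℝ → ℝ} (hv : SmoothPer v) (hw : SmoothPer w) :
    SmoothPer fun x => v x + w x :=
  ⟨hv.smooth.add hw.smooth, fun x₁ x₂ => by rw [hv.periodic, hw.periodic]⟩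

lemma SmoothPer.const_mul {v : ℝ × ℝ → ℝ} (hv : SmoothPer v) (c : ℝ) :
    SmoothPer fun x => c * v x :=
  ⟨contDiff_const.mul hv.smooth, fun x₁ x₂ => by rw [hv.periodic]⟩

lemma IsTest.mul_left {v φ : ℝ × ℝ → ℝ} (hv : SmoothPer v) (hφ : IsTest φ) :
    IsTest fun x => v x * φ x := by
  refine ⟨(hv.mul hφ.smoothPer).smooth, (hv.mul hφ.smoothPer).periodic, ?_⟩
  obtain ⟨δ, hδ, hs⟩ := hφ.supported
  exact ⟨δ, hδ, fun x hx => hs x (right_ne_zero_of_mul hx)⟩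

lemma IsTest.eq_zero_at_bdry {φ : ℝ × ℝ → ℝ} (h : IsTest φ) (y : ℝ) :
    φ (0, y) = 0 ∧ φ (1, y) = 0 := by
  obtain ⟨δ, hδ, hs⟩ := h.supported
  constructor
  · by_contra h0
    have := (hs _ h0).1
    simp only at this
    linarith
  · by_contra h0
    have := (hs _ h0).2
    simp only at this
    linarith

/-! ### Products of a function of `x₁` and a function of `x₂` -/

lemma pdOne_sep (φ e : ℝ → ℝ) :
    pdOne (fun x => φ x.1 * e x.2) = fun x => deriv φ x.1 * e x.2 := by
  funext x
  exact deriv_mul_const_field (u := φ) (e x.2)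

lemma pdTwo_sep (φ e : ℝ → ℝ) :
    pdTwo (fun x => φ x.1 * e x.2) = fun x => φ x.1 * deriv e x.2 := by
  funext x
  exact deriv_const_mul_field (v := e) (φ x.1)

lemma pd_sep (φ e : ℝ → ℝ) (α : ℕ × ℕ) :
    pd α (fun x => φ x.1 * e x.2) = fun x => iteratedDeriv α.1 φ x.1 * iteratedDeriv α.2 e x.2 := by
  have h2 : ∀ n, pdTwo^[n] (fun x => φ x.1 * e x.2) = fun x => φ x.1 * iteratedDeriv n e x.2 := by
    intro n
    induction n with
    | zero => simp
    | succ n ih => rw [Function.iterate_succ_apply', ih, pdTwo_sep, iteratedDeriv_succ]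
  have h1 : ∀ n (e : ℝ → ℝ), pdOne^[n] (fun x => φ x.1 * e x.2)
      = fun x => iteratedDeriv n φ x.1 * e x.2 := by
    intro n e
    induction n with
    | zero => simp
    | succ n ih => rw [Function.iterate_succ_apply', ih, pdOne_sep, iteratedDeriv_succ]
  rw [pd, h2, h1]

lemma SmoothPer.sep {φ e : ℝ → ℝ} (hφ : ContDiff ℝ ∞ φ) (he : ContDiff ℝ ∞ e)
    (hp : ∀ y, e (y + 1) = e y) : SmoothPer fun x => φ x.1 * e x.2 :=
  ⟨(hφ.comp contDiff_fst).mul (he.comp contDiff_snd), fun x₁ x₂ => by simp [hp]⟩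

/-- The trigonometric functions `cos (2πk y + θ)`, of period `1`. -/
def trig (k : ℤ) (θ : ℝ) (y : ℝ) : ℝ := Real.cos (2 * Real.pi * k * y + θ)

lemma contDiff_trig (k : ℤ) (θ : ℝ) : ContDiff ℝ ∞ (trig k θ) := by
  unfold trig
  fun_prop

lemma trig_periodic (k : ℤ) (θ : ℝ) (y : ℝ) : trig k θ (y + 1) = trig k θ y := by
  unfold trig
  rw [show 2 * Real.pi * k * (y + 1) + θ = 2 * Real.pi * k * y + θ + k * (2 * Real.pi) by ring,
    Real.cos_add_int_mul_two_pi]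

/-- Differentiation only shifts the phase by `π/2`, so with a free phase `θ` sines and cosines need
no separate treatment. -/
lemma deriv_trig (k : ℤ) (θ : ℝ) :
    deriv (trig k θ) = fun y => 2 * Real.pi * k * trig k (θ + Real.pi / 2) y := by
  funext y
  have h : HasDerivAt (trig k θ) (-Real.sin (2 * Real.pi * k * y + θ) * (2 * Real.pi * k)) y := by
    have h1 : HasDerivAt (fun y : ℝ => 2 * Real.pi * k * y + θ) (2 * Real.pi * k) y := by
      simpa using ((hasDerivAt_id y).const_mul (2 * Real.pi * k)).add_const θ
    exact h1.cos
  rw [h.deriv, trig, ← add_assoc, Real.cos_add_pi_div_two]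
  ring

lemma iteratedDeriv_trig (k : ℤ) (θ : ℝ) (n : ℕ) : iteratedDeriv n (trig k θ)
    = fun y => (2 * Real.pi * k) ^ n * trig k (θ + n * (Real.pi / 2)) y := by
  induction n with
  | zero => simp
  | succ n ih =>
    rw [iteratedDeriv_succ, ih]
    funext y
    rw [deriv_const_mul_field, deriv_trig]
    push_cast
    rw [show θ + (n + 1) * (Real.pi / 2) = θ + n * (Real.pi / 2) + Real.pi / 2 by ring]
    ring

/-- An even number of derivatives shifts the phase by a multiple of `π`, which is a sign: this is
the eigenfunction property behind the equations of the modes. -/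
lemma iteratedDeriv_two_mul_trig (k : ℤ) (θ : ℝ) (n : ℕ) : iteratedDeriv (2 * n) (trig k θ)
    = fun y => (-1) ^ n * (2 * Real.pi * k) ^ (2 * n) * trig k θ y := by
  rw [iteratedDeriv_trig]
  funext y
  have : ((2 * n : ℕ) : ℝ) * (Real.pi / 2) = n * Real.pi := by push_cast; ring
  rw [this, trig, trig, ← add_assoc, Real.cos_add_nat_mul_pi]
  ring

/-! ### Integrals of `L²` functions against bounded functions -/

section Bounded

variable {X : Type*} [MeasurableSpace X] {μ : Measure X}

lemma inner_eq_integral (f g : Lp ℝ 2 μ) : inner ℝ f g = ∫ x, f x * g x ∂μ := by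
  rw [L2.inner_def]
  refine integral_congr_ae (ae_of_all _ fun x => ?_)
  simp [mul_comm]

lemma integrable_mul_memLp (f : Lp ℝ 2 μ) {b : X → ℝ} (hb : MemLp b 2 μ) :
    Integrable (fun x => f x * b x) μ :=
  (Lp.memLp f).integrable_mul hb

lemma integral_mul_toLp (f : Lp ℝ 2 μ) {b : X → ℝ} (hb : MemLp b 2 μ) :
    ∫ x, f x * b x ∂μ = inner ℝ f (hb.toLp b) := by
  rw [inner_eq_integral]
  refine integral_congr_ae ?_
  filter_upwards [hb.coeFn_toLp] with x hx
  rw [hx]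

lemma integral_sub_mul (f g : Lp ℝ 2 μ) {b : X → ℝ} (hb : MemLp b 2 μ) :
    ∫ x, (f - g : Lp ℝ 2 μ) x * b x ∂μ = (∫ x, f x * b x ∂μ) - ∫ x, g x * b x ∂μ := by
  rw [integral_mul_toLp _ hb, integral_mul_toLp _ hb, integral_mul_toLp _ hb, inner_sub_left]

lemma tendsto_integral_mul_left {g : ℕ → Lp ℝ 2 μ} {g₀ : Lp ℝ 2 μ}
    (hg : Filter.Tendsto g Filter.atTop (nhds g₀)) {b : X → ℝ} (hb : MemLp b 2 μ) :
    Filter.Tendsto (fun n => ∫ x, g n x * b x ∂μ) Filter.atTop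
      (nhds (∫ x, g₀ x * b x ∂μ)) := by
  simp only [integral_mul_toLp _ hb]
  exact hg.inner tendsto_const_nhds

variable [IsProbabilityMeasure μ]

/-- Cauchy–Schwarz; as the total mass is one, the `L²` norm of `b` is at most its essential bound.
-/
lemma abs_integral_mul_le (f : Lp ℝ 2 μ) {b : X → ℝ} (hb : AEStronglyMeasurable b μ) {C : ℝ}
    (hC : 0 ≤ C) (h : ∀ᵐ x ∂μ, |b x| ≤ C) : |∫ x, f x * b x ∂μ| ≤ C * ‖f‖ := by
  have hm : MemLp b 2 μ := MemLp.of_bound hb C h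
  rw [integral_mul_toLp f hm]
  have h1 : ‖hm.toLp b‖ ≤ C := by
    have := Lp.norm_le_of_ae_bound (f := hm.toLp b) hC (by
      filter_upwards [hm.coeFn_toLp, h] with x hx hx'
      rw [hx]; exact hx')
    simpa [measureUnivNNReal] using this
  calc |inner ℝ f (hm.toLp b)| ≤ ‖f‖ * ‖hm.toLp b‖ := abs_real_inner_le_norm _ _
    _ ≤ ‖f‖ * C := by gcongr
    _ = C * ‖f‖ := mul_comm _ _

/-- Split the integrand as `(g n - g₀) * b n + g₀ * b n`: the first part is small by the uniform
bound on `b n`, the second converges by dominated convergence. Every passage to the limit in the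
product and chain rules has this form or a special case of it. -/
lemma tendsto_integral_mul {g : ℕ → Lp ℝ 2 μ} {g₀ : Lp ℝ 2 μ}
    (hg : Filter.Tendsto g Filter.atTop (nhds g₀)) {b : ℕ → X → ℝ} {b₀ : X → ℝ}
    (hb : ∀ n, AEStronglyMeasurable (b n) μ) {C : ℝ} (h : ∀ n, ∀ᵐ x ∂μ, |b n x| ≤ C)
    (hlim : ∀ᵐ x ∂μ, Filter.Tendsto (fun n => b n x) Filter.atTop (nhds (b₀ x))) :
    Filter.Tendsto (fun n => ∫ x, g n x * b n x ∂μ) Filter.atTop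
      (nhds (∫ x, g₀ x * b₀ x ∂μ)) := by
  have hC : 0 ≤ C := by
    obtain ⟨x, hx⟩ := (h 0).exists
    exact (abs_nonneg _).trans hx
  have h1 : Filter.Tendsto (fun n => ∫ x, g₀ x * b n x ∂μ) Filter.atTop
      (nhds (∫ x, g₀ x * b₀ x ∂μ)) := by
    have hi : Integrable (fun x => g₀ x) μ := (Lp.memLp g₀).integrable (by norm_num)
    refine tendsto_integral_of_dominated_convergence (fun x => ‖g₀ x‖ * C)
      (fun n => hi.aestronglyMeasurable.mul (hb n)) (hi.norm.mul_const C) (fun n => ?_) ?_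
    · filter_upwards [h n] with x hx
      rw [norm_mul]
      exact mul_le_mul_of_nonneg_left hx (norm_nonneg _)
    · filter_upwards [hlim] with x hx
      exact hx.const_mul _
  have h2 : Filter.Tendsto (fun n => ∫ x, (g n - g₀ : Lp ℝ 2 μ) x * b n x ∂μ) Filter.atTop
      (nhds 0) := by
    have h3 : Filter.Tendsto (fun n => C * ‖g n - g₀‖) Filter.atTop (nhds 0) := by
      have := (tendsto_iff_norm_sub_tendsto_zero.1 hg).const_mul C
      simpa using this
    exact squeeze_zero_norm (fun n => abs_integral_mul_le _ (hb n) hC (h n)) h3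
  have h4 := h2.add h1
  rw [zero_add] at h4
  refine h4.congr fun n => ?_
  rw [integral_sub_mul _ _ (MemLp.of_bound (hb n) C (h n))]
  ring

lemma tendsto_integral_mul_right (g : Lp ℝ 2 μ) {b : ℕ → X → ℝ} {b₀ : X → ℝ}
    (hb : ∀ n, AEStronglyMeasurable (b n) μ) {C : ℝ} (h : ∀ n, ∀ᵐ x ∂μ, |b n x| ≤ C)
    (hlim : ∀ᵐ x ∂μ, Filter.Tendsto (fun n => b n x) Filter.atTop (nhds (b₀ x))) :
    Filter.Tendsto (fun n => ∫ x, g x * b n x ∂μ) Filter.atTop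
      (nhds (∫ x, g x * b₀ x ∂μ)) :=
  tendsto_integral_mul tendsto_const_nhds hb h hlim

end Bounded

lemma ae_cell {p : ℝ × ℝ → Prop} (h : ∀ x ∈ cell, p x) : ∀ᵐ x ∂cellMeasure, p x :=
  (ae_restrict_iff' measurableSet_cell).2 (ae_of_all _ h)

lemma exists_bound_on_cell {w : ℝ × ℝ → ℝ} (hw : Continuous w) :
    ∃ C, 0 ≤ C ∧ ∀ x ∈ Icc (0 : ℝ) 1 ×ˢ Icc (0 : ℝ) 1, |w x| ≤ C := by
  obtain ⟨C, hC⟩ :=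
    (isCompact_Icc.prod isCompact_Icc).exists_bound_of_continuousOn (f := w)
      (s := Icc (0 : ℝ) 1 ×ˢ Icc (0 : ℝ) 1) hw.continuousOn
  exact ⟨|C|, abs_nonneg _, fun x hx => (hC x hx).trans (le_abs_self C)⟩

lemma memLp_of_continuous {w : ℝ × ℝ → ℝ} (hw : Continuous w) : MemLp w 2 cellMeasure := by
  obtain ⟨C, -, hC⟩ := exists_bound_on_cell hw
  exact MemLp.of_bound hw.aestronglyMeasurable C (ae_cell fun x hx => hC x (cell_subset hx))

lemma coeFn_classL2 {w : ℝ × ℝ → ℝ} (hw : MemLp w 2 cellMeasure) : classL2 w =ᵐ[cellMeasure] w := by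
  rw [classL2, dif_pos hw]
  exact hw.coeFn_toLp

lemma classL2_congr {w : ℝ × ℝ → ℝ} {f : L2} (h : w =ᵐ[cellMeasure] f) : classL2 w = f := by
  refine Lp.ext ((coeFn_classL2 ?_).trans h)
  exact (memLp_congr_ae h).2 (Lp.memLp f)

lemma integral_mul_classL2 (f : L2) {w : ℝ × ℝ → ℝ} (hw : MemLp w 2 cellMeasure) :
    ∫ x in cell, f x * w x = inner ℝ f (classL2 w) := by
  rw [classL2, dif_pos hw]
  exact integral_mul_toLp f hw

lemma integral_classL2_mul {w : ℝ × ℝ → ℝ} (hw : MemLp w 2 cellMeasure) (ψ : ℝ × ℝ → ℝ) :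
    ∫ x in cell, classL2 w x * ψ x = ∫ x in cell, w x * ψ x := by
  refine integral_congr_ae ?_
  filter_upwards [coeFn_classL2 hw] with x hx
  rw [hx]

/-! ### Cutoff functions in `x₁` -/

/-- Smooth functions supported in `[1/n, 1 - 1/n]`, converging to `1` on `(0,1)`. -/
def cutoff (n : ℕ) (t : ℝ) : ℝ :=
  Real.smoothTransition (n * t - 1) * Real.smoothTransition (n * (1 - t) - 1)

lemma contDiff_cutoff (n : ℕ) : ContDiff ℝ ∞ (cutoff n) := by
  have h : ContDiff ℝ ∞ Real.smoothTransition := Real.smoothTransition.contDiff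
  exact (h.comp (by fun_prop : ContDiff ℝ ∞ fun t : ℝ => n * t - 1)).mul
    (h.comp (by fun_prop : ContDiff ℝ ∞ fun t : ℝ => n * (1 - t) - 1))

lemma abs_cutoff_le (n : ℕ) (t : ℝ) : |cutoff n t| ≤ 1 := by
  rw [cutoff, abs_of_nonneg
    (mul_nonneg (Real.smoothTransition.nonneg _) (Real.smoothTransition.nonneg _))]
  exact mul_le_one₀ (Real.smoothTransition.le_one _) (Real.smoothTransition.nonneg _)
    (Real.smoothTransition.le_one _)

lemma cutoff_supported (n : ℕ) :
    ∃ δ : ℝ, 0 < δ ∧ ∀ t : ℝ, cutoff n t ≠ 0 → δ ≤ t ∧ t ≤ 1 - δ := by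
  rcases Nat.eq_zero_or_pos n with rfl | hn
  · refine ⟨1, one_pos, fun t ht => absurd ?_ ht⟩
    simp [cutoff, Real.smoothTransition.zero_of_nonpos]
  · have hn' : (0 : ℝ) < n := Nat.cast_pos.2 hn
    refine ⟨1 / n, by positivity, fun t ht => ⟨?_, ?_⟩⟩
    · by_contra hlt
      refine ht (mul_eq_zero_of_left (Real.smoothTransition.zero_of_nonpos ?_) _)
      rw [not_le, lt_div_iff₀ hn'] at hlt
      linarith
    · by_contra hlt
      refine ht (mul_eq_zero_of_right _ (Real.smoothTransition.zero_of_nonpos ?_))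
      have : 1 - t < 1 / n := by linarith
      rw [lt_div_iff₀ hn'] at this
      linarith

lemma eventually_lt_mul {t : ℝ} (ht : 0 < t) (C : ℝ) : ∀ᶠ n : ℕ in Filter.atTop, C < n * t :=
  (tendsto_natCast_atTop_atTop.atTop_mul_const ht).eventually_gt_atTop C

lemma tendsto_cutoff {t : ℝ} (ht : t ∈ Ioo (0 : ℝ) 1) :
    Filter.Tendsto (fun n => cutoff n t) Filter.atTop (nhds 1) := by
  refine tendsto_const_nhds.congr' ?_
  filter_upwards [eventually_lt_mul ht.1 2, eventually_lt_mul (sub_pos.2 ht.2) 2] with n h1 h2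
  rw [cutoff, Real.smoothTransition.one_of_one_le (by linarith),
    Real.smoothTransition.one_of_one_le (by linarith), mul_one]

lemma deriv_smoothTransition_eq_zero {t : ℝ} (ht : t < 0 ∨ 1 < t) :
    deriv Real.smoothTransition t = 0 := by
  rcases ht with ht | ht
  · have : Real.smoothTransition =ᶠ[nhds t] fun _ => 0 := by
      filter_upwards [Iio_mem_nhds ht] with y hy
      exact Real.smoothTransition.zero_of_nonpos (le_of_lt hy)
    simp [this.deriv_eq]
  · have : Real.smoothTransition =ᶠ[nhds t] fun _ => 1 := by
      filter_upwards [Ioi_mem_nhds ht] with y hy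
      exact Real.smoothTransition.one_of_one_le (le_of_lt hy)
    simp [this.deriv_eq]

lemma deriv_cutoff (n : ℕ) (t : ℝ) : deriv (cutoff n) t
    = n * deriv Real.smoothTransition (n * t - 1) * Real.smoothTransition (n * (1 - t) - 1)
      - Real.smoothTransition (n * t - 1)
        * (n * deriv Real.smoothTransition (n * (1 - t) - 1)) := by
  have h : ContDiff ℝ ∞ Real.smoothTransition := Real.smoothTransition.contDiff
  have hd : ∀ y, HasDerivAt Real.smoothTransition (deriv Real.smoothTransition y) y := fun y =>
    (h.differentiable (by simp) y).hasDerivAt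
  have h1 : HasDerivAt (fun t : ℝ => (n : ℝ) * t - 1) n t := by
    simpa using ((hasDerivAt_id t).const_mul (n : ℝ)).sub_const 1
  have h2 : HasDerivAt (fun t : ℝ => (n : ℝ) * (1 - t) - 1) (-n) t := by
    simpa using (((hasDerivAt_id t).const_sub 1).const_mul (n : ℝ)).sub_const 1
  have := ((hd _).comp t h1).mul ((hd _).comp t h2)
  refine this.deriv.trans ?_
  simp only [Function.comp]
  ring

lemma tendsto_deriv_cutoff {t : ℝ} (ht : t ∈ Ioo (0 : ℝ) 1) :
    Filter.Tendsto (fun n => deriv (cutoff n) t) Filter.atTop (nhds 0) := by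
  refine tendsto_const_nhds.congr' ?_
  filter_upwards [eventually_lt_mul ht.1 2, eventually_lt_mul (sub_pos.2 ht.2) 2] with n h1 h2
  rw [deriv_cutoff, deriv_smoothTransition_eq_zero (Or.inr (by linarith)),
    deriv_smoothTransition_eq_zero (Or.inr (by linarith))]
  simp

lemma exists_bound_mul_deriv_smoothTransition :
    ∃ C : ℝ, ∀ t : ℝ, |t * deriv Real.smoothTransition (t - 1)| ≤ C := by
  have h : ContDiff ℝ ∞ Real.smoothTransition := Real.smoothTransition.contDiff
  have hc : Continuous fun t : ℝ => t * deriv Real.smoothTransition (t - 1) :=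
    continuous_id.mul ((h.continuous_deriv (by simp)).comp (continuous_id.sub continuous_const))
  refine hc.bounded_above_of_compact_support
    (HasCompactSupport.intro (isCompact_Icc (a := (1 : ℝ)) (b := 2)) fun t ht => ?_)
  rw [deriv_smoothTransition_eq_zero, mul_zero]
  by_contra hcon
  push Not at hcon
  exact ht ⟨by linarith, by linarith⟩

/-- The derivative of `cutoff n` has size `n`, but only in layers of width of order `1/n` at the two
ends. Multiplied by a quantity dominated by the distance to either end it stays bounded in `n`,
since `n t ψ'(n t - 1)` is a bounded function of `n t` for `ψ` the smooth transition. -/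
lemma exists_bound_mul_deriv_cutoff (M : ℝ) : ∃ C : ℝ, ∀ (n : ℕ) (t z : ℝ), 0 ≤ t → t ≤ 1 →
    |z| ≤ M * t → |z| ≤ M * (1 - t) → |z * deriv (cutoff n) t| ≤ C := by
  obtain ⟨C, hC⟩ := exists_bound_mul_deriv_smoothTransition
  have key : ∀ (n : ℕ) (t z p : ℝ), 0 ≤ t → |z| ≤ M * t → 0 ≤ M → |p| ≤ 1 →
      |z * (n * deriv Real.smoothTransition (n * t - 1)) * p| ≤ M * C := by
    intro n t z p ht hz hM hp
    calc |z * (n * deriv Real.smoothTransition (n * t - 1)) * p|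
        = |z| * |n * deriv Real.smoothTransition (n * t - 1)| * |p| := by rw [abs_mul, abs_mul]
      _ ≤ (M * t) * |n * deriv Real.smoothTransition (n * t - 1)| * 1 := by gcongr
      _ = M * |n * t * deriv Real.smoothTransition (n * t - 1)| := by
          rw [abs_mul (n * t : ℝ), abs_mul (n : ℝ), abs_mul (n : ℝ), abs_of_nonneg ht]; ring
      _ ≤ M * C := by gcongr; exact hC _
  have hst : ∀ y, |Real.smoothTransition y| ≤ 1 := fun y => by
    rw [abs_of_nonneg (Real.smoothTransition.nonneg y)]; exact Real.smoothTransition.le_one y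
  refine ⟨M * C + M * C, fun n t z h0 h1 hz hz' => ?_⟩
  have hM : 0 ≤ M := by
    have : 0 ≤ M * t + M * (1 - t) :=
      add_nonneg ((abs_nonneg z).trans hz) ((abs_nonneg z).trans hz')
    linarith
  rw [deriv_cutoff]
  have e : z * (n * deriv Real.smoothTransition (n * t - 1) *
        Real.smoothTransition (n * (1 - t) - 1)
      - Real.smoothTransition (n * t - 1) * (n * deriv Real.smoothTransition (n * (1 - t) - 1)))
      = z * (n * deriv Real.smoothTransition (n * t - 1)) *
          Real.smoothTransition (n * (1 - t) - 1)
        - z * (n * deriv Real.smoothTransition (n * (1 - t) - 1)) *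
          Real.smoothTransition (n * t - 1) := by ring
  rw [e]
  exact (abs_sub _ _).trans (add_le_add (key n t z _ h0 hz hM (hst _))
    (key n (1 - t) z _ (by linarith) hz' hM (hst _)))

lemma SmoothPer.isTest_cutoff_mul {v : ℝ × ℝ → ℝ} (hv : SmoothPer v) (n : ℕ) :
    IsTest fun x => cutoff n x.1 * v x := by
  refine ⟨((contDiff_cutoff n).comp contDiff_fst).mul hv.smooth,
    fun x₁ x₂ => by rw [hv.periodic], ?_⟩
  obtain ⟨δ, hδ, h⟩ := cutoff_supported n
  exact ⟨δ, hδ, fun x hx => h x.1 (left_ne_zero_of_mul hx)⟩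

lemma tendsto_integral_cutoff_mul (f : L2) {v : ℝ × ℝ → ℝ} (hv : Continuous v) :
    Filter.Tendsto (fun n => ∫ x in cell, f x * (cutoff n x.1 * v x)) Filter.atTop
      (nhds (∫ x in cell, f x * v x)) := by
  obtain ⟨C, hC0, hC⟩ := exists_bound_on_cell hv
  refine tendsto_integral_mul_right (μ := cellMeasure) f (C := C) (fun n => ?_) (fun n => ?_) ?_
  · exact (((contDiff_cutoff n).continuous.comp continuous_fst).mul hv).aestronglyMeasurable
  · refine ae_cell fun x hx => ?_
    rw [abs_mul]
    exact (mul_le_mul (abs_cutoff_le n _) (hC x (cell_subset hx)) (abs_nonneg _)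
      zero_le_one).trans (one_mul C).le
  · refine ae_cell fun x hx => ?_
    simpa using (tendsto_cutoff hx.1).mul_const (v x)

/-- Test functions that need not vanish near `x₁ = 0` and `x₁ = 1` can be used as well when only
derivatives in `x₂` occur. -/
lemma IsWeakDeriv.integral_pd_zero_left {j : ℕ} {f g : L2} (h : IsWeakDeriv (0, j) f g)
    {v : ℝ × ℝ → ℝ} (hv : SmoothPer v) :
    ∫ x in cell, f x * pd (0, j) v x = (-1 : ℝ) ^ j * ∫ x in cell, g x * v x := by
  -- The cutoff depends on `x₁` alone and commutes with `∂₂`.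
  have e : ∀ n, pd (0, j) (fun x => cutoff n x.1 * v x)
      = fun x => cutoff n x.1 * pd (0, j) v x := by
    intro n
    induction j with
    | zero => rfl
    | succ j ih =>
      have ih' : pdTwo^[j] (fun x => cutoff n x.1 * v x)
          = fun x => cutoff n x.1 * pdTwo^[j] v x := by
        clear ih h
        induction j with
        | zero => rfl
        | succ j ih =>
          rw [Function.iterate_succ_apply', ih, Function.iterate_succ_apply']
          funext x
          exact deriv_const_mul_field (v := fun t => pdTwo^[j] v (x.1, t)) (cutoff n x.1)
      change pdTwo^[j + 1] _ = fun x => _ * pdTwo^[j + 1] v x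
      rw [Function.iterate_succ_apply', ih', Function.iterate_succ_apply']
      funext x
      exact deriv_const_mul_field (v := fun t => pdTwo^[j] v (x.1, t)) (cutoff n x.1)
  have h1 := tendsto_integral_cutoff_mul f (hv.pd (0, j)).smooth.continuous
  have h2 := (tendsto_integral_cutoff_mul g hv.smooth.continuous).const_mul ((-1 : ℝ) ^ j)
  refine tendsto_nhds_unique (h1.congr fun n => ?_) h2
  have := h _ (hv.isTest_cutoff_mul n)
  rw [e n] at this
  simpa using this

/-- Integration by parts in `x₁` against smooth functions that vanish at `x₁ = 0` and `x₁ = 1`. -/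
lemma IsWeakDeriv.integral_pdOne {f g : L2} (h : IsWeakDeriv (1, 0) f g)
    {v : ℝ × ℝ → ℝ} (hv : SmoothPer v) (hv0 : ∀ y, v (0, y) = 0) (hv1 : ∀ y, v (1, y) = 0) :
    ∫ x in cell, f x * pdOne v x = - ∫ x in cell, g x * v x := by
  have hd := hv.smooth.differentiable (by simp)
  obtain ⟨M, hM0, hM⟩ := exists_bound_on_cell hv.pdOne.smooth.continuous
  -- The mean value inequality along horizontal lines bounds `|v|` by `M` times the distance to each
  -- boundary component.
  have hline : ∀ y ∈ Ioo (0 : ℝ) 1, ∀ t ∈ Icc (0 : ℝ) 1, ∀ t' ∈ Icc (0 : ℝ) 1,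
      |v (t', y) - v (t, y)| ≤ M * |t' - t| := by
    intro y hy t ht t' ht'
    refine Convex.norm_image_sub_le_of_norm_deriv_le (𝕜 := ℝ) (f := fun t => v (t, y))
      (s := Icc (0 : ℝ) 1) (fun t _ => ?_) (fun t ht => ?_) (convex_Icc 0 1) ht ht'
    · exact (hasDerivAt_pdOne (hd (t, y))).differentiableAt
    · exact hM (t, y) ⟨ht, Ioo_subset_Icc_self hy⟩
  have hb0 : ∀ x ∈ cell, |v x| ≤ M * x.1 := by
    intro x hx
    have := hline x.2 hx.2 0 (by simp) x.1 (Ioo_subset_Icc_self hx.1)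
    rwa [hv0, sub_zero, sub_zero, abs_of_nonneg hx.1.1.le] at this
  have hb1 : ∀ x ∈ cell, |v x| ≤ M * (1 - x.1) := by
    intro x hx
    have := hline x.2 hx.2 x.1 (Ioo_subset_Icc_self hx.1) 1 (by simp)
    rwa [hv1, zero_sub, abs_neg, abs_of_nonneg (sub_nonneg.2 hx.1.2.le)] at this
  obtain ⟨C, hC⟩ := exists_bound_mul_deriv_cutoff M
  -- The term in which the derivative hits the cutoff tends to zero at every point of the cell and
  -- is bounded there uniformly in `n`, because `v` vanishes on the boundary.
  have h0 : Filter.Tendsto (fun n => ∫ x in cell, f x * (v x * deriv (cutoff n) x.1))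
      Filter.atTop (nhds (∫ x in cell, f x * (0 : ℝ))) := by
    refine tendsto_integral_mul_right (μ := cellMeasure) (b₀ := fun _ => 0) f (C := C)
      (fun n => ?_) (fun n => ?_) ?_
    · exact (hv.smooth.continuous.mul (((contDiff_cutoff n).continuous_deriv (by simp)).comp
        continuous_fst)).aestronglyMeasurable
    · exact ae_cell fun x hx => hC n x.1 (v x) hx.1.1.le hx.1.2.le (hb0 x hx) (hb1 x hx)
    · refine ae_cell fun x hx => ?_
      simpa using (tendsto_deriv_cutoff hx.1).const_mul (v x)
  have h1 := tendsto_integral_cutoff_mul f hv.pdOne.smooth.continuous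
  have h2 := (tendsto_integral_cutoff_mul g hv.smooth.continuous).neg
  have h3 := h1.add h0
  simp only [mul_zero, integral_zero, add_zero] at h3
  refine tendsto_nhds_unique (h3.congr fun n => ?_) h2
  have ht := h _ (hv.isTest_cutoff_mul n)
  have e : pd (1, 0) (fun x => cutoff n x.1 * v x)
      = fun x => cutoff n x.1 * pdOne v x + v x * deriv (cutoff n) x.1 := by
    funext x
    have hc : DifferentiableAt ℝ (fun x : ℝ × ℝ => cutoff n x.1) x :=
      ((contDiff_cutoff n).comp contDiff_fst).differentiable (by simp) x
    rw [pd_one_zero, pdOne_mul hc (hd x)]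
    simp only [pdOne]
    ring
  rw [e] at ht
  have ht' : ∫ x in cell, f x * (cutoff n x.1 * pdOne v x + v x * deriv (cutoff n) x.1)
      = - ∫ x in cell, g x * (cutoff n x.1 * v x) := by simpa using ht
  rw [← ht']
  simp only [mul_add]
  exact (integral_add
    (integrable_mul_of_bounded f (((contDiff_cutoff n).continuous.comp continuous_fst).mul
      hv.pdOne.smooth.continuous))
    (integrable_mul_of_bounded f (hv.smooth.continuous.mul
      (((contDiff_cutoff n).continuous_deriv (by simp)).comp continuous_fst)))).symm

/-! ### Completeness of the trigonometric system -/

/-- The functions `cos (nπx₁) cos (2πk x₂ + θ)`. -/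
def cosTrig (n k : ℤ) (θ : ℝ) (x : ℝ × ℝ) : ℝ := Real.cos (n * Real.pi * x.1) * trig k θ x.2

lemma contDiff_cos_mul (n : ℤ) : ContDiff ℝ ∞ fun t : ℝ => Real.cos (n * Real.pi * t) := by
  fun_prop

lemma smoothPer_cosTrig (n k : ℤ) (θ : ℝ) : SmoothPer (cosTrig n k θ) :=
  SmoothPer.sep (contDiff_cos_mul n) (contDiff_trig k θ) (trig_periodic k θ)

instance : Fact ((0 : ℝ) < 1) := ⟨one_pos⟩

/-- The compact cylinder. -/
abbrev Cyl : Type := Icc (0 : ℝ) 1 × AddCircle (1 : ℝ)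

/-- The map from the plane to the cylinder. -/
def toCyl (x : ℝ × ℝ) : Cyl := (projIcc 0 1 zero_le_one x.1, (x.2 : AddCircle (1 : ℝ)))

lemma continuous_toCyl : Continuous toCyl :=
  (continuous_projIcc.comp continuous_fst).prodMk
    ((AddCircle.continuous_mk' 1).comp continuous_snd)

lemma isOpenQuotientMap_cyl :
    IsOpenQuotientMap (Prod.map id (fun y : ℝ => (y : AddCircle (1 : ℝ))) :
      Icc (0 : ℝ) 1 × ℝ → Cyl) :=
  IsOpenQuotientMap.id.prodMap QuotientAddGroup.isOpenQuotientMap_mk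

/-- A continuous function that is periodic in `x₂` defines a function on the cylinder. -/
lemma exists_lift_cyl {q : Icc (0 : ℝ) 1 × ℝ → ℝ} (hq : Continuous q)
    (hp : ∀ t y, q (t, y + 1) = q (t, y)) :
    ∃ Q : C(Cyl, ℝ), ∀ (t : Icc (0 : ℝ) 1) (y : ℝ), Q (t, (y : AddCircle (1 : ℝ))) = q (t, y) := by
  have hper : Function.Periodic (fun (y : ℝ) (t : Icc (0 : ℝ) 1) => q (t, y)) 1 := by
    intro y
    funext t
    exact hp t y
  refine ⟨⟨fun z => hper.lift z.2 z.1, ?_⟩, fun t y => ?_⟩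
  · rw [isOpenQuotientMap_cyl.isQuotientMap.continuous_iff]
    exact hq
  · rfl

lemma exists_cosTrig_cyl (n k : ℤ) (θ : ℝ) :
    ∃ Q : C(Cyl, ℝ), ∀ (t : Icc (0 : ℝ) 1) (y : ℝ),
      Q (t, (y : AddCircle (1 : ℝ))) = cosTrig n k θ (t, y) := by
  refine exists_lift_cyl (q := fun z => cosTrig n k θ (z.1, z.2)) ?_ fun t y => ?_
  · exact (smoothPer_cosTrig n k θ).smooth.continuous.comp (by fun_prop)
  · exact (smoothPer_cosTrig n k θ).periodic _ _

/-- The functions `cos (nπx₁) cos (2πk x₂ + θ)` on the cylinder. -/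
def cylTrig (p : ℤ × ℤ × ℝ) : C(Cyl, ℝ) := (exists_cosTrig_cyl p.1 p.2.1 p.2.2).choose

lemma cylTrig_apply (p : ℤ × ℤ × ℝ) (t : Icc (0 : ℝ) 1) (y : ℝ) :
    cylTrig p (t, (y : AddCircle (1 : ℝ))) = cosTrig p.1 p.2.1 p.2.2 (t, y) :=
  (exists_cosTrig_cyl p.1 p.2.1 p.2.2).choose_spec t y

lemma ext_cyl {Q R : C(Cyl, ℝ)}
    (h : ∀ (t : Icc (0 : ℝ) 1) (y : ℝ), Q (t, (y : AddCircle (1 : ℝ))) = R (t, y)) : Q = R := by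
  ext ⟨t, z⟩
  induction z using QuotientAddGroup.induction_on with
  | H y => exact h t y

lemma cos_mul_cos_eq (A B : ℝ) :
    Real.cos A * Real.cos B = (Real.cos (A + B) + Real.cos (A - B)) / 2 := by
  rw [Real.cos_add, Real.cos_sub]
  ring

/-- The product-to-sum formula in each variable: the span of these functions is therefore an
algebra, as Stone–Weierstrass requires. -/
lemma cylTrig_mul (p q : ℤ × ℤ × ℝ) : cylTrig p * cylTrig q
    = (4⁻¹ : ℝ) • (cylTrig (p + q) + cylTrig (p.1 - q.1, p.2 + q.2)
      + (cylTrig (p.1 + q.1, p.2 - q.2) + cylTrig (p - q))) := by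
  refine ext_cyl fun t y => ?_
  simp only [ContinuousMap.mul_apply, ContinuousMap.smul_apply, ContinuousMap.add_apply,
    cylTrig_apply, cosTrig, trig, Prod.fst_add, Prod.snd_add, Prod.fst_sub, Prod.snd_sub,
    smul_eq_mul]
  have h1 := cos_mul_cos_eq (p.1 * Real.pi * t) (q.1 * Real.pi * t)
  have h2 := cos_mul_cos_eq (2 * Real.pi * p.2.1 * y + p.2.2) (2 * Real.pi * q.2.1 * y + q.2.2)
  rw [mul_mul_mul_comm, h1, h2]
  push_cast
  ring_nf

/-- The span of the trigonometric functions, a subalgebra. -/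
def cylAlg : Subalgebra ℝ C(Cyl, ℝ) :=
  (Submodule.span ℝ (range cylTrig)).toSubalgebra
    (by
      refine Submodule.subset_span ⟨0, ext_cyl fun t y => ?_⟩
      simp [cylTrig_apply, cosTrig, trig])
    (by
      intro x y hx hy
      have h := Submodule.mul_mem_mul hx hy
      rw [Submodule.span_mul_span] at h
      refine Submodule.span_le.2 ?_ h
      rintro _ ⟨_, ⟨p, rfl⟩, _, ⟨q, rfl⟩, rfl⟩
      change cylTrig p * cylTrig q ∈ Submodule.span ℝ (range cylTrig)
      rw [cylTrig_mul]
      have hm : ∀ r, cylTrig r ∈ Submodule.span ℝ (range cylTrig) := fun r =>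
        Submodule.subset_span ⟨r, rfl⟩
      exact Submodule.smul_mem _ _
        (add_mem (add_mem (hm _) (hm _)) (add_mem (hm _) (hm _))))

lemma cylTrig_mem (p : ℤ × ℤ × ℝ) : cylTrig p ∈ cylAlg := Submodule.subset_span ⟨p, rfl⟩

/-- `cos (πt)` is injective on `[0,1]`, which is why the frequencies in `x₁` are multiples of `π`;
the points of the circle are separated by the phases `0` and `-π/2`, that is, by cosine and sine. -/
lemma cylAlg_separatesPoints : cylAlg.SeparatesPoints := by
  rintro ⟨t, z⟩ ⟨t', z'⟩ hne
  by_contra hcon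
  have hall : ∀ p, cylTrig p (t, z) = cylTrig p (t', z') := by
    intro p
    by_contra hp
    exact hcon ⟨cylTrig p, ⟨cylTrig p, cylTrig_mem p, rfl⟩, hp⟩
  induction z using QuotientAddGroup.induction_on with | H y => ?_
  induction z' using QuotientAddGroup.induction_on with | H y' => ?_
  simp only [cylTrig_apply] at hall
  apply hne
  have h1 : t = t' := by
    have := hall (1, 0, 0)
    simp only [cosTrig, trig] at this
    have hc : Real.cos (Real.pi * t) = Real.cos (Real.pi * t') := by simpa using this
    have hmem : ∀ s : Icc (0 : ℝ) 1, Real.pi * s ∈ Icc 0 Real.pi := fun s =>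
      ⟨mul_nonneg Real.pi_pos.le s.2.1, mul_le_of_le_one_right Real.pi_pos.le s.2.2⟩
    exact Subtype.ext (mul_left_cancel₀ Real.pi_ne_zero
      (Real.injOn_cos (hmem t) (hmem t') hc))
  have h2 : (y : AddCircle (1 : ℝ)) = y' := by
    have hc := hall (0, 1, 0)
    have hs := hall (0, 1, -(Real.pi / 2))
    simp only [cosTrig, trig, ← sub_eq_add_neg, Real.cos_sub_pi_div_two] at hc hs
    have hc' : Real.cos (2 * Real.pi * y) = Real.cos (2 * Real.pi * y') := by simpa using hc
    have hs' : Real.sin (2 * Real.pi * y) = Real.sin (2 * Real.pi * y') := by simpa using hs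
    have h3 : Real.cos (2 * Real.pi * y - 2 * Real.pi * y') = 1 := by
      rw [Real.cos_sub, hc', hs', ← sq, ← sq, Real.cos_sq_add_sin_sq]
    obtain ⟨n, hn⟩ := (Real.cos_eq_one_iff _).1 h3
    have h4 : (n : ℝ) = y - y' := by
      have : (2 * Real.pi) * n = (2 * Real.pi) * (y - y') := by linarith
      exact mul_left_cancel₀ (by positivity) this
    rw [← sub_eq_zero, ← AddCircle.coe_sub, AddCircle.coe_eq_zero_iff]
    exact ⟨n, by simpa using h4⟩
  exact Prod.ext h1 h2

lemma cylAlg_dense (Q : C(Cyl, ℝ)) : Q ∈ cylAlg.topologicalClosure := by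
  rw [ContinuousMap.subalgebra_topologicalClosure_eq_top_of_separatesPoints _
    cylAlg_separatesPoints]
  trivial

lemma continuous_comp_toCyl (Q : C(Cyl, ℝ)) : Continuous fun x => Q (toCyl x) :=
  Q.continuous.comp continuous_toCyl

/-- Integration of functions on the cylinder against an `L²` function. -/
def cylPairing (f : L2) : C(Cyl, ℝ) →L[ℝ] ℝ :=
  LinearMap.mkContinuous
    { toFun := fun Q => ∫ x in cell, f x * Q (toCyl x)
      map_add' := fun Q R => by
        simp only [ContinuousMap.add_apply, mul_add]
        exact integral_add (integrable_mul_of_bounded f (continuous_comp_toCyl Q))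
          (integrable_mul_of_bounded f (continuous_comp_toCyl R))
      map_smul' := fun c Q => by
        simp only [ContinuousMap.smul_apply, smul_eq_mul, RingHom.id_apply]
        rw [← integral_const_mul]
        refine integral_congr_ae (ae_of_all _ fun x => ?_)
        ring }
    ‖f‖ fun Q => by
      refine (abs_integral_mul_le (μ := cellMeasure) f
        (continuous_comp_toCyl Q).aestronglyMeasurable (norm_nonneg Q)
        (ae_of_all _ fun x => Q.norm_coe_le_norm _)).trans_eq (mul_comm _ _)

lemma toCyl_of_mem {x : ℝ × ℝ} (hx : x ∈ cell) :
    toCyl x = (⟨x.1, Ioo_subset_Icc_self hx.1⟩, (x.2 : AddCircle (1 : ℝ))) := by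
  rw [toCyl, projIcc_of_mem]

lemma cylPairing_eq_zero {f : L2}
    (h : ∀ (n k : ℤ) (θ : ℝ), ∫ x in cell, f x * cosTrig n k θ x = 0) : cylPairing f = 0 := by
  have h1 : ∀ Q ∈ cylAlg, cylPairing f Q = 0 := by
    intro Q hQ
    have hle : Submodule.span ℝ (range cylTrig) ≤ LinearMap.ker (cylPairing f).toLinearMap := by
      rw [Submodule.span_le]
      rintro _ ⟨p, rfl⟩
      refine LinearMap.mem_ker.2 (Eq.trans ?_ (h p.1 p.2.1 p.2.2))
      refine setIntegral_congr_fun measurableSet_cell fun x hx => ?_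
      simp only [toCyl_of_mem hx, cylTrig_apply]
    exact hle hQ
  ext Q
  have hcl : IsClosed {R : C(Cyl, ℝ) | cylPairing f R = 0} :=
    isClosed_eq (cylPairing f).continuous continuous_const
  exact closure_minimal (s := (cylAlg : Set C(Cyl, ℝ))) h1 hcl (cylAlg_dense Q)

/-- The trigonometric system is complete in `L²`. -/
lemma eq_zero_of_integral_cosTrig {f : L2}
    (h : ∀ (n k : ℤ) (θ : ℝ), ∫ x in cell, f x * cosTrig n k θ x = 0) : f = 0 := by
  have h0 := cylPairing_eq_zero h
  have hcell : IsOpen cell := isOpen_Ioo.prod isOpen_Ioo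
  have hint : IntegrableOn (fun x => f x) cell := (Lp.memLp f).integrable (by norm_num)
  have hae : ∀ᵐ x ∂(volume : Measure (ℝ × ℝ)), x ∈ cell → f x = 0 := by
    refine hcell.ae_eq_zero_of_integral_contDiff_smul_eq_zero hint.locallyIntegrableOn ?_
    intro ψ hψ _ hsupp
    have hzero : ∀ x ∉ cell, ψ x = 0 := fun x hx =>
      image_eq_zero_of_notMem_tsupport fun hx' => hx (hsupp hx')
    -- A test function supported in the open cell vanishes at `x₂ = 0` and `x₂ = 1`, so its periodic
    -- extension through `Int.fract` is continuous and descends to the cylinder.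
    have hfr : Continuous fun z : Icc (0 : ℝ) 1 × ℝ => ψ ((z.1 : ℝ), Int.fract z.2) := by
      refine ContinuousOn.comp_fract' (f := fun (t : Icc (0 : ℝ) 1) y => ψ ((t : ℝ), y)) ?_ ?_
      · exact (hψ.continuous.comp (by fun_prop :
          Continuous fun z : Icc (0 : ℝ) 1 × ℝ => ((z.1 : ℝ), z.2))).continuousOn
      · intro t
        rw [hzero _ fun hc => lt_irrefl _ hc.2.1, hzero _ fun hc => lt_irrefl _ hc.2.2]
    obtain ⟨Q, hQ⟩ := exists_lift_cyl hfr fun t y => by simp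
    have h2 : cylPairing f Q = 0 := by rw [h0]; rfl
    rw [← setIntegral_eq_integral_of_forall_compl_eq_zero (s := cell)
      fun x hx => by rw [hzero x hx, zero_smul]]
    refine Eq.trans (setIntegral_congr_fun measurableSet_cell fun x hx => ?_) h2
    simp only [toCyl_of_mem hx, hQ, smul_eq_mul]
    rw [Int.fract_eq_self.2 ⟨hx.2.1.le, hx.2.2⟩, mul_comm]
  refine Lp.ext ?_
  filter_upwards [(ae_restrict_iff' measurableSet_cell).2 hae,
    Lp.coeFn_zero ℝ 2 cellMeasure] with x hx hx'
  rw [hx, hx', Pi.zero_apply]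

/-! ### Weak derivatives -/

/-- Cutoffs of the trigonometric functions are test functions and converge boundedly to them, so
completeness of that system applies. -/
lemma eq_zero_of_integral_test {f : L2}
    (h : ∀ φ, IsTest φ → ∫ x in cell, f x * φ x = 0) : f = 0 := by
  refine eq_zero_of_integral_cosTrig fun n k θ => ?_
  have h1 := tendsto_integral_cutoff_mul f (smoothPer_cosTrig n k θ).smooth.continuous
  refine tendsto_nhds_unique h1 (tendsto_const_nhds.congr fun j => ?_)
  exact (h _ ((smoothPer_cosTrig n k θ).isTest_cutoff_mul j)).symm

lemma SmoothPer.memLp {v : ℝ × ℝ → ℝ} (hv : SmoothPer v) : MemLp v 2 cellMeasure :=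
  memLp_of_continuous hv.smooth.continuous

lemma IsTest.memLp {v : ℝ × ℝ → ℝ} (hv : IsTest v) : MemLp v 2 cellMeasure :=
  memLp_of_continuous hv.smooth.continuous

/-- In this form the condition is visibly linear and closed in the pair `(f, g)`. -/
lemma isWeakDeriv_iff_inner {α : ℕ × ℕ} {f g : L2} : IsWeakDeriv α f g ↔ ∀ φ, IsTest φ →
    inner ℝ f (classL2 (pd α φ)) = (-1 : ℝ) ^ (α.1 + α.2) * inner ℝ g (classL2 φ) := by
  refine forall₂_congr fun φ hφ => ?_
  rw [integral_mul_classL2 _ hφ.memLp, integral_mul_classL2 _ (hφ.pd α).memLp]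

lemma IsWeakDeriv.unique {α : ℕ × ℕ} {f g g' : L2} (h : IsWeakDeriv α f g)
    (h' : IsWeakDeriv α f g') : g = g' := by
  rw [← sub_eq_zero]
  refine eq_zero_of_integral_test fun φ hφ => ?_
  have h1 := h φ hφ
  rw [h' φ hφ] at h1
  rw [integral_sub_mul (μ := cellMeasure) _ _ hφ.memLp, sub_eq_zero]
  exact (mul_left_cancel₀ (pow_ne_zero _ (by norm_num)) h1).symm

lemma weakDeriv_eq {α : ℕ × ℕ} {f g : L2} (h : IsWeakDeriv α f g) : weakDeriv α f = g := by
  have hex : ∃ g : L2, IsWeakDeriv α f g := ⟨g, h⟩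
  rw [weakDeriv, dif_pos hex]
  exact hex.choose_spec.unique h

lemma IsWeakDeriv.refl (f : L2) : IsWeakDeriv (0, 0) f f := fun φ _ => by simp [pd_zero_zero]

lemma IsWeakDeriv.add {α : ℕ × ℕ} {f g f' g' : L2} (h : IsWeakDeriv α f g)
    (h' : IsWeakDeriv α f' g') : IsWeakDeriv α (f + f') (g + g') := by
  rw [isWeakDeriv_iff_inner] at *
  intro φ hφ
  rw [inner_add_left, inner_add_left, h φ hφ, h' φ hφ, mul_add]

lemma IsWeakDeriv.smul {α : ℕ × ℕ} {f g : L2} (c : ℝ) (h : IsWeakDeriv α f g) :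
    IsWeakDeriv α (c • f) (c • g) := by
  rw [isWeakDeriv_iff_inner] at *
  intro φ hφ
  rw [real_inner_smul_left, real_inner_smul_left, h φ hφ]
  ring

lemma IsWeakDeriv.sub {α : ℕ × ℕ} {f g f' g' : L2} (h : IsWeakDeriv α f g)
    (h' : IsWeakDeriv α f' g') : IsWeakDeriv α (f - f') (g - g') := by
  simpa [sub_eq_add_neg] using h.add (h'.smul (-1))

lemma IsWeakDeriv.comp {α β : ℕ × ℕ} {f g h : L2} (hfg : IsWeakDeriv α f g)
    (hgh : IsWeakDeriv β g h) : IsWeakDeriv (α + β) f h := by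
  intro φ hφ
  rw [pd_add hφ.smooth, hfg _ (hφ.pd β), hgh _ hφ, ← mul_assoc, ← pow_add]
  congr 2
  simp only [Prod.fst_add, Prod.snd_add]
  ring

lemma IsWeakDeriv.cancel {α β : ℕ × ℕ} {f g h : L2} (hfg : IsWeakDeriv α f g)
    (hfh : IsWeakDeriv (α + β) f h) : IsWeakDeriv β g h := by
  intro φ hφ
  have h1 := hfh φ hφ
  rw [pd_add hφ.smooth, hfg _ (hφ.pd β)] at h1
  have h2 : (-1 : ℝ) ^ ((α + β).1 + (α + β).2)
      = (-1 : ℝ) ^ (α.1 + α.2) * (-1 : ℝ) ^ (β.1 + β.2) := by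
    rw [← pow_add]
    congr 1
    simp only [Prod.fst_add, Prod.snd_add]
    ring
  rw [h2, mul_assoc] at h1
  exact mul_left_cancel₀ (pow_ne_zero _ (by norm_num)) h1

lemma isClosed_isWeakDeriv (α : ℕ × ℕ) : IsClosed {p : L2 × L2 | IsWeakDeriv α p.1 p.2} := by
  simp only [isWeakDeriv_iff_inner, ofPred_forall]
  refine isClosed_iInter fun φ => isClosed_iInter fun _ => isClosed_eq ?_ ?_
  · exact continuous_fst.inner continuous_const
  · exact continuous_const.mul (continuous_snd.inner continuous_const)

/-- The support of `φ` stays away from `x₁ = 0, 1`, so regularity of `u` in the open strip suffices.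
This matters for superpositions, whose outer function is only controlled on `dom`. -/
lemma IsTest.contDiff_mul {φ u : ℝ × ℝ → ℝ} (hφ : IsTest φ)
    (hu : ∀ x : ℝ × ℝ, x.1 ∈ Ioo (0 : ℝ) 1 → ContDiffAt ℝ 1 u x) :
    ContDiff ℝ 1 fun x => u x * φ x := by
  obtain ⟨δ, hδ, hs⟩ := hφ.supported
  rw [contDiff_iff_contDiffAt]
  intro x
  by_cases hx : x.1 ∈ Ioo (0 : ℝ) 1
  · exact (hu x hx).mul (hφ.smooth.of_le (by simp)).contDiffAt
  · have hev : (fun x => u x * φ x) =ᶠ[nhds x] fun _ => (0 : ℝ) := by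
      have ho : IsOpen {y : ℝ × ℝ | y.1 ∉ Icc δ (1 - δ)} :=
        (isClosed_Icc.preimage continuous_fst).isOpen_compl
      have hmem : x ∈ {y : ℝ × ℝ | y.1 ∉ Icc δ (1 - δ)} := fun hx' =>
        hx ⟨by linarith [hx'.1], by linarith [hx'.2]⟩
      filter_upwards [ho.mem_nhds hmem] with y hy
      by_contra h0
      exact hy (hs y (right_ne_zero_of_mul h0))
    exact contDiffAt_const.congr_of_eventuallyEq hev

/-! ### Weak derivatives of smooth functions -/

lemma isWeakDeriv_pdOne {u : ℝ × ℝ → ℝ} (hu : SmoothPer u) :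
    IsWeakDeriv (1, 0) (classL2 u) (classL2 (pdOne u)) := by
  intro φ hφ
  rw [integral_classL2_mul hu.memLp, integral_classL2_mul hu.pdOne.memLp, pd_one_zero]
  have hc := hφ.contDiff_mul (u := u) fun x _ => (hu.smooth.of_le (by simp)).contDiffAt
  have h0 := integral_pdOne_eq_zero hc fun y => by
    rw [(hφ.eq_zero_at_bdry y).1, (hφ.eq_zero_at_bdry y).2, mul_zero, mul_zero]
  have e : ∀ x, pdOne (fun x => u x * φ x) x = pdOne u x * φ x + u x * pdOne φ x := fun x =>
    pdOne_mul (hu.smooth.differentiable (by simp) x) (hφ.smooth.differentiable (by simp) x)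
  simp only [e] at h0
  have hadd := integral_add (μ := cellMeasure) (f := fun x => pdOne u x * φ x)
    (g := fun x => u x * pdOne φ x)
    (integrableOn_cell_of_continuous (hu.pdOne.smooth.continuous.mul hφ.smooth.continuous))
    (integrableOn_cell_of_continuous (hu.smooth.continuous.mul hφ.pdOne.smooth.continuous))
  rw [hadd] at h0
  simp only [add_zero, pow_one]
  linarith

lemma isWeakDeriv_pdTwo {u : ℝ × ℝ → ℝ} (hu : SmoothPer u) :
    IsWeakDeriv (0, 1) (classL2 u) (classL2 (pdTwo u)) := by
  intro φ hφ
  rw [integral_classL2_mul hu.memLp, integral_classL2_mul hu.pdTwo.memLp, pd_zero_one]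
  have hc := hφ.contDiff_mul (u := u) fun x _ => (hu.smooth.of_le (by simp)).contDiffAt
  have h0 := integral_pdTwo_eq_zero hc fun t => by
    have h1 := hu.periodic t 0
    have h2 := hφ.periodic t 0
    rw [zero_add] at h1 h2
    rw [h1, h2]
  have e : ∀ x, pdTwo (fun x => u x * φ x) x = pdTwo u x * φ x + u x * pdTwo φ x := fun x =>
    pdTwo_mul (hu.smooth.differentiable (by simp) x) (hφ.smooth.differentiable (by simp) x)
  simp only [e] at h0
  have hadd := integral_add (μ := cellMeasure) (f := fun x => pdTwo u x * φ x)
    (g := fun x => u x * pdTwo φ x)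
    (integrableOn_cell_of_continuous (hu.pdTwo.smooth.continuous.mul hφ.smooth.continuous))
    (integrableOn_cell_of_continuous (hu.smooth.continuous.mul hφ.pdTwo.smooth.continuous))
  rw [hadd] at h0
  simp only [zero_add, pow_one]
  linarith

/-- Classical derivatives are weak derivatives. -/
lemma SmoothPer.isWeakDeriv {u : ℝ × ℝ → ℝ} (hu : SmoothPer u) (α : ℕ × ℕ) :
    IsWeakDeriv α (classL2 u) (classL2 (ToyProblem.pd α u)) := by
  obtain ⟨a, b⟩ := α
  induction a with
  | zero =>
    induction b with
    | zero => exact IsWeakDeriv.refl _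
    | succ b ih =>
      have h := ih.comp (isWeakDeriv_pdTwo (hu.pd (0, b)))
      rwa [← pd_zero_one, ← pd_add hu.smooth, Prod.mk_add_mk, Prod.mk_add_mk, add_comm 1 b] at h
  | succ a ih =>
    have h := ih.comp (isWeakDeriv_pdOne (hu.pd (a, b)))
    rwa [← pd_one_zero, ← pd_add hu.smooth, Prod.mk_add_mk, Prod.mk_add_mk, add_comm 1 a,
      zero_add, add_zero] at h

lemma classL2_add {v w : ℝ × ℝ → ℝ} (hv : MemLp v 2 cellMeasure) (hw : MemLp w 2 cellMeasure) :
    classL2 (fun x => v x + w x) = classL2 v + classL2 w := by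
  refine classL2_congr ?_
  filter_upwards [coeFn_classL2 hv, coeFn_classL2 hw, Lp.coeFn_add (classL2 v) (classL2 w)]
    with x h1 h2 h3
  rw [h3, Pi.add_apply, h1, h2]

lemma classL2_const_mul (c : ℝ) {v : ℝ × ℝ → ℝ} (hv : MemLp v 2 cellMeasure) :
    classL2 (fun x => c * v x) = c • classL2 v := by
  refine classL2_congr ?_
  filter_upwards [coeFn_classL2 hv, Lp.coeFn_smul c (classL2 v)] with x h1 h3
  rw [h3, Pi.smul_apply, h1, smul_eq_mul]

/-! ### Functions with a square integrable mixed derivative -/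

/-- `u₁, u₂, u₁₂` are the weak derivatives `∂₁u, ∂₂u, ∂₁∂₂u`. -/
structure MixedReg (u u₁ u₂ u₁₂ : L2) : Prop where
  one : IsWeakDeriv (1, 0) u u₁
  two : IsWeakDeriv (0, 1) u u₂
  mixed : IsWeakDeriv (1, 1) u u₁₂

lemma MixedReg.sub {u u₁ u₂ u₁₂ v v₁ v₂ v₁₂ : L2} (hu : MixedReg u u₁ u₂ u₁₂)
    (hv : MixedReg v v₁ v₂ v₁₂) : MixedReg (u - v) (u₁ - v₁) (u₂ - v₂) (u₁₂ - v₁₂) :=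
  ⟨hu.one.sub hv.one, hu.two.sub hv.two, hu.mixed.sub hv.mixed⟩

/-- Quadruples of `L²` functions. -/
abbrev Quad : Type := PiLp 2 (fun _ : Fin 4 => L2)

/-- The quadruple of the class of `v` and of its derivatives `∂₁v, ∂₂v, ∂₁∂₂v`. -/
def quad (v : ℝ × ℝ → ℝ) : Quad :=
  WithLp.toLp 2 ![classL2 v, classL2 (pdOne v), classL2 (pdTwo v), classL2 (pd (1, 1) v)]

lemma SmoothPer.mixedReg {v : ℝ × ℝ → ℝ} (hv : SmoothPer v) :
    MixedReg (quad v 0) (quad v 1) (quad v 2) (quad v 3) :=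
  ⟨hv.isWeakDeriv (1, 0), hv.isWeakDeriv (0, 1), hv.isWeakDeriv (1, 1)⟩

/-- The first entry determines the others by uniqueness of weak derivatives, so linearity of `quad`
needs checking only on the function itself. -/
lemma quad_eq_of_mixedReg {v : ℝ × ℝ → ℝ} (hv : SmoothPer v) {U : Quad} (h0 : U 0 = classL2 v)
    (hU : MixedReg (U 0) (U 1) (U 2) (U 3)) : quad v = U := by
  have h := hv.mixedReg
  have e : quad v 0 = U 0 := h0.symm
  rw [e] at h
  ext1 i
  fin_cases i
  · exact e
  · exact h.one.unique hU.one
  · exact h.two.unique hU.two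
  · exact h.mixed.unique hU.mixed

lemma quad_add {v w : ℝ × ℝ → ℝ} (hv : SmoothPer v) (hw : SmoothPer w) :
    quad (fun x => v x + w x) = quad v + quad w :=
  quad_eq_of_mixedReg (hv.add hw) (classL2_add hv.memLp hw.memLp).symm
    ⟨hv.mixedReg.one.add hw.mixedReg.one, hv.mixedReg.two.add hw.mixedReg.two,
      hv.mixedReg.mixed.add hw.mixedReg.mixed⟩

lemma quad_const_mul (c : ℝ) {v : ℝ × ℝ → ℝ} (hv : SmoothPer v) :
    quad (fun x => c * v x) = c • quad v :=
  quad_eq_of_mixedReg (hv.const_mul c) (classL2_const_mul c hv.memLp).symm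
    ⟨hv.mixedReg.one.smul c, hv.mixedReg.two.smul c, hv.mixedReg.mixed.smul c⟩

lemma smoothPer_zero : SmoothPer fun _ => 0 := ⟨contDiff_const, fun _ _ => rfl⟩

/-- The quadruples of smooth functions. -/
def smoothQuad : Submodule ℝ Quad where
  carrier := {U | ∃ v, SmoothPer v ∧ quad v = U}
  add_mem' := by
    rintro _ _ ⟨v, hv, rfl⟩ ⟨w, hw, rfl⟩
    exact ⟨_, hv.add hw, quad_add hv hw⟩
  zero_mem' := ⟨_, smoothPer_zero, by simpa using quad_const_mul 0 smoothPer_zero⟩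
  smul_mem' := by
    rintro c _ ⟨v, hv, rfl⟩
    exact ⟨_, hv.const_mul c, quad_const_mul c hv⟩

lemma isClosed_mixedReg : IsClosed {U : Quad | MixedReg (U 0) (U 1) (U 2) (U 3)} := by
  have hc : ∀ i j : Fin 4, Continuous fun U : Quad => (U i, U j) := fun i j => by fun_prop
  have e : {U : Quad | MixedReg (U 0) (U 1) (U 2) (U 3)}
      = {U : Quad | IsWeakDeriv (1, 0) (U 0) (U 1)} ∩ {U : Quad | IsWeakDeriv (0, 1) (U 0) (U 2)}
        ∩ {U : Quad | IsWeakDeriv (1, 1) (U 0) (U 3)} := by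
    ext U
    exact ⟨fun h => ⟨⟨h.one, h.two⟩, h.mixed⟩, fun h => ⟨h.1.1, h.1.2, h.2⟩⟩
  rw [e]
  exact (((isClosed_isWeakDeriv (1, 0)).preimage (hc 0 1)).inter
    ((isClosed_isWeakDeriv (0, 1)).preimage (hc 0 2))).inter
    ((isClosed_isWeakDeriv (1, 1)).preimage (hc 0 3))

lemma cosTrig_pdOne (n k : ℤ) (θ : ℝ) : pdOne (cosTrig n k θ)
    = fun x => -(n * Real.pi) * Real.sin (n * Real.pi * x.1) * trig k θ x.2 := by
  refine (pdOne_sep (fun t : ℝ => Real.cos (n * Real.pi * t)) (trig k θ)).trans ?_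
  funext x
  have h := ((hasDerivAt_id x.1).const_mul (n * Real.pi : ℝ)).cos
  simp only [id, mul_one] at h
  rw [h.deriv]
  ring

lemma cosTrig_pdOne_pdOne (n k : ℤ) (θ : ℝ) :
    pdOne (pdOne (cosTrig n k θ)) = fun x => -(n * Real.pi) ^ 2 * cosTrig n k θ x := by
  rw [cosTrig_pdOne]
  refine (pdOne_sep (fun t : ℝ => -(n * Real.pi) * Real.sin (n * Real.pi * t)) (trig k θ)).trans ?_
  funext x
  have h := (((hasDerivAt_id x.1).const_mul (n * Real.pi : ℝ)).sin).const_mul (-(n * Real.pi))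
  simp only [id, mul_one] at h
  rw [h.deriv, cosTrig]
  ring

lemma cosTrig_pdOne_bdry (n k : ℤ) (θ y : ℝ) :
    pdOne (cosTrig n k θ) (0, y) = 0 ∧ pdOne (cosTrig n k θ) (1, y) = 0 := by
  rw [cosTrig_pdOne]
  simp [Real.sin_int_mul_pi]

lemma cosTrig_pdTwo (n k : ℤ) (θ : ℝ) : pdTwo (cosTrig n k θ)
    = fun x => 2 * Real.pi * k * cosTrig n k (θ + Real.pi / 2) x := by
  refine (pdTwo_sep (fun t : ℝ => Real.cos (n * Real.pi * t)) (trig k θ)).trans ?_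
  rw [deriv_trig]
  funext x
  simp only [cosTrig]
  ring

lemma cosTrig_add_pi (n k : ℤ) (θ : ℝ) (x : ℝ × ℝ) :
    cosTrig n k (θ + Real.pi) x = - cosTrig n k θ x := by
  simp only [cosTrig, trig, ← add_assoc, Real.cos_add_pi]
  ring

/-- `∂₁` of the cosine vanishes at `x₁ = 0, 1`, so the integration by parts has no boundary term
although `z` satisfies no boundary condition. This is the reason for cosines, rather than sines, in
`x₁`. -/
lemma inner_pdOne_cosTrig {z z₁ : L2} (h : IsWeakDeriv (1, 0) z z₁) (n k : ℤ) (θ : ℝ) :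
    ∫ x in cell, z₁ x * pdOne (cosTrig n k θ) x
      = (n * Real.pi) ^ 2 * ∫ x in cell, z x * cosTrig n k θ x := by
  have h1 := h.integral_pdOne (smoothPer_cosTrig n k θ).pdOne
    (fun y => (cosTrig_pdOne_bdry n k θ y).1) (fun y => (cosTrig_pdOne_bdry n k θ y).2)
  rw [cosTrig_pdOne_pdOne] at h1
  have h2 : ∫ x in cell, z x * (-(n * Real.pi) ^ 2 * cosTrig n k θ x)
      = -(n * Real.pi) ^ 2 * ∫ x in cell, z x * cosTrig n k θ x := by
    rw [← integral_const_mul]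
    congr 1
    funext x
    ring
  rw [h2] at h1
  linarith

lemma inner_pdTwo_cosTrig {z z₂ : L2} (h : IsWeakDeriv (0, 1) z z₂) (n k : ℤ) (θ : ℝ) :
    ∫ x in cell, z₂ x * pdTwo (cosTrig n k θ) x
      = (2 * Real.pi * k) ^ 2 * ∫ x in cell, z x * cosTrig n k θ x := by
  have h1 := h.integral_pd_zero_left (smoothPer_cosTrig n k θ).pdTwo
  rw [pd_zero_one] at h1
  have h2 : ∫ x in cell, z x * pdTwo (pdTwo (cosTrig n k θ)) x
      = -(2 * Real.pi * k) ^ 2 * ∫ x in cell, z x * cosTrig n k θ x := by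
    rw [← integral_const_mul]
    congr 1
    funext x
    have e : pdTwo (pdTwo (cosTrig n k θ)) x = -(2 * Real.pi * k) ^ 2 * cosTrig n k θ x := by
      rw [cosTrig_pdTwo]
      change deriv (fun t => 2 * Real.pi * k * cosTrig n k (θ + Real.pi / 2) (x.1, t)) x.2 = _
      rw [deriv_const_mul_field]
      change 2 * Real.pi * k * pdTwo (cosTrig n k (θ + Real.pi / 2)) x = _
      rw [cosTrig_pdTwo]
      simp only
      rw [show θ + Real.pi / 2 + Real.pi / 2 = θ + Real.pi by ring, cosTrig_add_pi]
      ring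
    rw [e]
    ring
  rw [h2] at h1
  simp only [pow_one] at h1
  linarith

lemma inner_mixed_cosTrig {z₂ z₁₂ : L2} (h : IsWeakDeriv (1, 0) z₂ z₁₂) (n k : ℤ) (θ : ℝ) :
    ∫ x in cell, z₁₂ x * pd (1, 1) (cosTrig n k θ) x
      = (n * Real.pi) ^ 2 * ∫ x in cell, z₂ x * pdTwo (cosTrig n k θ) x := by
  have e : pd (1, 1) (cosTrig n k θ)
      = fun x => 2 * Real.pi * k * pdOne (cosTrig n k (θ + Real.pi / 2)) x := by
    change pdOne (pdTwo (cosTrig n k θ)) = _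
    rw [cosTrig_pdTwo]
    funext x
    exact deriv_const_mul_field (v := fun t => cosTrig n k (θ + Real.pi / 2) (t, x.2)) _
  have h1 := inner_pdOne_cosTrig h n k (θ + Real.pi / 2)
  rw [e, cosTrig_pdTwo]
  have h2 : ∀ (f : L2) (w : ℝ × ℝ → ℝ), ∫ x in cell, f x * (2 * Real.pi * k * w x)
      = 2 * Real.pi * k * ∫ x in cell, f x * w x := by
    intro f w
    rw [← integral_const_mul]
    congr 1
    funext x
    ring
  rw [h2, h2, h1]
  ring

lemma eq_zero_of_orthogonal_smoothQuad {U : Quad} (hU : MixedReg (U 0) (U 1) (U 2) (U 3))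
    (h : ∀ v, SmoothPer v → inner ℝ U (quad v) = 0) : U = 0 := by
  have h21 : IsWeakDeriv (1, 0) (U 2) (U 3) := hU.two.cancel hU.mixed
  have h0 : U 0 = 0 := by
    refine eq_zero_of_integral_cosTrig fun n k θ => ?_
    have hs := smoothPer_cosTrig n k θ
    have h1 := h _ hs
    rw [PiLp.inner_apply, Fin.sum_univ_four] at h1
    change inner ℝ (U 0) (classL2 _) + inner ℝ (U 1) (classL2 _) + inner ℝ (U 2) (classL2 _)
      + inner ℝ (U 3) (classL2 _) = 0 at h1
    rw [← integral_mul_classL2 _ hs.memLp, ← integral_mul_classL2 _ hs.pdOne.memLp,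
      ← integral_mul_classL2 _ hs.pdTwo.memLp, ← integral_mul_classL2 _ (hs.pd (1, 1)).memLp,
      inner_mixed_cosTrig h21, inner_pdTwo_cosTrig hU.two, inner_pdOne_cosTrig hU.one] at h1
    -- The four inner products are multiples of one Fourier coefficient, with factors `1`, `(nπ)²`,
    -- `(2πk)²` and `(nπ)²(2πk)²`.
    have h2 : (1 + (n * Real.pi) ^ 2) * (1 + (2 * Real.pi * k) ^ 2)
        * ∫ x in cell, U 0 x * cosTrig n k θ x = 0 := by linarith
    exact (mul_eq_zero.1 h2).resolve_left (by positivity)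
  have hz : ∀ α, IsWeakDeriv α (0 : L2) 0 := fun α => by
    simpa using (smoothPer_zero.isWeakDeriv α).smul 0
  rw [h0] at hU
  ext1 i
  fin_cases i
  · exact h0
  · exact hU.one.unique (hz _)
  · exact hU.two.unique (hz _)
  · exact hU.mixed.unique (hz _)

/-- Smooth functions are dense. -/
lemma mem_closure_smoothQuad {U : Quad} (hU : MixedReg (U 0) (U 1) (U 2) (U 3)) :
    U ∈ smoothQuad.topologicalClosure := by
  set K := smoothQuad.topologicalClosure with hK
  have : CompleteSpace K := smoothQuad.isClosed_topologicalClosure.completeSpace_coe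
  have hPK : K.starProjection U ∈ K := K.starProjection_apply_mem U
  have hP : MixedReg (K.starProjection U 0) (K.starProjection U 1) (K.starProjection U 2)
      (K.starProjection U 3) := by
    refine closure_minimal (s := (smoothQuad : Set Quad)) ?_ isClosed_mixedReg hPK
    rintro _ ⟨v, hv, rfl⟩
    exact hv.mixedReg
  -- The difference is orthogonal to the smooth quadruples and, since `MixedReg` is a closed linear
  -- condition, still consists of a function and its weak derivatives.
  have hz : U - K.starProjection U = 0 := by
    refine eq_zero_of_orthogonal_smoothQuad (hU.sub hP) fun v hv => ?_
    have h1 := K.sub_starProjection_mem_orthogonal U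
    rw [Submodule.mem_orthogonal'] at h1
    exact h1 _ (smoothQuad.le_topologicalClosure ⟨v, hv, rfl⟩)
  rw [sub_eq_zero] at hz
  rw [hz]
  exact hPK

/-! ### The uniform bound -/

/-- Average `|f t| ≤ |f r| + ∫ |f'|` over `r` in the unit interval. -/
lemma abs_le_integral_add {f f' : ℝ → ℝ} (h : ∀ t, HasDerivAt f (f' t) t) (hc : Continuous f')
    {t : ℝ} (ht : t ∈ Icc (0 : ℝ) 1) : |f t| ≤ ∫ r in Ioo (0 : ℝ) 1, (|f r| + |f' r|) := by
  have hfc : Continuous f := continuous_iff_continuousAt.2 fun t => (h t).continuousAt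
  have hi : ∀ {g : ℝ → ℝ}, Continuous g → IntegrableOn g (Ioo (0 : ℝ) 1) := fun hg =>
    (hg.continuousOn.integrableOn_compact isCompact_Icc).mono_set Ioo_subset_Icc_self
  set I := ∫ r in Ioo (0 : ℝ) 1, |f' r| with hI
  have h1 : ∀ r ∈ Ioo (0 : ℝ) 1, |f t| ≤ |f r| + I := by
    intro r hr
    have h2 : ∫ y in r..t, f' y = f t - f r :=
      intervalIntegral.integral_eq_sub_of_hasDerivAt (fun y _ => h y) (hc.intervalIntegrable _ _)
    have h3 : |f t - f r| ≤ I := by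
      rw [← h2, hI, ← integral_Ioc_eq_integral_Ioo]
      refine (intervalIntegral.norm_integral_le_integral_norm_uIoc (f := f') (a := r) (b := t)
        (μ := volume)).trans ?_
      refine setIntegral_mono_set ?_ (ae_of_all _ fun y => abs_nonneg _) ?_
      · exact (hc.abs.continuousOn.integrableOn_compact isCompact_Icc).mono_set Ioc_subset_Icc_self
      · refine (Ioc_subset_Ioc ?_ ?_).eventuallyLE
        · exact le_min hr.1.le ht.1
        · exact max_le hr.2.le ht.2
    calc |f t| = |f r + (f t - f r)| := by ring_nf
      _ ≤ |f r| + |f t - f r| := abs_add_le _ _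
      _ ≤ |f r| + I := by gcongr
  have h4 : ∫ _ in Ioo (0 : ℝ) 1, |f t| ≤ ∫ r in Ioo (0 : ℝ) 1, (|f r| + I) :=
    setIntegral_mono_on (hi continuous_const) (hi (by fun_prop)) measurableSet_Ioo h1
  rw [integral_add (hi hfc.abs) (hi hc.abs)]
  rw [integral_add (hi hfc.abs) (hi continuous_const)] at h4
  simpa using h4

lemma integral_abs_le_norm {w : ℝ × ℝ → ℝ} (hw : MemLp w 2 cellMeasure) :
    ∫ x in cell, |w x| ≤ ‖classL2 w‖ := by
  have h1 := abs_integral_mul_le (μ := cellMeasure) |classL2 w| (b := fun _ => 1)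
    aestronglyMeasurable_const zero_le_one (by simp)
  rw [norm_abs_eq_norm, one_mul] at h1
  refine le_trans (le_of_eq ?_) ((le_abs_self _).trans h1)
  refine integral_congr_ae ?_
  filter_upwards [coeFn_classL2 hw, Lp.coeFn_abs (classL2 w)] with x h2 h3
  rw [h3, h2, mul_one]

/-- The one-dimensional estimate in `x₁` and then in `x₂` bounds the value by four `L¹` norms, those
of `v`, `∂₁v`, `∂₂v`, `∂₁∂₂v`; each is at most the norm of `quad v`, hence the factor `4`. -/
lemma SmoothPer.abs_le {v : ℝ × ℝ → ℝ} (hv : SmoothPer v) {x : ℝ × ℝ}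
    (hx : x ∈ Icc (0 : ℝ) 1 ×ˢ Icc (0 : ℝ) 1) : |v x| ≤ 4 * ‖quad v‖ := by
  have hi : ∀ {g : ℝ → ℝ}, Continuous g → IntegrableOn g (Ioo (0 : ℝ) 1) := fun hg =>
    (hg.continuousOn.integrableOn_compact isCompact_Icc).mono_set Ioo_subset_Icc_self
  have hline : ∀ {u : ℝ × ℝ → ℝ}, SmoothPer u → ∀ t, |u (t, x.2)|
      ≤ ∫ y in Ioo (0 : ℝ) 1, (|u (t, y)| + |ToyProblem.pdTwo u (t, y)|) := by
    intro u hu t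
    refine abs_le_integral_add (f := fun y => u (t, y))
      (f' := fun y => ToyProblem.pdTwo u (t, y)) (fun y => ?_)
      (hu.pdTwo.smooth.continuous.comp (by fun_prop)) hx.2
    have hd := hu.smooth.differentiable (by simp) (t, y)
    rw [pdTwo_eq_fderiv hd]
    exact hasDerivAt_pdTwo hd
  have hcell : ∀ {u : ℝ × ℝ → ℝ}, SmoothPer u → IntegrableOn (fun x => |u x|) cell := fun hu =>
    integrableOn_cell_of_continuous hu.smooth.continuous.abs
  have hdouble : ∀ {u : ℝ × ℝ → ℝ}, SmoothPer u → ∫ t in Ioo (0 : ℝ) 1, |u (t, x.2)|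
      ≤ ‖classL2 u‖ + ‖classL2 (ToyProblem.pdTwo u)‖ := by
    intro u hu
    have h1 : IntegrableOn (fun x => |u x| + |ToyProblem.pdTwo u x|) cell :=
      (hcell hu).add (hcell hu.pdTwo)
    refine le_trans (integral_mono_of_nonneg (ae_of_all _ fun t => abs_nonneg _) ?_
      (ae_of_all _ (hline hu))) ?_
    · rw [IntegrableOn, ← cellMeasure, cellMeasure_eq_prod] at h1
      exact h1.integral_prod_left
    · rw [← integral_cell_eq h1, integral_add (hcell hu) (hcell hu.pdTwo)]
      exact add_le_add (integral_abs_le_norm hu.memLp) (integral_abs_le_norm hu.pdTwo.memLp)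
  have h1 : |v x| ≤ ∫ t in Ioo (0 : ℝ) 1, (|v (t, x.2)| + |ToyProblem.pdOne v (t, x.2)|) := by
    refine abs_le_integral_add (f := fun t => v (t, x.2))
      (f' := fun t => ToyProblem.pdOne v (t, x.2)) (fun t => ?_)
      (hv.pdOne.smooth.continuous.comp (by fun_prop)) hx.1
    have hd := hv.smooth.differentiable (by simp) (t, x.2)
    rw [pdOne_eq_fderiv hd]
    exact hasDerivAt_pdOne hd
  have hadd := integral_add (hi (hv.smooth.continuous.comp
      (by fun_prop : Continuous fun t : ℝ => (t, x.2))).abs)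
    (hi (hv.pdOne.smooth.continuous.comp (by fun_prop : Continuous fun t : ℝ => (t, x.2))).abs)
  have h1 := h1.trans_eq hadd
  simp only [Function.comp_apply] at h1
  have h2 := add_le_add (hdouble hv) (hdouble hv.pdOne)
  rw [pdTwo_pdOne hv.smooth] at h2
  have hn : ∀ i, ‖quad v i‖ ≤ ‖quad v‖ := fun i => PiLp.norm_apply_le _ i
  have n0 : ‖classL2 v‖ ≤ ‖quad v‖ := hn 0
  have n1 : ‖classL2 (ToyProblem.pdOne v)‖ ≤ ‖quad v‖ := hn 1
  have n2 : ‖classL2 (ToyProblem.pdTwo v)‖ ≤ ‖quad v‖ := hn 2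
  have n3 : ‖classL2 (ToyProblem.pdOne (ToyProblem.pdTwo v))‖ ≤ ‖quad v‖ := hn 3
  linarith

/-- Functions with a square integrable mixed derivative are limits of smooth functions, in `L²`
together with their first derivatives and boundedly pointwise on the closed cell. -/
lemma MixedReg.exists_approx {u u₁ u₂ u₁₂ : L2} (h : MixedReg u u₁ u₂ u₁₂) :
    ∃ (v : ℕ → ℝ × ℝ → ℝ) (P : ℝ × ℝ → ℝ) (C : ℝ), (∀ n, SmoothPer (v n)) ∧
      Filter.Tendsto (fun n => classL2 (v n)) Filter.atTop (nhds u) ∧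
      Filter.Tendsto (fun n => classL2 (pdOne (v n))) Filter.atTop (nhds u₁) ∧
      Filter.Tendsto (fun n => classL2 (pdTwo (v n))) Filter.atTop (nhds u₂) ∧
      (∀ n, ∀ x ∈ Icc (0 : ℝ) 1 ×ˢ Icc (0 : ℝ) 1, |v n x| ≤ C) ∧
      (∀ x ∈ cell, Filter.Tendsto (fun n => v n x) Filter.atTop (nhds (P x))) ∧
      u =ᵐ[cellMeasure] P := by
  set U : Quad := WithLp.toLp 2 ![u, u₁, u₂, u₁₂] with hUdef
  have hU : U ∈ closure (smoothQuad : Set Quad) := mem_closure_smoothQuad (U := U) h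
  obtain ⟨W, hW, hlim⟩ := mem_closure_iff_seq_limit.1 hU
  choose v hv hvW using hW
  have hcoord : ∀ i : Fin 4, Filter.Tendsto (fun n => quad (v n) i) Filter.atTop (nhds (U i)) := by
    intro i
    have hc : Continuous fun V : Quad => V i := by fun_prop
    simp only [hvW]
    exact (hc.tendsto U).comp hlim
  have hsub : ∀ n m, ∀ x ∈ Icc (0 : ℝ) 1 ×ˢ Icc (0 : ℝ) 1,
      |v n x - v m x| ≤ 4 * ‖W n - W m‖ := by
    intro n m x hx
    have h1 := (hv n).add ((hv m).const_mul (-1))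
    have h2 := h1.abs_le hx
    rw [quad_add (hv n) ((hv m).const_mul (-1)), quad_const_mul (-1) (hv m), hvW, hvW] at h2
    simpa [← sub_eq_add_neg] using h2
  have hcauchy : ∀ x ∈ Icc (0 : ℝ) 1 ×ˢ Icc (0 : ℝ) 1, CauchySeq fun n => v n x := by
    intro x hx
    have h1 : CauchySeq fun n => (4 : ℝ) • W n := (hlim.const_smul (4 : ℝ)).cauchySeq
    rw [Metric.cauchySeq_iff] at h1 ⊢
    intro ε hε
    obtain ⟨N, hN⟩ := h1 ε hε
    refine ⟨N, fun m hm n hn => lt_of_le_of_lt ?_ (hN m hm n hn)⟩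
    rw [Real.dist_eq, dist_eq_norm, ← smul_sub, norm_smul]
    simpa using hsub m n x hx
  obtain ⟨C, hC⟩ := hlim.norm.bddAbove_range
  have hbd : ∀ n, ∀ x ∈ Icc (0 : ℝ) 1 ×ˢ Icc (0 : ℝ) 1, |v n x| ≤ 4 * C := by
    intro n x hx
    refine ((hv n).abs_le hx).trans ?_
    rw [hvW]
    have := hC ⟨n, rfl⟩
    gcongr
  choose! P hP using fun x (hx : x ∈ Icc (0 : ℝ) 1 ×ˢ Icc (0 : ℝ) 1) =>
    cauchySeq_tendsto_of_complete (hcauchy x hx)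
  have hPcell : ∀ x ∈ cell, Filter.Tendsto (fun n => v n x) Filter.atTop (nhds (P x)) :=
    fun x hx => hP x (cell_subset hx)
  refine ⟨v, P, 4 * C, hv, hcoord 0, hcoord 1, hcoord 2, hbd, hPcell, ?_⟩
  have hPm : AEStronglyMeasurable P cellMeasure :=
    aestronglyMeasurable_of_tendsto_ae Filter.atTop
      (fun n => (hv n).smooth.continuous.aestronglyMeasurable) (ae_cell hPcell)
  have hPmem : MemLp P 2 cellMeasure := MemLp.of_bound hPm (4 * C) (ae_cell fun x hx =>
    le_of_tendsto (hPcell x hx).norm (Filter.Eventually.of_forall fun n =>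
      hbd n x (cell_subset hx)))
  -- The `L²` limit and the pointwise limit agree because they give the same integrals against test
  -- functions.
  have hueq : u - classL2 P = 0 := by
    refine eq_zero_of_integral_test fun φ hφ => ?_
    rw [integral_sub_mul (μ := cellMeasure) _ _ hφ.memLp, sub_eq_zero]
    have h1 : Filter.Tendsto (fun n => ∫ x in cell, classL2 (v n) x * φ x) Filter.atTop
        (nhds (∫ x in cell, u x * φ x)) :=
      tendsto_integral_mul_left (μ := cellMeasure) (hcoord 0) hφ.memLp
    have h2 : Filter.Tendsto (fun n => ∫ x in cell, classL2 φ x * v n x) Filter.atTop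
        (nhds (∫ x in cell, classL2 φ x * P x)) :=
      tendsto_integral_mul_right (μ := cellMeasure) _
        (fun n => (hv n).smooth.continuous.aestronglyMeasurable)
        (fun n => ae_cell fun x hx => hbd n x (cell_subset hx)) (ae_cell hPcell)
    have e : ∀ {w : ℝ × ℝ → ℝ}, MemLp w 2 cellMeasure →
        ∫ x in cell, classL2 w x * φ x = ∫ x in cell, classL2 φ x * w x := by
      intro w hw
      rw [integral_classL2_mul hw, integral_classL2_mul hφ.memLp]
      simp only [mul_comm]
    simp only [e (hv _).memLp] at h1
    rw [e hPmem]
    exact tendsto_nhds_unique h1 h2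
  rw [sub_eq_zero] at hueq
  rw [hueq]
  exact coeFn_classL2 hPmem

/-! ### The product rule -/

/-- The multi-indices of order one. -/
def IsUnitIdx (α : ℕ × ℕ) : Prop := α = (1, 0) ∨ α = (0, 1)

lemma IsUnitIdx.sum_eq {α : ℕ × ℕ} (h : IsUnitIdx α) : α.1 + α.2 = 1 := by
  rcases h with rfl | rfl <;> rfl

lemma pd_mul_of_isUnitIdx {α : ℕ × ℕ} (hα : IsUnitIdx α) {u v : ℝ × ℝ → ℝ} {x : ℝ × ℝ}
    (hu : DifferentiableAt ℝ u x) (hv : DifferentiableAt ℝ v x) :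
    pd α (fun y => u y * v y) x = pd α u x * v x + u x * pd α v x := by
  rcases hα with rfl | rfl
  · exact pdOne_mul hu hv
  · exact pdTwo_mul hu hv

lemma MixedReg.exists_approx_pd {u u₁ u₂ u₁₂ : L2} (h : MixedReg u u₁ u₂ u₁₂) :
    ∃ (v : ℕ → ℝ × ℝ → ℝ) (P : ℝ × ℝ → ℝ) (C : ℝ), (∀ n, SmoothPer (v n)) ∧
      (∀ α uα, IsUnitIdx α → IsWeakDeriv α u uα →
        Filter.Tendsto (fun n => classL2 (pd α (v n))) Filter.atTop (nhds uα)) ∧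
      (∀ n, ∀ x ∈ Icc (0 : ℝ) 1 ×ˢ Icc (0 : ℝ) 1, |v n x| ≤ C) ∧
      (∀ x ∈ cell, Filter.Tendsto (fun n => v n x) Filter.atTop (nhds (P x))) ∧
      u =ᵐ[cellMeasure] P := by
  obtain ⟨v, P, C, hv, -, h1, h2, hbd, hlim, hP⟩ := h.exists_approx
  refine ⟨v, P, C, hv, fun α uα hα hd => ?_, hbd, hlim, hP⟩
  rcases hα with rfl | rfl
  · rw [hd.unique h.one]
    exact h1
  · rw [hd.unique h.two]
    exact h2

lemma MixedReg.exists_ae_bound {u u₁ u₂ u₁₂ : L2} (h : MixedReg u u₁ u₂ u₁₂) :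
    ∃ C, ∀ᵐ x ∂cellMeasure, |u x| ≤ C := by
  obtain ⟨v, P, C, -, -, hbd, hlim, hP⟩ := h.exists_approx_pd
  refine ⟨C, ?_⟩
  filter_upwards [hP, ae_cell hlim, ae_cell fun x hx n => hbd n x (cell_subset hx)]
    with x h1 h2 h3
  rw [h1]
  exact le_of_tendsto h2.abs (Filter.Eventually.of_forall h3)

lemma memLp_mul_of_bound {u : ℝ × ℝ → ℝ} (v : L2) (hu : AEStronglyMeasurable u cellMeasure) {C : ℝ}
    (h : ∀ᵐ x ∂cellMeasure, |u x| ≤ C) : MemLp (fun x => u x * v x) 2 cellMeasure :=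
  (Lp.memLp v).of_le_mul (c := C) (hu.mul (Lp.memLp v).1) (by
    filter_upwards [h] with x hx
    rw [norm_mul]
    exact mul_le_mul_of_nonneg_right hx (norm_nonneg _))

lemma IsTest.exists_bound {φ : ℝ × ℝ → ℝ} (hφ : IsTest φ) : ∃ C, ∀ᵐ x ∂cellMeasure, |φ x| ≤ C := by
  obtain ⟨C, -, hC⟩ := exists_bound_on_cell hφ.smooth.continuous
  exact ⟨C, ae_cell fun x hx => hC x (cell_subset hx)⟩

lemma integrable_mul_mul_of_continuous (f : L2) {v φ : ℝ × ℝ → ℝ} (hv : Continuous v)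
    (hφ : Continuous φ) : Integrable (fun x => f x * (v x * φ x)) cellMeasure :=
  integrable_mul_of_bounded f (hv.mul hφ)

/-- The product rule. -/
lemma MixedReg.isWeakDeriv_mul {u u₁ u₂ u₁₂ v f uα vα g : L2} (h : MixedReg u u₁ u₂ u₁₂)
    {α : ℕ × ℕ} (hα : IsUnitIdx α) (hu : IsWeakDeriv α u uα) (hv : IsWeakDeriv α v vα)
    (hf : f =ᵐ[cellMeasure] fun x => u x * v x)
    (hg : g =ᵐ[cellMeasure] fun x => uα x * v x + u x * vα x) : IsWeakDeriv α f g := by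
  intro φ hφ
  obtain ⟨w, P, C, hw, hwα, hbd, hlim, hP⟩ := h.exists_approx_pd
  have hpφ := hφ.pd α
  have hdom : ∀ (q : L2) {ψ : ℝ × ℝ → ℝ}, IsTest ψ →
      Filter.Tendsto (fun n => ∫ x in cell, q x * (w n x * ψ x)) Filter.atTop
        (nhds (∫ x in cell, q x * (P x * ψ x))) := by
    intro q ψ hψ
    obtain ⟨B, hB0, hB⟩ := exists_bound_on_cell hψ.smooth.continuous
    refine tendsto_integral_mul_right (μ := cellMeasure) q (C := C * B)
      (fun n => ((hw n).smooth.continuous.mul hψ.smooth.continuous).aestronglyMeasurable)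
      (fun n => ae_cell fun x hx => ?_) (ae_cell fun x hx => (hlim x hx).mul_const _)
    rw [abs_mul]
    exact mul_le_mul (hbd n x (cell_subset hx)) (hB x (cell_subset hx)) (abs_nonneg _)
      ((abs_nonneg _).trans (hbd n x (cell_subset hx)))
  have hvφ : MemLp (fun x => v x * φ x) 2 cellMeasure := by
    obtain ⟨B, hB⟩ := hφ.exists_bound
    refine (memLp_congr_ae (ae_of_all _ fun x => ?_)).1
      (memLp_mul_of_bound v hφ.smooth.continuous.aestronglyMeasurable hB)
    exact mul_comm _ _
  have l1 := hdom v hpφ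
  have l2 := hdom vα hφ
  have l3 : Filter.Tendsto (fun n => ∫ x in cell, classL2 (pd α (w n)) x * (v x * φ x))
      Filter.atTop (nhds (∫ x in cell, uα x * (v x * φ x))) :=
    tendsto_integral_mul_left (μ := cellMeasure) (hwα α uα hα hu) hvφ
  have key : ∀ n, ∫ x in cell, v x * (w n x * pd α φ x)
      = -(∫ x in cell, vα x * (w n x * φ x))
        - ∫ x in cell, classL2 (pd α (w n)) x * (v x * φ x) := by
    intro n
    -- A smooth periodic function times a test function is a test function, so `w n * φ` may be used
    -- in the definition of the weak derivative of `v`, which need not be bounded.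
    have h1 := hv _ (hφ.mul_left (hw n))
    rw [hα.sum_eq, pow_one, neg_one_mul] at h1
    have e : ∀ x, pd α (fun y => w n y * φ y) x = pd α (w n) x * φ x + w n x * pd α φ x := fun x =>
      pd_mul_of_isUnitIdx hα ((hw n).smooth.differentiable (by simp) x)
        (hφ.smooth.differentiable (by simp) x)
    simp only [e, mul_add] at h1
    have hadd := integral_add
      (integrable_mul_mul_of_continuous v ((hw n).pd α).smooth.continuous hφ.smooth.continuous)
      (integrable_mul_mul_of_continuous v (hw n).smooth.continuous hpφ.smooth.continuous)
    rw [hadd] at h1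
    have h2 : ∫ x in cell, classL2 (pd α (w n)) x * (v x * φ x)
        = ∫ x in cell, v x * (pd α (w n) x * φ x) := by
      rw [integral_classL2_mul ((hw n).pd α).memLp]
      congr 1
      funext x
      ring
    rw [h2]
    linarith
  have l4 := tendsto_nhds_unique l1 ((l2.neg.sub l3).congr fun n => (key n).symm)
  have e1 : ∫ x in cell, f x * pd α φ x = ∫ x in cell, v x * (P x * pd α φ x) := by
    refine integral_congr_ae ?_
    filter_upwards [hf, hP] with x h1 h2
    rw [h1, h2]
    ring
  have e2 : ∫ x in cell, g x * φ x
      = (∫ x in cell, uα x * (v x * φ x)) + ∫ x in cell, vα x * (P x * φ x) := by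
    have hi : Integrable (fun x => vα x * (P x * φ x)) cellMeasure := by
      obtain ⟨C', hC'⟩ := h.exists_ae_bound
      obtain ⟨B, hB⟩ := hφ.exists_bound
      have hm : MemLp (fun x => φ x * u x) 2 cellMeasure :=
        memLp_mul_of_bound u hφ.smooth.continuous.aestronglyMeasurable hB
      refine (integrable_congr ?_).1 (integrable_mul_memLp vα hm)
      filter_upwards [hP] with x h2
      rw [h2]
      ring
    rw [← integral_add (integrable_mul_memLp uα hvφ) hi]
    refine integral_congr_ae ?_
    filter_upwards [hg, hP] with x h1 h2
    rw [h1, h2]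
    ring
  rw [e1, l4, e2, hα.sum_eq]
  ring

/-! ### The Sobolev scale -/

/-- Having weak derivatives in `L²` up to order `k`. -/
def HasH (k : ℕ) (f : L2) : Prop := ∀ α : ℕ × ℕ, α.1 + α.2 ≤ k → ∃ g, IsWeakDeriv α f g

lemma hasH_zero (f : L2) : HasH 0 f := by
  rintro ⟨a, b⟩ hα
  obtain ⟨rfl, rfl⟩ : a = 0 ∧ b = 0 := by simp only at hα; omega
  exact ⟨f, IsWeakDeriv.refl f⟩

lemma HasH.add {k : ℕ} {f g : L2} (hf : HasH k f) (hg : HasH k g) : HasH k (f + g) := by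
  intro α hα
  obtain ⟨f', hf'⟩ := hf α hα
  obtain ⟨g', hg'⟩ := hg α hα
  exact ⟨_, hf'.add hg'⟩

lemma HasH.deriv {k l : ℕ} {f g : L2} (hf : HasH l f) {β : ℕ × ℕ} (hg : IsWeakDeriv β f g)
    (hkl : k + (β.1 + β.2) ≤ l) : HasH k g := by
  intro α hα
  obtain ⟨r, hr⟩ := hf (β + α) (by simp only [Prod.fst_add, Prod.snd_add]; omega)
  exact ⟨r, hg.cancel hr⟩

/-- A nonzero multi-index is a unit index plus one of smaller order, and weak derivatives compose;
this is the form used for induction on the order. -/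
lemma hasH_succ_of {k : ℕ} {f : L2}
    (h : ∀ β, IsUnitIdx β → ∃ g, IsWeakDeriv β f g ∧ HasH k g) : HasH (k + 1) f := by
  rintro ⟨a, b⟩ hα
  simp only at hα
  rcases a with _ | a
  · rcases b with _ | b
    · exact ⟨f, IsWeakDeriv.refl f⟩
    · obtain ⟨g, hg, hk⟩ := h (0, 1) (Or.inr rfl)
      obtain ⟨r, hr⟩ := hk (0, b) (by simp only; omega)
      have := hg.comp hr
      rw [Prod.mk_add_mk, add_comm 1 b] at this
      exact ⟨r, this⟩
  · obtain ⟨g, hg, hk⟩ := h (1, 0) (Or.inl rfl)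
    obtain ⟨r, hr⟩ := hk (a, b) (by simp only; omega)
    have := hg.comp hr
    rw [Prod.mk_add_mk, add_comm 1 a, zero_add] at this
    exact ⟨r, this⟩

lemma HasH.exists_mixedReg {k : ℕ} {f : L2} (h : HasH k f) (hk : 2 ≤ k) :
    ∃ f₁ f₂ f₁₂, MixedReg f f₁ f₂ f₁₂ := by
  obtain ⟨f₁, h₁⟩ := h (1, 0) (by simp only; omega)
  obtain ⟨f₂, h₂⟩ := h (0, 1) (by simp only; omega)
  obtain ⟨f₁₂, h₁₂⟩ := h (1, 1) (by simp only; omega)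
  exact ⟨f₁, f₂, f₁₂, h₁, h₂, h₁₂⟩

lemma HasH.memLp_mul {a : ℕ} {u : L2} (hu : HasH a u) (ha : 2 ≤ a) (v : L2) :
    MemLp (fun x => u x * v x) 2 cellMeasure := by
  obtain ⟨_, _, _, h⟩ := hu.exists_mixedReg ha
  obtain ⟨C, hC⟩ := h.exists_ae_bound
  exact memLp_mul_of_bound v (Lp.memLp u).1 hC

/-- One of the two orders is at least `2`, and that factor is essentially bounded. -/
lemma memLp_mul_of_hasH {a b : ℕ} {u v : L2} (hu : HasH a u) (hv : HasH b v) (h : 3 ≤ a + b) :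
    MemLp (fun x => u x * v x) 2 cellMeasure := by
  rcases le_or_gt 2 a with ha | ha
  · exact hu.memLp_mul ha v
  · simpa only [mul_comm] using hv.memLp_mul (by omega : 2 ≤ b) u

/-- The bound `4 ≤ a + b` leaves a total order of at least `3` after one differentiation, so both
terms of the product rule are in `L²`. The rule itself is applied with the factor of order at least
`2` as the bounded one. -/
lemma isWeakDeriv_mul_of_hasH {a b : ℕ} {u v uβ vβ : L2} (hu : HasH a u) (hv : HasH b v)
    (ha : 1 ≤ a) (hb : 1 ≤ b) (h : 4 ≤ a + b) {β : ℕ × ℕ} (hβ : IsUnitIdx β)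
    (huβ : IsWeakDeriv β u uβ) (hvβ : IsWeakDeriv β v vβ) :
    IsWeakDeriv β (classL2 fun x => u x * v x)
      ((classL2 fun x => uβ x * v x) + classL2 fun x => u x * vβ x) := by
  have hs := hβ.sum_eq
  have m0 := memLp_mul_of_hasH hu hv (by omega)
  have m1 := memLp_mul_of_hasH (hu.deriv huβ (k := a - 1) (by omega)) hv (by omega)
  have m2 := memLp_mul_of_hasH hu (hv.deriv hvβ (k := b - 1) (by omega)) (by omega)
  have hg : ((classL2 fun x => uβ x * v x) + classL2 fun x => u x * vβ x : L2)
      =ᵐ[cellMeasure] fun x => uβ x * v x + u x * vβ x := by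
    rw [← classL2_add m1 m2]
    exact coeFn_classL2 (m1.add m2)
  rcases le_or_gt 2 a with ha2 | ha2
  · obtain ⟨_, _, _, hm⟩ := hu.exists_mixedReg ha2
    exact hm.isWeakDeriv_mul hβ huβ hvβ (coeFn_classL2 m0) hg
  · obtain ⟨_, _, _, hm⟩ := hv.exists_mixedReg (by omega)
    refine hm.isWeakDeriv_mul hβ hvβ huβ ?_ ?_
    · filter_upwards [coeFn_classL2 m0] with x hx
      rw [hx, mul_comm]
    · filter_upwards [hg] with x hx
      rw [hx]
      ring

/-- Products of functions in Sobolev spaces. -/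
lemma HasH.mul {k a b : ℕ} {u v : L2} (hu : HasH a u) (hv : HasH b v) (ha : k ≤ a) (hb : k ≤ b)
    (h : k + 3 ≤ a + b) : HasH k (classL2 fun x => u x * v x) := by
  induction k generalizing a b u v with
  | zero => exact hasH_zero _
  | succ k ih =>
    refine hasH_succ_of fun β hβ => ?_
    have hs := hβ.sum_eq
    obtain ⟨uβ, huβ⟩ := hu β (by omega)
    obtain ⟨vβ, hvβ⟩ := hv β (by omega)
    refine ⟨_, isWeakDeriv_mul_of_hasH hu hv (by omega) (by omega) (by omega) hβ huβ hvβ, ?_⟩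
    -- Each derivative lowers one of `a`, `b` by one and `k` by one, which preserves `k + 3 ≤ a +
    -- b`.
    exact (ih (hu.deriv huβ (k := a - 1) (by omega)) hv (by omega) (by omega) (by omega)).add
      (ih hu (hv.deriv hvβ (k := b - 1) (by omega)) (by omega) (by omega) (by omega))

/-! ### Superposition operators -/

/-- The closed strip times the plane. -/
def dom : Set ((ℝ × ℝ) × (ℝ × ℝ)) := (Icc (0 : ℝ) 1 ×ˢ univ) ×ˢ univ

lemma mem_dom {x p : ℝ × ℝ} (hx : x.1 ∈ Icc (0 : ℝ) 1) : (x, p) ∈ dom := ⟨⟨hx, trivial⟩, trivial⟩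

lemma dom_mem_nhds {x p : ℝ × ℝ} (hx : x.1 ∈ Ioo (0 : ℝ) 1) : dom ∈ nhds (x, p) :=
  prod_mem_nhds (prod_mem_nhds (Icc_mem_nhds hx.1 hx.2) Filter.univ_mem) Filter.univ_mem

lemma uniqueDiffOn_dom : UniqueDiffOn ℝ dom :=
  ((uniqueDiffOn_Icc zero_lt_one).prod uniqueDiffOn_univ).prod uniqueDiffOn_univ

/-- The points `(x, (v n x, w n x))` over the cell stay in one compact subset of `dom`, on which `F`
is bounded. The three conclusions are what `tendsto_integral_mul` asks for. -/
lemma superposition_tendsto {F : (ℝ × ℝ) × (ℝ × ℝ) → ℝ} (hF : ContinuousOn F dom)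
    {v w : ℕ → ℝ × ℝ → ℝ} {P Q : ℝ × ℝ → ℝ} {C B : ℝ} (hv : ∀ n, SmoothPer (v n))
    (hw : ∀ n, SmoothPer (w n))
    (hvC : ∀ n, ∀ x ∈ Icc (0 : ℝ) 1 ×ˢ Icc (0 : ℝ) 1, |v n x| ≤ C)
    (hwB : ∀ n, ∀ x ∈ Icc (0 : ℝ) 1 ×ˢ Icc (0 : ℝ) 1, |w n x| ≤ B)
    (hvP : ∀ x ∈ cell, Filter.Tendsto (fun n => v n x) Filter.atTop (nhds (P x)))
    (hwQ : ∀ x ∈ cell, Filter.Tendsto (fun n => w n x) Filter.atTop (nhds (Q x))) :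
    (∀ n, AEStronglyMeasurable (fun x => F (x, (v n x, w n x))) cellMeasure) ∧
    (∃ M, ∀ n, ∀ x ∈ cell, |F (x, (v n x, w n x))| ≤ M) ∧
    ∀ x ∈ cell, Filter.Tendsto (fun n => F (x, (v n x, w n x))) Filter.atTop
      (nhds (F (x, (P x, Q x)))) := by
  refine ⟨fun n => ?_, ?_, fun x hx => ?_⟩
  · refine ContinuousOn.aestronglyMeasurable ?_ measurableSet_cell
    refine hF.comp (Continuous.continuousOn ?_) fun x hx => mem_dom (Ioo_subset_Icc_self hx.1)
    exact continuous_id.prodMk ((hv n).smooth.continuous.prodMk (hw n).smooth.continuous)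
  · have hK : IsCompact ((Icc (0 : ℝ) 1 ×ˢ Icc (0 : ℝ) 1) ×ˢ (Icc (-C) C ×ˢ Icc (-B) B)) :=
      (isCompact_Icc.prod isCompact_Icc).prod (isCompact_Icc.prod isCompact_Icc)
    obtain ⟨M, hM⟩ := hK.exists_bound_of_continuousOn
      (hF.mono fun z hz => ⟨⟨hz.1.1, trivial⟩, trivial⟩)
    refine ⟨M, fun n x hx => hM _ ⟨cell_subset hx, ?_, ?_⟩⟩
    · exact abs_le.1 (hvC n x (cell_subset hx))
    · exact abs_le.1 (hwB n x (cell_subset hx))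
  · have h1 : x.1 ∈ Icc (0 : ℝ) 1 := Ioo_subset_Icc_self hx.1
    refine (hF _ (mem_dom h1)).tendsto.comp (tendsto_nhdsWithin_iff.2 ⟨?_, ?_⟩)
    · exact tendsto_const_nhds.prodMk_nhds ((hvP x hx).prodMk_nhds (hwQ x hx))
    · exact Filter.Eventually.of_forall fun n => mem_dom h1

/-- The function `x ↦ F(x, (p x, q x))`. -/
def superpose (F : (ℝ × ℝ) × (ℝ × ℝ) → ℝ) (p q : L2) (x : ℝ × ℝ) : ℝ := F (x, (p x, q x))

/-- Continuity of `F` is known on `dom` only, so measurability and the bound are taken from the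
smooth approximations by a pointwise limit. -/
lemma superpose_meas_bound {F : (ℝ × ℝ) × (ℝ × ℝ) → ℝ} (hF : ContinuousOn F dom) {k : ℕ} {p q : L2}
    (hp : HasH k p) (hq : HasH k q) (hk : 2 ≤ k) :
    AEStronglyMeasurable (superpose F p q) cellMeasure ∧
      ∃ M, ∀ᵐ x ∂cellMeasure, |superpose F p q x| ≤ M := by
  obtain ⟨_, _, _, hp'⟩ := hp.exists_mixedReg hk
  obtain ⟨_, _, _, hq'⟩ := hq.exists_mixedReg hk
  obtain ⟨v, P, C, hv, -, hvC, hvP, hpP⟩ := hp'.exists_approx_pd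
  obtain ⟨w, Q, B, hw, -, hwB, hwQ, hqQ⟩ := hq'.exists_approx_pd
  obtain ⟨hm, ⟨M, hM⟩, hlim⟩ := superposition_tendsto hF hv hw hvC hwB hvP hwQ
  have e : superpose F p q =ᵐ[cellMeasure] fun x => F (x, (P x, Q x)) := by
    filter_upwards [hpP, hqQ] with x h1 h2
    rw [superpose, h1, h2]
  refine ⟨(aestronglyMeasurable_congr e).2
    (aestronglyMeasurable_of_tendsto_ae Filter.atTop hm (ae_cell hlim)), M, ?_⟩
  filter_upwards [e, ae_cell hlim, ae_cell fun x hx n => hM n x hx] with x h1 h2 h3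
  rw [h1]
  exact le_of_tendsto h2.abs (Filter.Eventually.of_forall h3)

lemma memLp_superpose {F : (ℝ × ℝ) × (ℝ × ℝ) → ℝ} (hF : ContinuousOn F dom) {k : ℕ} {p q : L2}
    (hp : HasH k p) (hq : HasH k q) (hk : 2 ≤ k) : MemLp (superpose F p q) 2 cellMeasure := by
  obtain ⟨hm, M, hM⟩ := superpose_meas_bound hF hp hq hk
  exact MemLp.of_bound hm M hM

/-- The directional derivative of a function on `dom`. -/
def dirDeriv (F : (ℝ × ℝ) × (ℝ × ℝ) → ℝ) (e : (ℝ × ℝ) × (ℝ × ℝ)) (z : (ℝ × ℝ) × (ℝ × ℝ)) : ℝ :=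
  fderivWithin ℝ F dom z e

lemma contDiffOn_dirDeriv {F : (ℝ × ℝ) × (ℝ × ℝ) → ℝ} {k : ℕ}
    (hF : ContDiffOn ℝ (k + 1 : ℕ) F dom) (e : (ℝ × ℝ) × (ℝ × ℝ)) :
    ContDiffOn ℝ k (dirDeriv F e) dom :=
  (hF.fderivWithin uniqueDiffOn_dom (by norm_cast)).clm_apply contDiffOn_const

/-- Period `1` in `x₂`. -/
def PerTwo (F : (ℝ × ℝ) × (ℝ × ℝ) → ℝ) : Prop :=
  ∀ x₁ ∈ Icc (0 : ℝ) 1, ∀ (x₂ : ℝ) (z : ℝ × ℝ), F ((x₁, x₂ + 1), z) = F ((x₁, x₂), z)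

-- The set `dom` is invariant under the unit translation in `x₂`, and `fderivWithin` commutes with
-- translations.
open scoped Pointwise in
lemma PerTwo.dirDeriv {F : (ℝ × ℝ) × (ℝ × ℝ) → ℝ} (hF : PerTwo F) (e : (ℝ × ℝ) × (ℝ × ℝ)) :
    PerTwo (dirDeriv F e) := by
  intro x₁ h₁ x₂ z
  set τ : (ℝ × ℝ) × (ℝ × ℝ) := ((0, 1), (0, 0)) with hτ
  have hS : τ +ᵥ dom = dom := by
    ext y
    rw [mem_vadd_set_iff_neg_vadd_mem]
    simp [dom, hτ]
  have h2 := fderivWithin_comp_add_right (𝕜 := ℝ) (f := F) (s := dom) (x := ((x₁, x₂), z)) τ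
  rw [hS] at h2
  have h3 : fderivWithin ℝ (fun y => F (y + τ)) dom ((x₁, x₂), z)
      = fderivWithin ℝ F dom ((x₁, x₂), z) := by
    have hall : ∀ y ∈ dom, F (y + τ) = F y := by
      rintro ⟨⟨y₁, y₂⟩, y⟩ hy
      have h5 : ((y₁, y₂), y) + τ = ((y₁, y₂ + 1), y) := by ext <;> simp [hτ]
      rw [h5]
      exact hF y₁ hy.1.1 y₂ y
    exact fderivWithin_congr hall (hall _ (mem_dom h₁))
  have h4 : ((x₁, x₂), z) + τ = ((x₁, x₂ + 1), z) := by ext <;> simp [hτ]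
  rw [h3, h4] at h2
  simp only [ToyProblem.dirDeriv, h2]

lemma pd_superpose {F : (ℝ × ℝ) × (ℝ × ℝ) → ℝ} (hF : ContDiffOn ℝ 1 F dom) {v w : ℝ × ℝ → ℝ}
    (hv : SmoothPer v) (hw : SmoothPer w) {β : ℕ × ℕ} (hβ : IsUnitIdx β) {x : ℝ × ℝ}
    (hx : x.1 ∈ Ioo (0 : ℝ) 1) :
    pd β (fun y => F (y, (v y, w y))) x
      = dirDeriv F ((β.1, β.2), (0, 0)) (x, (v x, w x))
        + dirDeriv F ((0, 0), (1, 0)) (x, (v x, w x)) * pd β v x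
        + dirDeriv F ((0, 0), (0, 1)) (x, (v x, w x)) * pd β w x := by
  have hdF : HasFDerivAt F (fderivWithin ℝ F dom (x, (v x, w x))) (x, (v x, w x)) :=
    ((hF.differentiableOn (by simp) _ (mem_dom (Ioo_subset_Icc_self hx))).hasFDerivWithinAt).hasFDerivAt
      (dom_mem_nhds hx)
  have hdv := hv.smooth.differentiable (by simp) x
  have hdw := hw.smooth.differentiable (by simp) x
  have hlin : ∀ (L : (ℝ × ℝ) × (ℝ × ℝ) →L[ℝ] ℝ) (e : ℝ × ℝ) (r t : ℝ),
      L (e, (r, t)) = L (e, (0, 0)) + L ((0, 0), (1, 0)) * r + L ((0, 0), (0, 1)) * t := by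
    intro L e r t
    have : (e, (r, t)) = (e, ((0 : ℝ), (0 : ℝ))) + r • (((0 : ℝ), (0 : ℝ)), ((1 : ℝ), (0 : ℝ)))
        + t • (((0 : ℝ), (0 : ℝ)), ((0 : ℝ), (1 : ℝ))) := by
      ext <;> simp
    rw [this, map_add, map_add, map_smul, map_smul, smul_eq_mul, smul_eq_mul]
    ring
  rcases hβ with rfl | rfl
  · rw [pd_one_zero, pd_one_zero, pd_one_zero, pdOne_eq_fderiv hdv, pdOne_eq_fderiv hdw]
    have h1 : HasDerivAt (fun t : ℝ => ((t, x.2), (v (t, x.2), w (t, x.2))))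
        ((1, 0), (fderiv ℝ v x (1, 0), fderiv ℝ w x (1, 0))) x.1 :=
      ((hasDerivAt_id x.1).prodMk (hasDerivAt_const x.1 x.2)).prodMk
        ((hasDerivAt_pdOne hdv).prodMk (hasDerivAt_pdOne hdw))
    have h2 := (HasFDerivAt.comp_hasDerivAt (x := x.1) (f := fun t : ℝ =>
      ((t, x.2), (v (t, x.2), w (t, x.2)))) (l := F) hdF h1).deriv
    refine h2.trans ?_
    rw [hlin]
    simp [dirDeriv]
  · rw [pd_zero_one, pd_zero_one, pd_zero_one, pdTwo_eq_fderiv hdv, pdTwo_eq_fderiv hdw]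
    have h1 : HasDerivAt (fun t : ℝ => ((x.1, t), (v (x.1, t), w (x.1, t))))
        ((0, 1), (fderiv ℝ v x (0, 1), fderiv ℝ w x (0, 1))) x.2 :=
      ((hasDerivAt_const x.2 x.1).prodMk (hasDerivAt_id x.2)).prodMk
        ((hasDerivAt_pdTwo hdv).prodMk (hasDerivAt_pdTwo hdw))
    have h2 := (HasFDerivAt.comp_hasDerivAt (x := x.2) (f := fun t : ℝ =>
      ((x.1, t), (v (x.1, t), w (x.1, t)))) (l := F) hdF h1).deriv
    refine h2.trans ?_
    rw [hlin]
    simp [dirDeriv]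

lemma integral_pd_superpose_mul_test {F : (ℝ × ℝ) × (ℝ × ℝ) → ℝ} (hF : ContDiffOn ℝ 1 F dom)
    (hper : PerTwo F) {v w φ : ℝ × ℝ → ℝ} (hv : SmoothPer v) (hw : SmoothPer w) (hφ : IsTest φ)
    {β : ℕ × ℕ} (hβ : IsUnitIdx β) :
    ∫ x in cell, (pd β (fun y => F (y, (v y, w y))) x * φ x + F (x, (v x, w x)) * pd β φ x)
      = 0 := by
  have hat : ∀ x : ℝ × ℝ, x.1 ∈ Ioo (0 : ℝ) 1 →
      ContDiffAt ℝ 1 (fun y => F (y, (v y, w y))) x := by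
    intro x hx
    refine ContDiffAt.comp (g := F) (f := fun y => (y, (v y, w y))) x
      (hF.contDiffAt (dom_mem_nhds hx)) ?_
    exact contDiffAt_id.prodMk ((hv.smooth.of_le (by simp)).contDiffAt.prodMk
      (hw.smooth.of_le (by simp)).contDiffAt)
  have hc := hφ.contDiff_mul hat
  have h0 : ∫ x in cell, pd β (fun y => F (y, (v y, w y)) * φ y) x = 0 := by
    rcases hβ with rfl | rfl
    · rw [pd_one_zero]
      refine integral_pdOne_eq_zero hc fun y => ?_
      rw [(hφ.eq_zero_at_bdry y).1, (hφ.eq_zero_at_bdry y).2, mul_zero, mul_zero]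
    · rw [pd_zero_one]
      refine integral_pdTwo_eq_zero hc fun t => ?_
      have h1 := hv.periodic t 0
      have h2 := hw.periodic t 0
      have h3 := hφ.periodic t 0
      rw [zero_add] at h1 h2 h3
      rw [h1, h2, h3]
      -- Periodicity of `F` is available only for `x₁` in `[0,1]`; elsewhere the test function
      -- vanishes.
      by_cases ht : t ∈ Icc (0 : ℝ) 1
      · have h4 := hper t ht 0 (v (t, 0), w (t, 0))
        rw [zero_add] at h4
        rw [h4]
      · have h5 : φ (t, 0) = 0 := by
          obtain ⟨δ, hδ, hs⟩ := hφ.supported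
          by_contra hne
          have := hs _ hne
          exact ht ⟨by simp only at this; linarith [this.1], by simp only at this; linarith [this.2]⟩
        rw [h5, mul_zero, mul_zero]
  rw [← h0]
  refine setIntegral_congr_fun measurableSet_cell fun x hx => ?_
  exact (pd_mul_of_isUnitIdx hβ ((hat x hx.1).differentiableAt (by simp))
    (hφ.smooth.differentiable (by simp) x)).symm

/-- The chain rule. -/
lemma isWeakDeriv_superpose {F : (ℝ × ℝ) × (ℝ × ℝ) → ℝ} (hF : ContDiffOn ℝ 1 F dom)
    (hper : PerTwo F) {k : ℕ} {p q pβ qβ : L2} (hp : HasH k p) (hq : HasH k q) (hk : 2 ≤ k)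
    {β : ℕ × ℕ} (hβ : IsUnitIdx β) (hpβ : IsWeakDeriv β p pβ) (hqβ : IsWeakDeriv β q qβ) :
    IsWeakDeriv β (classL2 (superpose F p q))
      (classL2 (superpose (dirDeriv F ((β.1, β.2), (0, 0))) p q)
        + (classL2 (fun x => superpose (dirDeriv F ((0, 0), (1, 0))) p q x * pβ x)
        + classL2 (fun x => superpose (dirDeriv F ((0, 0), (0, 1))) p q x * qβ x))) := by
  have hD : ∀ e, ContinuousOn (dirDeriv F e) dom := fun e =>
    (contDiffOn_dirDeriv (k := 0) (by simpa using hF) e).continuousOn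
  obtain ⟨_, _, _, hp'⟩ := hp.exists_mixedReg hk
  obtain ⟨_, _, _, hq'⟩ := hq.exists_mixedReg hk
  obtain ⟨v, P, C, hv, hvβ, hvC, hvP, hpP⟩ := hp'.exists_approx_pd
  obtain ⟨w, Q, B, hw, hwβ, hwB, hwQ, hqQ⟩ := hq'.exists_approx_pd
  intro φ hφ
  obtain ⟨R, hR0, hR⟩ := exists_bound_on_cell hφ.smooth.continuous
  obtain ⟨hm, ⟨M, hM⟩, hlim⟩ := superposition_tendsto hF.continuousOn hv hw hvC hwB hvP hwQ
  have lF : Filter.Tendsto (fun n => ∫ x in cell, classL2 (pd β φ) x * F (x, (v n x, w n x)))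
      Filter.atTop (nhds (∫ x in cell, classL2 (pd β φ) x * F (x, (P x, Q x)))) :=
    tendsto_integral_mul_right (μ := cellMeasure) _ hm (fun n => ae_cell (hM n)) (ae_cell hlim)
  have mF : ∀ n, MemLp (fun x => F (x, (v n x, w n x))) 2 cellMeasure := fun n =>
    MemLp.of_bound (hm n) M (ae_cell (hM n))
  have hDφ : ∀ e, (∀ n, AEStronglyMeasurable
        (fun x => dirDeriv F e (x, (v n x, w n x)) * φ x) cellMeasure) ∧
      (∃ M', ∀ n, ∀ᵐ x ∂cellMeasure, |dirDeriv F e (x, (v n x, w n x)) * φ x| ≤ M') ∧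
      ∀ᵐ x ∂cellMeasure, Filter.Tendsto (fun n => dirDeriv F e (x, (v n x, w n x)) * φ x)
        Filter.atTop (nhds (dirDeriv F e (x, (P x, Q x)) * φ x)) := by
    intro e
    obtain ⟨hm', ⟨M', hM'⟩, hlim'⟩ := superposition_tendsto (hD e) hv hw hvC hwB hvP hwQ
    refine ⟨fun n => (hm' n).mul hφ.smooth.continuous.aestronglyMeasurable, ⟨M' * R, fun n =>
      ae_cell fun x hx => ?_⟩, ae_cell fun x hx => (hlim' x hx).mul_const _⟩
    rw [abs_mul]
    exact mul_le_mul (hM' n x hx) (hR x (cell_subset hx)) (abs_nonneg _)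
      ((abs_nonneg _).trans (hM' n x hx))
  have mD : ∀ e n, MemLp (fun x => dirDeriv F e (x, (v n x, w n x)) * φ x) 2 cellMeasure := by
    intro e n
    obtain ⟨h1, ⟨M', h2⟩, -⟩ := hDφ e
    exact MemLp.of_bound (h1 n) M' (h2 n)
  have lD : ∀ e {g : ℕ → L2} {g₀ : L2}, Filter.Tendsto g Filter.atTop (nhds g₀) →
      Filter.Tendsto (fun n => ∫ x in cell, g n x * (dirDeriv F e (x, (v n x, w n x)) * φ x))
        Filter.atTop (nhds (∫ x in cell, g₀ x * (dirDeriv F e (x, (P x, Q x)) * φ x))) := by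
    intro e g g₀ hg
    obtain ⟨h1, ⟨M', h2⟩, h3⟩ := hDφ e
    exact tendsto_integral_mul (μ := cellMeasure) hg h1 h2 h3
  -- The constant `1` serves as the `L²` factor of the term with the explicit `x`-derivative of `F`,
  -- so that all terms are pairings of an `L²` function with a bounded one and `lD` covers them.
  have one : MemLp (fun _ : ℝ × ℝ => (1 : ℝ)) 2 cellMeasure := memLp_const 1
  have key : ∀ n,
      (∫ x in cell, classL2 (pd β φ) x * F (x, (v n x, w n x)))
        + ((∫ x in cell, classL2 (fun _ => 1) x
              * (dirDeriv F ((β.1, β.2), (0, 0)) (x, (v n x, w n x)) * φ x))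
          + ((∫ x in cell, classL2 (pd β (v n)) x
              * (dirDeriv F ((0, 0), (1, 0)) (x, (v n x, w n x)) * φ x))
          + ∫ x in cell, classL2 (pd β (w n)) x
              * (dirDeriv F ((0, 0), (0, 1)) (x, (v n x, w n x)) * φ x))) = 0 := by
    intro n
    refine Eq.trans ?_ (integral_pd_superpose_mul_test hF hper (hv n) (hw n) hφ hβ)
    have i1 := integrable_mul_memLp (classL2 (pd β φ)) (mF n)
    have i2 := integrable_mul_memLp (classL2 (fun _ => 1)) (mD ((β.1, β.2), (0, 0)) n)
    have i3 := integrable_mul_memLp (classL2 (pd β (v n))) (mD ((0, 0), (1, 0)) n)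
    have i4 := integrable_mul_memLp (classL2 (pd β (w n))) (mD ((0, 0), (0, 1)) n)
    have e1 := integral_add i3 i4
    have e2 := integral_add i2 (i3.add i4)
    have e3 := integral_add i1 (i2.add (i3.add i4))
    simp only [Pi.add_apply] at e1 e2 e3
    rw [← e1, ← e2, ← e3]
    refine integral_congr_ae ?_
    filter_upwards [coeFn_classL2 (hφ.pd β).memLp, coeFn_classL2 one,
      coeFn_classL2 ((hv n).pd β).memLp, coeFn_classL2 ((hw n).pd β).memLp,
      ae_cell fun x hx => pd_superpose hF (hv n) (hw n) hβ (x := x) hx.1] with x h1 h2 h3 h4 h5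
    rw [h1, h2, h3, h4, h5]
    ring
  -- The classical identity `key` passes to the limit: the derivatives of `v n`, `w n` converge in
  -- `L²`, their coefficients boundedly and pointwise.
  have hfin := tendsto_nhds_unique
    (((lF.add ((lD _ tendsto_const_nhds).add ((lD _ (hvβ β pβ hβ hpβ)).add
      (lD _ (hwβ β qβ hβ hqβ)))))).congr key) tendsto_const_nhds
  have hae : ∀ G, superpose G p q =ᵐ[cellMeasure] fun x => G (x, (P x, Q x)) := by
    intro G
    filter_upwards [hpP, hqQ] with x h1 h2
    rw [superpose, h1, h2]
  have m0 := memLp_superpose (hD ((β.1, β.2), (0, 0))) hp hq hk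
  have mm : ∀ e (g : L2), MemLp (fun x => superpose (dirDeriv F e) p q x * g x) 2 cellMeasure := by
    intro e g
    obtain ⟨h1, M', h2⟩ := superpose_meas_bound (hD e) hp hq hk
    exact memLp_mul_of_bound g h1 h2
  have e0 : ∫ x in cell, classL2 (superpose F p q) x * pd β φ x
      = ∫ x in cell, classL2 (pd β φ) x * F (x, (P x, Q x)) := by
    refine integral_congr_ae ?_
    filter_upwards [coeFn_classL2 (hφ.pd β).memLp, hae F,
      coeFn_classL2 (memLp_superpose hF.continuousOn hp hq hk)] with x h1 h2 h3
    rw [h1, h3, h2, mul_comm]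
  have e1 : ∫ x in cell, classL2 (superpose (dirDeriv F ((β.1, β.2), (0, 0))) p q) x * φ x
      = ∫ x in cell, classL2 (fun _ => 1) x
        * (dirDeriv F ((β.1, β.2), (0, 0)) (x, (P x, Q x)) * φ x) := by
    refine integral_congr_ae ?_
    filter_upwards [coeFn_classL2 m0, hae (dirDeriv F ((β.1, β.2), (0, 0))), coeFn_classL2 one]
      with x h1 h2 h3
    rw [h1, h2, h3, one_mul]
  have e2 : ∀ e (g : L2),
      ∫ x in cell, classL2 (fun x => superpose (dirDeriv F e) p q x * g x) x * φ x
        = ∫ x in cell, g x * (dirDeriv F e (x, (P x, Q x)) * φ x) := by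
    intro e g
    refine integral_congr_ae ?_
    filter_upwards [coeFn_classL2 (mm e g), hae (dirDeriv F e)] with x h1 h2
    rw [h1, h2]
    ring
  rw [e0, integral_add_mul _ _ hφ.smooth.continuous, integral_add_mul _ _ hφ.smooth.continuous,
    e1, e2, e2, hβ.sum_eq]
  linarith

/-- Superposition preserves Sobolev regularity. -/
lemma hasH_superpose {m : ℕ} (hm : 4 ≤ m) {p q : L2} (hp : HasH m p) (hq : HasH m q) {k : ℕ}
    (hk : k ≤ m) {F : (ℝ × ℝ) × (ℝ × ℝ) → ℝ} (hF : ContDiffOn ℝ k F dom) (hper : PerTwo F) :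
    HasH k (classL2 (superpose F p q)) := by
  induction k generalizing F with
  | zero => exact hasH_zero _
  | succ k ih =>
    refine hasH_succ_of fun β hβ => ?_
    have hs := hβ.sum_eq
    obtain ⟨pβ, hpβ⟩ := hp β (by omega)
    obtain ⟨qβ, hqβ⟩ := hq β (by omega)
    have hDk : ∀ e, ContDiffOn ℝ k (dirDeriv F e) dom := contDiffOn_dirDeriv hF
    have hS : ∀ e, HasH k (classL2 (superpose (dirDeriv F e) p q)) := fun e =>
      ih (by omega) (hDk e) (hper.dirDeriv e)
    have hprod : ∀ e {g : L2}, HasH (m - 1) g →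
        HasH k (classL2 fun x => superpose (dirDeriv F e) p q x * g x) := by
      intro e g hg
      -- The product theorem with orders `k` and `m - 1` requires `k + 3 ≤ k + (m - 1)`, that is, `4
      -- ≤ m`.
      have h1 := (hS e).mul hg le_rfl (by omega : k ≤ m - 1) (by omega)
      have hM := memLp_superpose (hDk e).continuousOn hp hq (by omega)
      have h2 : (classL2 fun x => classL2 (superpose (dirDeriv F e) p q) x * g x)
          = classL2 fun x => superpose (dirDeriv F e) p q x * g x := by
        obtain ⟨b1, M', b2⟩ := superpose_meas_bound (hDk e).continuousOn hp hq (by omega)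
        refine classL2_congr ?_
        filter_upwards [coeFn_classL2 hM, coeFn_classL2 (memLp_mul_of_bound g b1 b2)]
          with x h3 h4
        rw [h3, h4]
      rwa [← h2]
    refine ⟨_, isWeakDeriv_superpose (hF.of_le (by norm_cast; omega)) hper hp hq (by omega) hβ
      hpβ hqβ, ?_⟩
    exact (hS _).add ((hprod _ (hp.deriv hpβ (by omega))).add (hprod _ (hq.deriv hqβ (by omega))))

/-! ### Elements of the Sobolev spaces and the regularity of `a(x, ∇w)`. -/

lemma HasH.exists_hPer {m : ℕ} {f : L2} (h : HasH m f) : ∃ U : HPer m, toL2 (HPer m) U = f := by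
  choose g hg using fun α : multiIdx m => h α (le_of_mem_multiIdx α.2)
  have h0 : g ⟨(0, 0), mem_multiIdx (Nat.zero_le m)⟩ = f := (hg _).unique (IsWeakDeriv.refl f)
  refine ⟨⟨WithLp.toLp 2 g, fun α hα => ?_⟩, h0⟩
  have h1 := hg ⟨α, mem_multiIdx hα⟩
  rw [← h0] at h1
  exact h1

lemma isWeakDeriv_D {m : ℕ} (U : HPer m) (α : ℕ × ℕ) (h : α.1 + α.2 ≤ m) :
    IsWeakDeriv α (toL2 (HPer m) U) (D (HPer m) α h U) := U.2 α h

lemma isWeakDeriv_D_zero {m : ℕ} (U : HPerZero m) (α : ℕ × ℕ) (h : α.1 + α.2 ≤ m) :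
    IsWeakDeriv α (toL2 (HPerZero m) U) (D (HPerZero m) α h U) := U.2.1 α h

lemma hasH_grad {s : ℕ} (w : HPerZero s) (α : ℕ × ℕ) (h : α.1 + α.2 ≤ s) (hα : α.1 + α.2 = 1) :
    HasH (s - 1) (D (HPerZero s) α h w) := by
  have h0 : HasH s (toL2 (HPerZero s) w) := fun α hα => ⟨_, isWeakDeriv_D_zero w α hα⟩
  exact h0.deriv (isWeakDeriv_D_zero w α h) (by omega)

/-- Superposition is applied to `∇w` with `m = s - 1`, so the requirement `4 ≤ m` is exactly `5 ≤
s`. -/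
lemma hasH_field {s : ℕ} (hs : 5 ≤ s) {a : (ℝ × ℝ) × (ℝ × ℝ) → ℝ × ℝ}
    (ha : ContDiffOn ℝ (s + 1 : ℕ) a ((Icc (0 : ℝ) 1 ×ˢ univ) ×ˢ univ))
    (ha_per : ∀ x₁ ∈ Icc (0 : ℝ) 1, ∀ (x₂ : ℝ) (z : ℝ × ℝ), a ((x₁, x₂ + 1), z) = a ((x₁, x₂), z))
    (w : HPerZero s) :
    (MemLp (fun x => (field a hs w x).1) 2 cellMeasure ∧ HasH (s - 1) (fieldOne a hs w)) ∧
    (MemLp (fun x => (field a hs w x).2) 2 cellMeasure ∧ HasH (s - 1) (fieldTwo a hs w)) := by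
  have h1 := hasH_grad w (1, 0) (by simp; omega) rfl
  have h2 := hasH_grad w (0, 1) (by simp; omega) rfl
  have hle : ((s - 1 : ℕ) : ℕ∞ω) ≤ (s + 1 : ℕ) := by
    norm_cast
    omega
  have c1 : ContDiffOn ℝ (s - 1 : ℕ) (fun z => (a z).1) dom := (ha.of_le hle).fst
  have c2 : ContDiffOn ℝ (s - 1 : ℕ) (fun z => (a z).2) dom := (ha.of_le hle).snd
  have p1 : PerTwo fun z => (a z).1 := fun x₁ h₁ x₂ z => by simp only [ha_per x₁ h₁ x₂ z]
  have p2 : PerTwo fun z => (a z).2 := fun x₁ h₁ x₂ z => by simp only [ha_per x₁ h₁ x₂ z]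
  exact ⟨⟨memLp_superpose c1.continuousOn h1 h2 (by omega),
    hasH_superpose (by omega) h1 h2 le_rfl c1 p1⟩,
    memLp_superpose c2.continuousOn h1 h2 (by omega),
    hasH_superpose (by omega) h1 h2 le_rfl c2 p2⟩

/-! ### One-dimensional calculus -/

/-- Lebesgue measure on the unit interval. -/
abbrev unitMeasure : Measure ℝ := volume.restrict (Ioo (0 : ℝ) 1)

/-- The real Hilbert space `L²(0,1)`. -/
abbrev L2I : Type := Lp ℝ 2 unitMeasure

lemma ae_unit {p : ℝ → Prop} (h : ∀ t ∈ Ioo (0 : ℝ) 1, p t) : ∀ᵐ t ∂unitMeasure, p t :=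
  (ae_restrict_iff' measurableSet_Ioo).2 (ae_of_all _ h)

lemma integrableOn_unit {f : ℝ → ℝ} (hf : Continuous f) : IntegrableOn f (Ioo (0 : ℝ) 1) :=
  (hf.continuousOn.integrableOn_compact isCompact_Icc).mono_set Ioo_subset_Icc_self

lemma exists_bound_unit {f : ℝ → ℝ} (hf : Continuous f) :
    ∃ C, 0 ≤ C ∧ ∀ t ∈ Ioo (0 : ℝ) 1, |f t| ≤ C := by
  obtain ⟨C, hC⟩ := (isCompact_Icc (a := (0 : ℝ)) (b := 1)).exists_bound_of_continuousOn
    hf.continuousOn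
  exact ⟨|C|, abs_nonneg _, fun t ht => (hC t (Ioo_subset_Icc_self ht)).trans (le_abs_self C)⟩

lemma memLp_unit {f : ℝ → ℝ} (hf : Continuous f) : MemLp f 2 unitMeasure := by
  obtain ⟨C, -, hC⟩ := exists_bound_unit hf
  exact MemLp.of_bound hf.aestronglyMeasurable C (ae_unit hC)

open Classical in
/-- The class in `L²(0,1)` of a function (zero if it is not square integrable). -/
def classI (f : ℝ → ℝ) : L2I := if h : MemLp f 2 unitMeasure then h.toLp f else 0

lemma coeFn_classI {f : ℝ → ℝ} (hf : Continuous f) : classI f =ᵐ[unitMeasure] f := by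
  rw [classI, dif_pos (memLp_unit hf)]
  exact (memLp_unit hf).coeFn_toLp

lemma classI_congr {w : ℝ → ℝ} {f : L2I} (hw : Continuous w) (h : w =ᵐ[unitMeasure] f) :
    classI w = f :=
  Lp.ext ((coeFn_classI hw).trans h)

lemma classI_add {f g : ℝ → ℝ} (hf : Continuous f) (hg : Continuous g) :
    classI (fun t => f t + g t) = classI f + classI g := by
  refine classI_congr (hf.add hg) ?_
  filter_upwards [coeFn_classI hf, coeFn_classI hg, Lp.coeFn_add (classI f) (classI g)]
    with x h1 h2 h3
  rw [h3, Pi.add_apply, h1, h2]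

lemma classI_sub {f g : ℝ → ℝ} (hf : Continuous f) (hg : Continuous g) :
    classI (fun t => f t - g t) = classI f - classI g := by
  refine classI_congr (hf.sub hg) ?_
  filter_upwards [coeFn_classI hf, coeFn_classI hg, Lp.coeFn_sub (classI f) (classI g)]
    with x h1 h2 h3
  rw [h3, Pi.sub_apply, h1, h2]

lemma integral_classI_mul {f : ℝ → ℝ} (hf : Continuous f) (ψ : ℝ → ℝ) :
    ∫ t in Ioo (0 : ℝ) 1, classI f t * ψ t = ∫ t in Ioo (0 : ℝ) 1, f t * ψ t := by
  refine integral_congr_ae ?_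
  filter_upwards [coeFn_classI hf] with x hx
  rw [hx]

lemma integral_mul_classI (F : L2I) {f : ℝ → ℝ} (hf : Continuous f) :
    ∫ t in Ioo (0 : ℝ) 1, F t * f t = inner ℝ F (classI f) := by
  rw [classI, dif_pos (memLp_unit hf)]
  exact integral_mul_toLp F (memLp_unit hf)

lemma integral_abs_le_norm_classI {f : ℝ → ℝ} (hf : Continuous f) :
    ∫ t in Ioo (0 : ℝ) 1, |f t| ≤ ‖classI f‖ := by
  have h1 := abs_integral_mul_le (μ := unitMeasure) |classI f| (b := fun _ => 1)
    aestronglyMeasurable_const zero_le_one (by simp)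
  rw [norm_abs_eq_norm, one_mul] at h1
  refine le_trans (le_of_eq ?_) ((le_abs_self _).trans h1)
  refine integral_congr_ae ?_
  filter_upwards [coeFn_classI hf, Lp.coeFn_abs (classI f)] with x h2 h3
  rw [h3, h2, mul_one]

lemma norm_classI_le {f : ℝ → ℝ} (hf : Continuous f) {C : ℝ} (hC : 0 ≤ C)
    (h : ∀ t ∈ Ioo (0 : ℝ) 1, |f t| ≤ C) : ‖classI f‖ ≤ C := by
  have h1 := abs_integral_mul_le (μ := unitMeasure) (classI f) hf.aestronglyMeasurable hC (ae_unit h)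
  rw [integral_mul_classI _ hf, real_inner_self_eq_norm_mul_norm,
    abs_of_nonneg (mul_self_nonneg _)] at h1
  rcases (norm_nonneg (classI f)).eq_or_lt with h0 | h0
  · rw [← h0]; exact hC
  · exact le_of_mul_le_mul_right h1 h0

/-- The primitive vanishing at `0`. -/
def prim (f : ℝ → ℝ) (t : ℝ) : ℝ := ∫ r in (0 : ℝ)..t, f r

lemma hasDerivAt_prim {f : ℝ → ℝ} (hf : Continuous f) (t : ℝ) : HasDerivAt (prim f) (f t) t :=
  intervalIntegral.integral_hasDerivAt_right (hf.intervalIntegrable _ _)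
    hf.aestronglyMeasurable.stronglyMeasurableAtFilter hf.continuousAt

lemma deriv_prim {f : ℝ → ℝ} (hf : Continuous f) : deriv (prim f) = f :=
  funext fun t => (hasDerivAt_prim hf t).deriv

lemma prim_zero (f : ℝ → ℝ) : prim f 0 = 0 := intervalIntegral.integral_same

lemma continuous_prim {f : ℝ → ℝ} (hf : Continuous f) : Continuous (prim f) :=
  continuous_iff_continuousAt.2 fun t => (hasDerivAt_prim hf t).continuousAt

lemma contDiff_prim {f : ℝ → ℝ} (hf : ContDiff ℝ ∞ f) : ContDiff ℝ ∞ (prim f) := by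
  rw [contDiff_infty_iff_deriv, deriv_prim hf.continuous]
  exact ⟨fun t => (hasDerivAt_prim hf.continuous t).differentiableAt, hf⟩

lemma abs_prim_le {f : ℝ → ℝ} (hf : Continuous f) {t : ℝ} (ht : t ∈ Icc (0 : ℝ) 1) :
    |prim f t| ≤ ‖classI f‖ := by
  refine le_trans ?_ (integral_abs_le_norm_classI hf)
  rw [← integral_Ioc_eq_integral_Ioo]
  refine (intervalIntegral.norm_integral_le_integral_norm_uIoc (f := f) (a := 0) (b := t)
    (μ := volume)).trans ?_
  refine setIntegral_mono_set ?_ (ae_of_all _ fun y => abs_nonneg _) ?_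
  · exact (hf.abs.continuousOn.integrableOn_compact isCompact_Icc).mono_set Ioc_subset_Icc_self
  · rw [uIoc_of_le ht.1]
    exact (Ioc_subset_Ioc le_rfl ht.2).eventuallyLE

lemma norm_classI_prim_le {f : ℝ → ℝ} (hf : Continuous f) : ‖classI (prim f)‖ ≤ ‖classI f‖ :=
  norm_classI_le (continuous_prim hf) (norm_nonneg _) fun _ ht =>
    abs_prim_le hf (Ioo_subset_Icc_self ht)

lemma prim_sub {f g : ℝ → ℝ} (hf : Continuous f) (hg : Continuous g) :
    prim (fun t => f t - g t) = fun t => prim f t - prim g t :=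
  funext fun _ => intervalIntegral.integral_sub (hf.intervalIntegrable _ _)
    (hg.intervalIntegrable _ _)

lemma contDiff_prim_iterate {f : ℝ → ℝ} (hf : ContDiff ℝ ∞ f) (m : ℕ) :
    ContDiff ℝ ∞ (prim^[m] f) := by
  induction m with
  | zero => exact hf
  | succ m ih => rw [Function.iterate_succ_apply']; exact contDiff_prim ih

lemma prim_iterate_sub {f g : ℝ → ℝ} (hf : ContDiff ℝ ∞ f) (hg : ContDiff ℝ ∞ g) (m : ℕ) :
    prim^[m] (fun t => f t - g t) = fun t => prim^[m] f t - prim^[m] g t := by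
  induction m with
  | zero => rfl
  | succ m ih =>
    rw [Function.iterate_succ_apply', Function.iterate_succ_apply', Function.iterate_succ_apply', ih]
    exact prim_sub (contDiff_prim_iterate hf m).continuous (contDiff_prim_iterate hg m).continuous

/-- Taking primitives does not increase the `L²` norm on the unit interval, so a Cauchy sequence
stays Cauchy after `m` integrations. -/
lemma norm_classI_prim_iterate_le {f : ℝ → ℝ} (hf : ContDiff ℝ ∞ f) (m : ℕ) :
    ‖classI (prim^[m] f)‖ ≤ ‖classI f‖ := by
  induction m with
  | zero => exact le_rfl
  | succ m ih =>
    rw [Function.iterate_succ_apply']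
    exact (norm_classI_prim_le (contDiff_prim_iterate hf m).continuous).trans ih

lemma iteratedDeriv_prim_iterate {f : ℝ → ℝ} (hf : ContDiff ℝ ∞ f) (m : ℕ) :
    iteratedDeriv m (prim^[m] f) = f := by
  induction m with
  | zero => exact iteratedDeriv_zero
  | succ m ih =>
    rw [iteratedDeriv_succ', Function.iterate_succ_apply',
      deriv_prim (contDiff_prim_iterate hf m).continuous, ih]

lemma integral_mul_deriv_add {f g : ℝ → ℝ} (hf : ContDiff ℝ ∞ f) (hg : ContDiff ℝ ∞ g) :
    (∫ t in Ioo (0 : ℝ) 1, f t * deriv g t) + ∫ t in Ioo (0 : ℝ) 1, deriv f t * g t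
      = f 1 * g 1 - f 0 * g 0 := by
  have hf' := hf.continuous_deriv (by simp)
  have hg' := hg.continuous_deriv (by simp)
  have h := integral_Ioo_deriv (f := fun t => f t * g t)
    (f' := fun t => deriv f t * g t + f t * deriv g t)
    (fun t => (hf.differentiable (by simp) t).hasDerivAt.mul
      (hg.differentiable (by simp) t).hasDerivAt)
    ((hf'.mul hg.continuous).add (hf.continuous.mul hg'))
  have hadd := integral_add (integrableOn_unit (hf'.mul hg.continuous))
    (integrableOn_unit (hf.continuous.mul hg'))
  rw [← h, add_comm]
  exact hadd.symm

/-- Smooth functions supported in a compact subset of `(0,1)`. -/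
structure IsTestI (η : ℝ → ℝ) : Prop where
  smooth : ContDiff ℝ ∞ η
  supported : ∃ δ : ℝ, 0 < δ ∧ ∀ t : ℝ, η t ≠ 0 → δ ≤ t ∧ t ≤ 1 - δ

lemma IsTestI.bdry {η : ℝ → ℝ} (h : IsTestI η) : η 0 = 0 ∧ η 1 = 0 := by
  obtain ⟨δ, hδ, hs⟩ := h.supported
  constructor
  · by_contra h0
    linarith [(hs _ h0).1]
  · by_contra h0
    linarith [(hs _ h0).2]

lemma IsTestI.deriv {η : ℝ → ℝ} (h : IsTestI η) : IsTestI (deriv η) := by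
  refine ⟨(contDiff_infty_iff_deriv.1 h.smooth).2, ?_⟩
  obtain ⟨δ, hδ, hs⟩ := h.supported
  refine ⟨δ, hδ, fun t ht => ?_⟩
  by_contra hcon
  refine ht ?_
  have hev : η =ᶠ[nhds t] fun _ => (0 : ℝ) := by
    have ho : IsOpen {t : ℝ | ¬ (δ ≤ t ∧ t ≤ 1 - δ)} :=
      (isClosed_Icc (a := δ) (b := 1 - δ)).isOpen_compl
    filter_upwards [ho.mem_nhds hcon] with t ht
    by_contra h0
    exact ht (hs _ h0)
  simp [hev.deriv_eq]

lemma IsTestI.iteratedDeriv {η : ℝ → ℝ} (h : IsTestI η) (m : ℕ) : IsTestI (iteratedDeriv m η) := by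
  induction m with
  | zero => simpa using h
  | succ m ih => rw [iteratedDeriv_succ]; exact ih.deriv

lemma IsTestI.integral_mul_deriv {η f : ℝ → ℝ} (h : IsTestI η) (hf : ContDiff ℝ ∞ f) :
    ∫ t in Ioo (0 : ℝ) 1, f t * _root_.deriv η t
      = - ∫ t in Ioo (0 : ℝ) 1, _root_.deriv f t * η t := by
  have := integral_mul_deriv_add hf h.smooth
  rw [h.bdry.1, h.bdry.2] at this
  linarith

lemma IsTestI.integral_prim_iterate_mul {η f : ℝ → ℝ} (h : IsTestI η) (hf : ContDiff ℝ ∞ f)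
    (m : ℕ) : ∫ t in Ioo (0 : ℝ) 1, prim^[m] f t * _root_.iteratedDeriv m η t
      = (-1) ^ m * ∫ t in Ioo (0 : ℝ) 1, f t * η t := by
  induction m with
  | zero => simp
  | succ m ih =>
    rw [iteratedDeriv_succ, (h.iteratedDeriv m).integral_mul_deriv (contDiff_prim_iterate hf _),
      Function.iterate_succ_apply', deriv_prim (contDiff_prim_iterate hf m).continuous, ih]
    ring

lemma eq_zero_of_integral_testI {f : L2I}
    (h : ∀ η, IsTestI η → ∫ t in Ioo (0 : ℝ) 1, f t * η t = 0) : f = 0 := by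
  have hint : IntegrableOn (fun t => f t) (Ioo (0 : ℝ) 1) := (Lp.memLp f).integrable (by norm_num)
  have hae : ∀ᵐ t ∂(volume : Measure ℝ), t ∈ Ioo (0 : ℝ) 1 → f t = 0 := by
    refine isOpen_Ioo.ae_eq_zero_of_integral_contDiff_smul_eq_zero hint.locallyIntegrableOn ?_
    intro ψ hψ hcomp hsupp
    have hzero : ∀ t ∉ Ioo (0 : ℝ) 1, ψ t = 0 := fun t ht =>
      image_eq_zero_of_notMem_tsupport fun ht' => ht (hsupp ht')
    have htest : IsTestI ψ := by
      refine ⟨hψ, ?_⟩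
      obtain ⟨δ, hδ, hδs⟩ := hcomp.isCompact.exists_thickening_subset_open isOpen_Ioo hsupp
      have hmem : ∀ t, ψ t ≠ 0 → ∀ r, |r - t| < δ → r ∈ Ioo (0 : ℝ) 1 := by
        intro t ht r hr
        exact hδs (Metric.mem_thickening_iff.2 ⟨t, subset_tsupport _ ht, hr⟩)
      refine ⟨δ / 2, by positivity, fun t ht => ⟨?_, ?_⟩⟩
      · have := (hmem t ht (t - δ / 2) (by
          rw [show t - δ / 2 - t = -(δ / 2) by ring, abs_neg, abs_of_pos (by positivity)]
          linarith)).1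
        linarith
      · have := (hmem t ht (t + δ / 2) (by
          rw [show t + δ / 2 - t = δ / 2 by ring, abs_of_pos (by positivity)]
          linarith)).2
        linarith
    rw [← setIntegral_eq_integral_of_forall_compl_eq_zero (s := Ioo (0 : ℝ) 1)
      fun t ht => by rw [hzero t ht, zero_smul]]
    simpa only [smul_eq_mul, mul_comm] using h ψ htest
  refine Lp.ext ?_
  filter_upwards [(ae_restrict_iff' measurableSet_Ioo).2 hae,
    Lp.coeFn_zero ℝ 2 unitMeasure] with x hx hx'
  rw [hx, hx', Pi.zero_apply]

lemma exists_testI_integral_eq_one :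
    ∃ η, IsTestI η ∧ ∫ t in Ioo (0 : ℝ) 1, η t = 1 := by
  have hex : ∃ η, IsTestI η ∧ ∫ t in Ioo (0 : ℝ) 1, η t ≠ 0 := by
    -- Otherwise the constant `1` would be orthogonal to every test function, hence zero.
    by_contra! hcon
    have h1 : classI (fun _ => 1) = 0 := by
      refine eq_zero_of_integral_testI fun η hη => ?_
      rw [integral_classI_mul continuous_const]
      simpa using hcon η hη
    have h2 := integral_classI_mul (f := fun _ => (1 : ℝ)) continuous_const (fun _ => 1)
    rw [integral_mul_classI _ continuous_const, h1, inner_zero_left] at h2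
    simp at h2
  obtain ⟨η, hη, h0⟩ := hex
  refine ⟨fun t => (∫ t in Ioo (0 : ℝ) 1, η t)⁻¹ * η t, ⟨contDiff_const.mul hη.smooth, ?_⟩, ?_⟩
  · obtain ⟨δ, hδ, hs⟩ := hη.supported
    exact ⟨δ, hδ, fun t ht => hs t (right_ne_zero_of_mul ht)⟩
  · rw [integral_const_mul, inv_mul_cancel₀ h0]

/-- Mean zero is what makes the primitive vanish also to the right of the support. -/
lemma IsTestI.prim {η : ℝ → ℝ} (h : IsTestI η) (h0 : ∫ t in Ioo (0 : ℝ) 1, η t = 0) :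
    IsTestI (prim η) := by
  refine ⟨contDiff_prim h.smooth, ?_⟩
  obtain ⟨δ, hδ, hs⟩ := h.supported
  have hz : ∀ t, (t < δ ∨ 1 - δ < t) → η t = 0 := by
    intro t ht
    by_contra hne
    have := hs t hne
    rcases ht with ht | ht <;> linarith [this.1, this.2]
  have hone : ToyProblem.prim η 1 = 0 := by
    rw [ToyProblem.prim, intervalIntegral.integral_of_le zero_le_one, integral_Ioc_eq_integral_Ioo,
      h0]
  refine ⟨δ, hδ, fun t ht => ?_⟩
  by_contra hcon
  rw [not_and_or, not_le, not_le] at hcon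
  refine ht ?_
  rcases hcon with hcon | hcon
  · refine intervalIntegral.integral_zero_ae (ae_of_all _ fun r hr => hz r (Or.inl ?_))
    have := hr.2
    rcases le_total 0 t with h' | h'
    · rw [max_eq_right h'] at this; linarith
    · rw [max_eq_left h'] at this; linarith
  · have hc := h.smooth.continuous
    have hsplit : ToyProblem.prim η 1 + ∫ r in (1 : ℝ)..t, η r = ToyProblem.prim η t :=
      intervalIntegral.integral_add_adjacent_intervals (hc.intervalIntegrable _ _)
        (hc.intervalIntegrable _ _)
    rw [← hsplit, hone, zero_add]
    refine intervalIntegral.integral_zero_ae (ae_of_all _ fun r hr => hz r (Or.inr ?_))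
    have := hr.1
    rcases le_total 1 t with h' | h'
    · rw [min_eq_left h'] at this; linarith
    · rw [min_eq_right h'] at this; linarith

lemma IsTestI.sub_const_mul {η ζ : ℝ → ℝ} (h : IsTestI η) (h' : IsTestI ζ) (c : ℝ) :
    IsTestI fun t => η t - c * ζ t := by
  refine ⟨h.smooth.sub (contDiff_const.mul h'.smooth), ?_⟩
  obtain ⟨δ, hδ, hs⟩ := h.supported
  obtain ⟨δ', hδ', hs'⟩ := h'.supported
  refine ⟨min δ δ', lt_min hδ hδ', fun t ht => ?_⟩
  by_cases h0 : η t = 0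
  · have h1 : ζ t ≠ 0 := by
      intro h1
      exact ht (by simp [h0, h1])
    have := hs' t h1
    exact ⟨(min_le_right _ _).trans this.1, by linarith [this.2, min_le_right δ δ']⟩
  · have := hs t h0
    exact ⟨(min_le_left _ _).trans this.1, by linarith [this.2, min_le_left δ δ']⟩

lemma iteratedDeriv_sub_const_mul {f g : ℝ → ℝ} (hf : ContDiff ℝ ∞ f) (hg : ContDiff ℝ ∞ g) (c : ℝ)
    (m : ℕ) : iteratedDeriv m (fun t => f t - c * g t)
      = fun t => iteratedDeriv m f t - c * iteratedDeriv m g t := by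
  induction m generalizing f g with
  | zero => simp
  | succ m ih =>
    have e : deriv (fun t => f t - c * g t) = fun t => deriv f t - c * deriv g t := by
      funext t
      exact ((hf.differentiable (by simp) t).hasDerivAt.sub
        ((hg.differentiable (by simp) t).hasDerivAt.const_mul c)).deriv
    simp only [iteratedDeriv_succ']
    rw [e, ih (contDiff_infty_iff_deriv.1 hf).2 (contDiff_infty_iff_deriv.1 hg).2]

/-- A function whose weak derivative of order `m` vanishes is a polynomial of degree less than `m`
(the lemma of du Bois-Reymond). -/
lemma exists_smooth_of_integral_iteratedDeriv_eq_zero (m : ℕ) {f : L2I}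
    (h : ∀ η, IsTestI η → ∫ t in Ioo (0 : ℝ) 1, f t * iteratedDeriv m η t = 0) :
    ∃ q : ℝ → ℝ, ContDiff ℝ ∞ q ∧ iteratedDeriv m q = 0 ∧ f = classI q := by
  induction m generalizing f with
  | zero =>
    refine ⟨fun _ => 0, contDiff_const, by funext; simp, ?_⟩
    have h0 : f = 0 := eq_zero_of_integral_testI fun η hη => by simpa using h η hη
    rw [h0]
    exact (classI_congr continuous_const (Lp.coeFn_zero ℝ 2 unitMeasure).symm).symm
  | succ m ih =>
    obtain ⟨η₀, hη₀, hone⟩ := exists_testI_integral_eq_one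
    set C := ∫ t in Ioo (0 : ℝ) 1, f t * iteratedDeriv m η₀ t with hC
    have h1 : ∀ η, IsTestI η → ∫ t in Ioo (0 : ℝ) 1, f t * iteratedDeriv m η t
        = C * ∫ t in Ioo (0 : ℝ) 1, η t := by
      intro η hη
      set c := ∫ t in Ioo (0 : ℝ) 1, η t with hc
      -- Subtracting `c * η₀` removes the mean, so the primitive is a test function, and its
      -- derivative of order `m + 1` is the derivative of order `m` of `η - c * η₀`.
      have hζ := hη.sub_const_mul hη₀ c
      have hint : ∫ t in Ioo (0 : ℝ) 1, (η t - c * η₀ t) = 0 := by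
        rw [integral_sub (integrableOn_unit hη.smooth.continuous)
          ((integrableOn_unit hη₀.smooth.continuous).const_mul c), integral_const_mul, hone]
        ring
      have h2 := h _ (hζ.prim hint)
      rw [iteratedDeriv_succ', deriv_prim hζ.smooth.continuous,
        iteratedDeriv_sub_const_mul hη.smooth hη₀.smooth] at h2
      simp only [mul_sub, mul_left_comm _ c] at h2
      have hsub := integral_sub
        (integrable_mul_memLp f (memLp_unit (hη.iteratedDeriv m).smooth.continuous))
        ((integrable_mul_memLp f (memLp_unit (hη₀.iteratedDeriv m).smooth.continuous)).const_mul c)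
      rw [hsub, integral_const_mul, ← hC] at h2
      linarith
    -- The sign `(-1) ^ m` cancels the one from `m` integrations by parts, so `f - classI q₁`
    -- satisfies the hypothesis at order `m`.
    set q₁ := prim^[m] (fun _ => (-1) ^ m * C) with hq₁
    have hq₁s : ContDiff ℝ ∞ q₁ := contDiff_prim_iterate contDiff_const m
    obtain ⟨q, hq, hqm, hfq⟩ := ih (f := f - classI q₁) fun η hη => by
      have hd := (hη.iteratedDeriv m).smooth.continuous
      rw [integral_sub_mul (μ := unitMeasure) _ _ (memLp_unit hd), h1 η hη,
        integral_classI_mul hq₁s.continuous, hq₁,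
        hη.integral_prim_iterate_mul contDiff_const, integral_const_mul, ← mul_assoc, ← mul_assoc,
        ← mul_pow]
      simp
    refine ⟨fun t => q t - (-1) * q₁ t, hq.sub (contDiff_const.mul hq₁s), ?_, ?_⟩
    · rw [iteratedDeriv_sub_const_mul hq hq₁s, iteratedDeriv_succ, iteratedDeriv_succ, hqm, hq₁,
        iteratedDeriv_prim_iterate contDiff_const]
      funext t
      simp
    · have e : (fun t => q t - (-1) * q₁ t) = fun t => q t + q₁ t := by
        funext t
        ring
      rw [e, classI_add hq.continuous hq₁s.continuous, ← hfq, sub_add_cancel]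

lemma exists_smooth_tendsto (H : L2I) : ∃ h : ℕ → ℝ → ℝ, (∀ n, ContDiff ℝ ∞ (h n)) ∧
    Filter.Tendsto (fun n => classI (h n)) Filter.atTop (nhds H) := by
  have hd := Lp.dense_hasCompactSupport_contDiff (F := ℝ) (μ := unitMeasure) (p := 2) (by norm_num)
  obtain ⟨W, hW, hlim⟩ := mem_closure_iff_seq_limit.1 (hd H)
  choose h hh using hW
  refine ⟨h, fun n => (hh n).2.2, hlim.congr fun n => ?_⟩
  exact (classI_congr (hh n).2.2.continuous (hh n).1.symm).symm

/-- Functions with a weak derivative of order `m` are limits of functions smooth up to the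
boundary. -/
lemma exists_smooth_tendsto_iteratedDeriv (m : ℕ) {G H : L2I}
    (hGH : ∀ η, IsTestI η → ∫ t in Ioo (0 : ℝ) 1, G t * iteratedDeriv m η t
      = (-1) ^ m * ∫ t in Ioo (0 : ℝ) 1, H t * η t) :
    ∃ χ : ℕ → ℝ → ℝ, (∀ n, ContDiff ℝ ∞ (χ n)) ∧
      Filter.Tendsto (fun n => classI (χ n)) Filter.atTop (nhds G) ∧
      Filter.Tendsto (fun n => classI (iteratedDeriv m (χ n))) Filter.atTop (nhds H) := by
  obtain ⟨h, hs, hlim⟩ := exists_smooth_tendsto H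
  have hsm : ∀ n, ContDiff ℝ ∞ (prim^[m] (h n)) := fun n => contDiff_prim_iterate (hs n) m
  have hcauchy : CauchySeq fun n => classI (prim^[m] (h n)) := by
    have h1 := hlim.cauchySeq
    rw [Metric.cauchySeq_iff] at h1 ⊢
    intro ε hε
    obtain ⟨N, hN⟩ := h1 ε hε
    refine ⟨N, fun i hi j hj => lt_of_le_of_lt ?_ (hN i hi j hj)⟩
    rw [dist_eq_norm, dist_eq_norm, ← classI_sub (hsm i).continuous (hsm j).continuous,
      ← classI_sub (hs i).continuous (hs j).continuous, ← prim_iterate_sub (hs i) (hs j)]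
    exact norm_classI_prim_iterate_le ((hs i).sub (hs j)) m
  obtain ⟨Ψ, hΨ⟩ := cauchySeq_tendsto_of_complete hcauchy
  have hΨm : ∀ η, IsTestI η → ∫ t in Ioo (0 : ℝ) 1, Ψ t * iteratedDeriv m η t
      = (-1) ^ m * ∫ t in Ioo (0 : ℝ) 1, H t * η t := by
    intro η hη
    have l1 := tendsto_integral_mul_left (μ := unitMeasure) hΨ
      (memLp_unit (hη.iteratedDeriv m).smooth.continuous)
    have l2 := (tendsto_integral_mul_left (μ := unitMeasure) hlim
      (memLp_unit hη.smooth.continuous)).const_mul ((-1 : ℝ) ^ m)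
    refine tendsto_nhds_unique l1 (l2.congr fun n => ?_)
    rw [integral_classI_mul (hs n).continuous, integral_classI_mul (hsm n).continuous,
      hη.integral_prim_iterate_mul (hs n)]
  -- `G` and the limit `Ψ` of the primitives have the same weak derivative of order `m`; the
  -- correction `q` restores `G` without affecting that derivative.
  obtain ⟨q, hq, hqm, hGq⟩ := exists_smooth_of_integral_iteratedDeriv_eq_zero m (f := G - Ψ)
    fun η hη => by
      rw [integral_sub_mul (μ := unitMeasure) _ _
        (memLp_unit (hη.iteratedDeriv m).smooth.continuous), hGH η hη, hΨm η hη, sub_self]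
  refine ⟨fun n t => q t - (-1) * prim^[m] (h n) t,
    fun n => hq.sub (contDiff_const.mul (hsm n)), ?_, ?_⟩
  · have l := hΨ.const_add (classI q)
    rw [← hGq, sub_add_cancel] at l
    refine l.congr fun n => ?_
    rw [hGq, ← classI_add hq.continuous (hsm n).continuous]
    congr 1
    funext t
    ring
  · refine hlim.congr fun n => ?_
    rw [iteratedDeriv_sub_const_mul hq (hsm n), hqm, iteratedDeriv_prim_iterate (hs n)]
    simp

/-- The solution of `-φ'' = χ` with `φ(0) = φ(1) = 0`. -/
def dirichletSol (χ : ℝ → ℝ) (t : ℝ) : ℝ := prim (prim χ) 1 * t - prim (prim χ) t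

lemma hasDerivAt_dirichletSol {χ : ℝ → ℝ} (hχ : ContDiff ℝ ∞ χ) (t : ℝ) :
    HasDerivAt (dirichletSol χ) (prim (prim χ) 1 - prim χ t) t := by
  have h := ((hasDerivAt_id t).const_mul (prim (prim χ) 1)).sub
    (hasDerivAt_prim (continuous_prim hχ.continuous) t)
  rw [mul_one] at h
  exact h

lemma deriv_dirichletSol {χ : ℝ → ℝ} (hχ : ContDiff ℝ ∞ χ) :
    deriv (dirichletSol χ) = fun t => prim (prim χ) 1 - prim χ t :=
  funext fun t => (hasDerivAt_dirichletSol hχ t).deriv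

lemma deriv_deriv_dirichletSol {χ : ℝ → ℝ} (hχ : ContDiff ℝ ∞ χ) :
    deriv (deriv (dirichletSol χ)) = fun t => -χ t := by
  rw [deriv_dirichletSol hχ]
  funext t
  exact ((hasDerivAt_prim hχ.continuous t).const_sub _).deriv

lemma contDiff_dirichletSol {χ : ℝ → ℝ} (hχ : ContDiff ℝ ∞ χ) : ContDiff ℝ ∞ (dirichletSol χ) :=
  (contDiff_const.mul contDiff_id).sub (contDiff_prim (contDiff_prim hχ))

lemma dirichletSol_bdry (χ : ℝ → ℝ) : dirichletSol χ 0 = 0 ∧ dirichletSol χ 1 = 0 := by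
  simp [dirichletSol, prim_zero]

lemma abs_dirichletSol_le {χ : ℝ → ℝ} (hχ : ContDiff ℝ ∞ χ) {t : ℝ} (ht : t ∈ Ioo (0 : ℝ) 1) :
    |dirichletSol χ t| ≤ 2 * ‖classI χ‖ := by
  have hc := continuous_prim hχ.continuous
  have h1 : ∀ r ∈ Icc (0 : ℝ) 1, |prim (prim χ) r| ≤ ‖classI χ‖ := fun r hr =>
    (abs_prim_le hc hr).trans (norm_classI_prim_le hχ.continuous)
  have h2 := h1 1 (by simp)
  have h3 := h1 t (Ioo_subset_Icc_self ht)
  calc |dirichletSol χ t| ≤ |prim (prim χ) 1 * t| + |prim (prim χ) t| := abs_sub _ _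
    _ ≤ ‖classI χ‖ * 1 + ‖classI χ‖ := by
        rw [abs_mul, abs_of_pos ht.1]
        exact add_le_add (mul_le_mul h2 ht.2.le ht.1.le (norm_nonneg _)) h3
    _ = 2 * ‖classI χ‖ := by ring

lemma iteratedDeriv_dirichletSol {χ : ℝ → ℝ} (hχ : ContDiff ℝ ∞ χ) (m : ℕ) :
    iteratedDeriv (m + 2) (dirichletSol χ) = fun t => -iteratedDeriv m χ t := by
  rw [iteratedDeriv_succ', iteratedDeriv_succ', deriv_deriv_dirichletSol hχ]
  funext t
  exact iteratedDeriv_fun_neg m χ t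

/-- The energy identity for `-φ'' = χ`: the boundary terms vanish with `φ`. -/
lemma integral_mul_dirichletSol {χ : ℝ → ℝ} (hχ : ContDiff ℝ ∞ χ) :
    ∫ t in Ioo (0 : ℝ) 1, χ t * dirichletSol χ t = ‖classI (deriv (dirichletSol χ))‖ ^ 2 := by
  have hs := contDiff_dirichletSol hχ
  have hs' := (contDiff_infty_iff_deriv.1 hs).2
  have h := integral_mul_deriv_add hs hs'
  rw [(dirichletSol_bdry χ).1, (dirichletSol_bdry χ).2, deriv_deriv_dirichletSol hχ] at h
  rw [← real_inner_self_eq_norm_sq, ← integral_mul_classI _ hs'.continuous,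
    integral_classI_mul hs'.continuous]
  have e : ∫ t in Ioo (0 : ℝ) 1, dirichletSol χ t * -χ t
      = - ∫ t in Ioo (0 : ℝ) 1, χ t * dirichletSol χ t := by
    rw [← integral_neg]
    congr 1
    funext t
    ring
  rw [e] at h
  linarith

/-- Uniqueness for the boundary value problem in one variable. -/
lemma eq_zero_of_boundary_problem (m : ℕ) {G H : L2I} {c : ℝ} (hc : 0 < c)
    (hGH : ∀ η, IsTestI η → ∫ t in Ioo (0 : ℝ) 1, G t * iteratedDeriv m η t
      = (-1) ^ m * ∫ t in Ioo (0 : ℝ) 1, H t * η t)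
    (heq : ∀ φ : ℝ → ℝ, ContDiff ℝ ∞ φ → φ 0 = 0 → φ 1 = 0 →
      ∫ t in Ioo (0 : ℝ) 1, H t * iteratedDeriv (m + 2) φ t
        = c * ∫ t in Ioo (0 : ℝ) 1, G t * φ t) : G = 0 := by
  obtain ⟨χ, hχ, hG, hH⟩ := exists_smooth_tendsto_iteratedDeriv m hGH
  have hφ := fun n => contDiff_dirichletSol (hχ n)
  have hφ' := fun n => (contDiff_infty_iff_deriv.1 (hφ n)).2
  have hχm : ∀ n, Continuous (iteratedDeriv m (χ n)) := fun n =>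
    (hχ n).continuous_iteratedDeriv m (by exact_mod_cast le_top)
  set E := fun n => ‖classI (deriv (dirichletSol (χ n)))‖ ^ 2 with hE
  obtain ⟨M, hM⟩ := hG.norm.bddAbove_range
  have hMn : ∀ n, ‖classI (χ n)‖ ≤ M := fun n => hM ⟨n, rfl⟩
  have hM0 : 0 ≤ M := (norm_nonneg _).trans (hMn 0)
  have herr : Filter.Tendsto
      (fun n => ∫ t in Ioo (0 : ℝ) 1, (G - classI (χ n) : L2I) t * dirichletSol (χ n) t)
      Filter.atTop (nhds 0) := by
    have h1 : Filter.Tendsto (fun n => (2 * M) * ‖G - classI (χ n)‖) Filter.atTop (nhds 0) := by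
      have h2 := (hG.const_sub G).norm.const_mul (2 * M)
      simpa using h2
    refine squeeze_zero_norm (fun n => ?_) h1
    refine abs_integral_mul_le (μ := unitMeasure) _ (hφ n).continuous.aestronglyMeasurable
      (by positivity) (ae_unit fun t ht => (abs_dirichletSol_le (hχ n) ht).trans ?_)
    exact mul_le_mul_of_nonneg_left (hMn n) zero_le_two
  -- The equation tested with the solution of `-φ'' = χ n`, for which `φ^{(m+2)} = -(χ n)^{(m)}`. In
  -- the limit the nonnegative left side tends to `-‖H‖²`, hence to zero.
  have hid : ∀ n, c * E n = -inner ℝ H (classI (iteratedDeriv m (χ n)))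
      - c * ∫ t in Ioo (0 : ℝ) 1, (G - classI (χ n) : L2I) t * dirichletSol (χ n) t := by
    intro n
    have h1 := heq _ (hφ n) (dirichletSol_bdry _).1 (dirichletSol_bdry _).2
    rw [iteratedDeriv_dirichletSol (hχ n)] at h1
    simp only [mul_neg, integral_neg] at h1
    rw [integral_mul_classI _ (hχm n)] at h1
    rw [integral_sub_mul (μ := unitMeasure) _ _ (memLp_unit (hφ n).continuous),
      integral_classI_mul (hχ n).continuous, integral_mul_dirichletSol (hχ n)]
    linarith
  have hlim : Filter.Tendsto (fun n => c * E n) Filter.atTop (nhds (-‖H‖ ^ 2)) := by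
    have h1 := ((tendsto_const_nhds (x := H)).inner hH).neg.sub (herr.const_mul c)
    rw [real_inner_self_eq_norm_sq, mul_zero, sub_zero] at h1
    exact h1.congr fun n => (hid n).symm
  have hE0 : Filter.Tendsto E Filter.atTop (nhds 0) := by
    have h1 : 0 ≤ -‖H‖ ^ 2 := ge_of_tendsto hlim
      (Filter.Eventually.of_forall fun n => mul_nonneg hc.le (sq_nonneg _))
    have h2 : -‖H‖ ^ 2 = 0 := le_antisymm (by nlinarith [sq_nonneg ‖H‖]) h1
    rw [h2] at hlim
    have h3 := hlim.const_mul c⁻¹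
    rw [mul_zero] at h3
    refine h3.congr fun n => ?_
    rw [← mul_assoc, inv_mul_cancel₀ hc.ne', one_mul]
  have hE1 : Filter.Tendsto (fun n => ‖classI (deriv (dirichletSol (χ n)))‖) Filter.atTop
      (nhds 0) := by
    have h1 := hE0.sqrt
    rw [Real.sqrt_zero] at h1
    exact h1.congr fun n => Real.sqrt_sq (norm_nonneg _)
  -- Since `χ n` is minus the derivative of `φ'`, its integral against `η` equals that of `φ'`
  -- against `η'`, which tends to zero with the energy.
  refine eq_zero_of_integral_testI fun η hη => ?_
  have l1 := tendsto_integral_mul_left (μ := unitMeasure) hG (memLp_unit hη.smooth.continuous)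
  have l2 : Filter.Tendsto (fun n => ∫ t in Ioo (0 : ℝ) 1, classI (χ n) t * η t) Filter.atTop
      (nhds 0) := by
    obtain ⟨B, hB0, hB⟩ := exists_bound_unit hη.deriv.smooth.continuous
    have h1 : Filter.Tendsto (fun n => B * ‖classI (deriv (dirichletSol (χ n)))‖) Filter.atTop
        (nhds 0) := by simpa using hE1.const_mul B
    refine squeeze_zero_norm (fun n => ?_) h1
    have h2 := abs_integral_mul_le (μ := unitMeasure) (classI (deriv (dirichletSol (χ n))))
      hη.deriv.smooth.continuous.aestronglyMeasurable hB0 (ae_unit hB)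
    refine le_trans (le_of_eq ?_) h2
    rw [integral_classI_mul (hχ n).continuous, integral_classI_mul (hφ' n).continuous,
      hη.integral_mul_deriv (hφ' n), deriv_deriv_dirichletSol (hχ n), ← integral_neg]
    simp only [neg_mul, neg_neg]
    rfl
  exact tendsto_nhds_unique l1 l2

/-! ### Fourier modes in `x₂` -/

lemma measurePreserving_fst_cell : MeasurePreserving Prod.fst cellMeasure unitMeasure := by
  rw [cellMeasure_eq_prod]
  exact measurePreserving_fst

lemma continuous_trig (k : ℤ) (θ : ℝ) : Continuous (trig k θ) := (contDiff_trig k θ).continuous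

lemma abs_trig_le (k : ℤ) (θ y : ℝ) : |trig k θ y| ≤ 1 := Real.abs_cos_le_one _

/-- The mode is the integral of `g` times `trig k θ` over `x₂`. It is obtained as the adjoint of the
isometry `f ↦ f ∘ Prod.fst`, which gives membership in `L²(0,1)` and the pairing formula at once. -/
lemma exists_mode (g : L2) (k : ℤ) (θ : ℝ) : ∃ G : L2I, ∀ φ : ℝ → ℝ, Continuous φ →
    ∫ t in Ioo (0 : ℝ) 1, G t * φ t = ∫ x in cell, g x * (φ x.1 * trig k θ x.2) := by
  have hm : MemLp (fun x : ℝ × ℝ => trig k θ x.2 * g x) 2 cellMeasure :=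
    memLp_mul_of_bound g ((continuous_trig k θ).comp continuous_snd).aestronglyMeasurable
      (ae_of_all _ fun x => abs_trig_le k θ x.2)
  let A : L2I →L[ℝ] L2 :=
    (Lp.compMeasurePreservingₗᵢ ℝ Prod.fst measurePreserving_fst_cell).toContinuousLinearMap
  refine ⟨A.adjoint (classL2 fun x : ℝ × ℝ => trig k θ x.2 * g x), fun φ hφ => ?_⟩
  rw [integral_mul_classI _ hφ, ContinuousLinearMap.adjoint_inner_left, inner_eq_integral]
  refine integral_congr_ae ?_
  have hA : A (classI φ) =ᵐ[cellMeasure] fun x => classI φ x.1 :=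
    Lp.coeFn_compMeasurePreserving (classI φ) measurePreserving_fst_cell
  have hφ' := measurePreserving_fst_cell.quasiMeasurePreserving.ae (coeFn_classI hφ)
  filter_upwards [coeFn_classL2 hm, hA, hφ'] with x h1 h2 h3
  rw [h1, h2, h3]
  ring

/-- A function on the cell vanishes if all its Fourier modes in `x₂` solve the homogeneous boundary
value problem. -/
lemma eq_zero_of_modes (m : ℕ) {g gm : L2} (hgm : IsWeakDeriv (m, 0) g gm) (c : ℤ → ℝ)
    (hc : ∀ k, 0 < c k)
    (h : ∀ (k : ℤ) (θ : ℝ) (φ : ℝ → ℝ), ContDiff ℝ ∞ φ → φ 0 = 0 → φ 1 = 0 →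
      ∫ x in cell, gm x * (iteratedDeriv (m + 2) φ x.1 * trig k θ x.2)
        = c k * ∫ x in cell, g x * (φ x.1 * trig k θ x.2)) : g = 0 := by
  refine eq_zero_of_integral_cosTrig fun n k θ => ?_
  obtain ⟨G, hG⟩ := exists_mode g k θ
  obtain ⟨H, hH⟩ := exists_mode gm k θ
  have hcont : ∀ {φ : ℝ → ℝ} (j : ℕ), ContDiff ℝ ∞ φ → Continuous (iteratedDeriv j φ) :=
    fun j hφ => hφ.continuous_iteratedDeriv j (by exact_mod_cast le_top)
  have h0 : G = 0 := by
    refine eq_zero_of_boundary_problem m (hc k) (H := H) (fun η hη => ?_) fun φ hφ h0 h1 => ?_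
    · rw [hG _ (hcont m hη.smooth), hH _ hη.smooth.continuous]
      have htest : IsTest fun x => η x.1 * trig k θ x.2 := by
        have hs := SmoothPer.sep hη.smooth (contDiff_trig k θ) (trig_periodic k θ)
        obtain ⟨δ, hδ, hsupp⟩ := hη.supported
        exact ⟨hs.smooth, hs.periodic, δ, hδ, fun x hx => hsupp x.1 (left_ne_zero_of_mul hx)⟩
      have h2 := hgm _ htest
      rw [pd_sep] at h2
      simpa using h2
    · rw [hH _ (hcont _ hφ), hG _ hφ.continuous]
      exact h k θ φ hφ h0 h1
  have h1 := hG _ (contDiff_cos_mul n).continuous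
  rw [h0] at h1
  refine h1.symm.trans (integral_eq_zero_of_ae ?_)
  filter_upwards [Lp.coeFn_zero ℝ 2 unitMeasure] with t ht
  rw [ht]
  simp

/-! ### Evaluation of the functionals on products -/

lemma exists_hPerZero_of_smooth {v : ℝ × ℝ → ℝ} (hv : SmoothPer v)
    (hv0 : ∀ y, v (0, y) = 0 ∧ v (1, y) = 0) (m : ℕ) :
    ∃ V : HPerZero m, ∀ (α : ℕ × ℕ) (h : α.1 + α.2 ≤ m),
      D (HPerZero m) α h V = classL2 (pd α v) :=
  ⟨⟨WithLp.toLp 2 fun α => classL2 (pd α v), fun α _ => hv.isWeakDeriv α,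
    v, hv.smooth.continuous.continuousOn, hv.periodic, hv0, coeFn_classL2 hv.memLp⟩,
    fun _ _ => rfl⟩

lemma pd_mode (φ : ℝ → ℝ) (k : ℤ) (θ : ℝ) (j s : ℕ) :
    pd (j, 2 * s) (fun x => φ x.1 * trig k θ x.2) = fun x =>
      (-1) ^ s * (2 * Real.pi * k) ^ (2 * s) * pd (j, 0) (fun x => φ x.1 * trig k θ x.2) x := by
  rw [pd_sep, pd_sep, iteratedDeriv_two_mul_trig]
  funext x
  simp only [iteratedDeriv_zero]
  ring

lemma integral_mul_const_mul (f : L2) (c : ℝ) (w : ℝ × ℝ → ℝ) :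
    ∫ x in cell, f x * (c * w x) = c * ∫ x in cell, f x * w x := by
  rw [← integral_const_mul]
  congr 1
  funext x
  ring

/-- Integration by parts in `x₂` against a product. -/
lemma IsWeakDeriv.integral_mode {f g : L2} {i : ℕ} (h : IsWeakDeriv (0, i) f g) {φ : ℝ → ℝ}
    (hφ : ContDiff ℝ ∞ φ) (k : ℤ) (θ : ℝ) {j l s : ℕ} (hil : i + l = 2 * s) :
    ∫ x in cell, g x * pd (j, l) (fun x => φ x.1 * trig k θ x.2) x
      = (-1) ^ i * ((-1) ^ s * (2 * Real.pi * k) ^ (2 * s)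
        * ∫ x in cell, f x * pd (j, 0) (fun x => φ x.1 * trig k θ x.2) x) := by
  have hv := SmoothPer.sep hφ (contDiff_trig k θ) (trig_periodic k θ)
  have h1 := h.integral_pd_zero_left (hv.pd (j, l))
  -- After the transfer all `i + l = 2 * s` derivatives in `x₂` fall on the trigonometric factor,
  -- where they act as a scalar.
  rw [← pd_add hv.smooth, Prod.mk_add_mk, zero_add, hil, pd_mode, integral_mul_const_mul] at h1
  rw [h1, ← mul_assoc, ← mul_pow]
  simp

/-! ### Uniqueness from the equations of the Fourier modes. -/

lemma mode_coeff_pos {lam₁ lam₂ : ℝ} (hlam₁ : 0 < lam₁) (hlam₂ : 0 < lam₂) (s : ℕ) (k : ℤ) :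
    0 < lam₁ * (2 * Real.pi * k) ^ (2 * s) + lam₂ := by
  have : 0 ≤ (2 * Real.pi * k : ℝ) ^ (2 * s) := (even_two_mul s).pow_nonneg _
  positivity

lemma neg_one_pow_mul_self (s : ℕ) : (-1 : ℝ) ^ s * (-1) ^ s = 1 := by
  rw [← mul_pow]
  simp

lemma neg_one_pow_sub_two {s : ℕ} (hs : 2 ≤ s) : (-1 : ℝ) ^ (s - 2) = (-1) ^ s := by
  obtain ⟨m, rfl⟩ := Nat.exists_eq_add_of_le' hs
  simp [pow_add]

lemma neg_one_pow_sub_one {s : ℕ} (hs : 1 ≤ s) : (-1 : ℝ) ^ (s - 1) = -(-1) ^ s := by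
  obtain ⟨m, rfl⟩ := Nat.exists_eq_add_of_le' hs
  simp [pow_add]

lemma integral_sub_mul_cell (f g : L2) {w : ℝ × ℝ → ℝ} (hw : SmoothPer w) :
    ∫ x in cell, (f - g : L2) x * w x = (∫ x in cell, f x * w x) - ∫ x in cell, g x * w x :=
  integral_sub_mul (μ := cellMeasure) f g hw.memLp

/-- Testing with `φ(x₁) * trig k θ x₂` produces the boundary problem of `eq_zero_of_modes` with `m =
s - 2` and `c k = λ₁(2πk)^{2s} + λ₂`. -/
theorem linMap_injective {s : ℕ} (hs : 5 ≤ s) {lam₁ lam₂ : ℝ} (hlam₁ : 0 < lam₁)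
    (hlam₂ : 0 < lam₂) : Function.Injective (linMap s lam₁ lam₂) := by
  rw [injective_iff_map_eq_zero]
  intro g hg
  have hg0 : toL2 (HPer (s - 2)) g = 0 := by
    refine eq_zero_of_modes (s - 2) (isWeakDeriv_D g (s - 2, 0) (by simp)) _
      (mode_coeff_pos hlam₁ hlam₂ s) fun k θ φ hφ h0 h1 => ?_
    have hv := SmoothPer.sep hφ (contDiff_trig k θ) (trig_periodic k θ)
    obtain ⟨V, hV⟩ := exists_hPerZero_of_smooth hv (fun y => by simp [h0, h1]) (s + 2)
    have h2 : linMap s lam₁ lam₂ g V = 0 := by rw [hg]; rfl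
    have h3 : -inner ℝ (D (HPer (s - 2)) (s - 2, 0) (by simp) g) (D (HPerZero (s + 2)) (s, 0) (by simp) V)
        + (lam₁ * (-1) ^ s) * inner ℝ (D (HPer (s - 2)) (0, s - 2) (by simp) g)
          ((-1 : ℝ) ^ (s + 2) • D (HPerZero (s + 2)) (0, s + 2) (by simp) V)
        + lam₂ * inner ℝ (toL2 (HPer (s - 2)) g) (D (HPerZero (s + 2)) (0, 0) (Nat.zero_le _) V)
        = 0 := h2
    rw [inner_smul_right, hV, hV, hV, ← integral_mul_classL2 _ (hv.pd _).memLp,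
      ← integral_mul_classL2 _ (hv.pd _).memLp, ← integral_mul_classL2 _ (hv.pd _).memLp,
      (isWeakDeriv_D g (0, s - 2) (by simp)).integral_mode hφ k θ (s := s) (by omega),
      neg_one_pow_sub_two (by omega), pd_zero_zero] at h3
    rw [show s - 2 + 2 = s by omega]
    have e : pd (s, 0) (fun x => φ x.1 * trig k θ x.2)
        = fun x => iteratedDeriv s φ x.1 * trig k θ x.2 := by
      rw [pd_sep]
      simp only [iteratedDeriv_zero]
    rw [e] at h3
    have h4 := neg_one_pow_mul_self s
    rw [pow_add] at h3
    -- All the signs `(-1) ^ s` occur in pairs, so the `λ₁` term enters with a plus sign, whatever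
    -- the parity of `s`.
    linear_combination -h3 + (lam₁ * (2 * Real.pi * k) ^ (2 * s)
      * ∫ x in cell, toL2 (HPer (s - 2)) g x * (φ x.1 * trig k θ x.2))
      * ((-1 : ℝ) ^ s * (-1) ^ s + 1) * h4
  -- An element of `HPer` is the whole family of derivatives; once the function is zero, the other
  -- entries are zero by uniqueness of weak derivatives.
  refine Subtype.ext ?_
  ext1 α
  have h1 := isWeakDeriv_D g α (le_of_mem_multiIdx α.2)
  rw [hg0] at h1
  have h2 : IsWeakDeriv (α : ℕ × ℕ) (0 : L2) 0 := by
    simpa using (smoothPer_zero.isWeakDeriv (α : ℕ × ℕ)).smul 0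
  exact h1.unique h2

/-- Against products `φ(x₁) * trig k θ x₂` each term of `A w` turns into a term with `div a(x, ∇w)`
in the place of `h`, so the difference solves the same mode equations as in `linMap_injective`. -/
theorem divField_eq_of_opA_eq {s : ℕ} (hs : 5 ≤ s) {a : (ℝ × ℝ) × (ℝ × ℝ) → ℝ × ℝ}
    {lam₁ lam₂ : ℝ} (hlam₁ : 0 < lam₁) (hlam₂ : 0 < lam₂) {w : HPerZero s}
    (h₁ : HasH (s - 1) (fieldOne a hs w)) (h₂ : HasH (s - 1) (fieldTwo a hs w)) {h : HPer s}
    (heq : opA a hs lam₁ lam₂ w = injDual s (rhs s lam₁ lam₂ h)) :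
    divField a hs w = toL2 (HPer s) h := by
  obtain ⟨f₁, hf₁⟩ := h₁ (1, 0) (by simp only; omega)
  obtain ⟨f₂, hf₂⟩ := h₂ (0, 1) (by simp only; omega)
  obtain ⟨A₁, hA₁⟩ := h₁ (0, s - 1) (by simp)
  obtain ⟨A₂, hA₂⟩ := h₂ (0, s - 1) (by simp)
  have hd : divField a hs w = f₁ + f₂ := by
    rw [divField, weakDeriv_eq hf₁, weakDeriv_eq hf₂]
  have hdH : HasH (s - 2) (f₁ + f₂) :=
    (h₁.deriv hf₁ (by simp only; omega)).add (h₂.deriv hf₂ (by simp only; omega))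
  -- All the weak derivatives occurring in `opA` exist, so none of its `weakDeriv` terms takes the
  -- default value zero.
  obtain ⟨dm, hdm⟩ := hdH (s - 2, 0) (by simp)
  rw [hd, ← sub_eq_zero]
  refine eq_zero_of_modes (s - 2) (hdm.sub (isWeakDeriv_D h (s - 2, 0) (by simp))) _
    (mode_coeff_pos hlam₁ hlam₂ s) fun k θ φ hφ h0 h1 => ?_
  have hv := SmoothPer.sep hφ (contDiff_trig k θ) (trig_periodic k θ)
  obtain ⟨V, hV⟩ := exists_hPerZero_of_smooth hv (fun y => by simp [h0, h1]) (s + 2)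
  have h2 : opA a hs lam₁ lam₂ w V = injDual s (rhs s lam₁ lam₂ h) V := by rw [heq]
  rw [opA, hd, weakDeriv_eq hdm, weakDeriv_eq hA₁, weakDeriv_eq hA₂] at h2
  have h3 : inner ℝ dm (D (HPerZero (s + 2)) (s, 0) (by simp) V)
      - (lam₁ * (-1) ^ s) * ((-1) ^ s
        * (inner ℝ A₁ (D (HPerZero (s + 2)) (1, s + 1) (by simp; omega) V)
          + inner ℝ A₂ (D (HPerZero (s + 2)) (0, s + 2) (by simp) V)))
      - lam₂ * -(inner ℝ (fieldOne a hs w) (D (HPerZero (s + 2)) (1, 0) (by simp) V)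
        + inner ℝ (fieldTwo a hs w) (D (HPerZero (s + 2)) (0, 1) (by simp) V))
      = inner ℝ (D (HPer s) (s - 2, 0) (by simp) h) (D (HPerZero (s + 2)) (s, 0) (by simp) V)
        - lam₁ * inner ℝ (D (HPer s) (0, s) (by simp) h)
          (D (HPerZero (s + 2)) (0, s) (by simp) V)
        - lam₂ * inner ℝ (toL2 (HPer s) h) (D (HPerZero (s + 2)) (0, 0) (Nat.zero_le _) V) := h2
  simp only [hV, ← integral_mul_classL2 _ (hv.pd _).memLp] at h3
  -- `∂₂^{s-1} a₂` is read as `∂₂^{s-2}` of `∂₂ a₂`, which matches the `s + 2` derivatives in `x₂`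
  -- on the test function to a total of `2 * s`.
  have hA₂' : IsWeakDeriv (0, s - 2) f₂ A₂ := by
    refine hf₂.cancel ?_
    rwa [Prod.mk_add_mk, show 1 + (s - 2) = s - 1 by omega]
  -- The single derivative in `x₁` is moved from the test function to `a₁` without a boundary term,
  -- because `φ(0) = φ(1) = 0`.
  have i₁ := hf₁.integral_pdOne hv (fun y => by simp [h0]) (fun y => by simp [h1])
  have i₂ := hf₂.integral_pd_zero_left hv
  rw [hA₁.integral_mode hφ k θ (s := s) (by omega), hA₂'.integral_mode hφ k θ (s := s) (by omega),
    (isWeakDeriv_D h (0, s) (by simp)).integral_mode hφ k θ (s := s) (by omega),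
    neg_one_pow_sub_two (by omega), neg_one_pow_sub_one (by omega), pd_zero_zero, pd_one_zero,
    i₁, i₂] at h3
  have e : ∀ x : ℝ × ℝ, iteratedDeriv s φ x.1 * trig k θ x.2
      = pd (s, 0) (fun x => φ x.1 * trig k θ x.2) x := by
    intro x
    rw [pd_sep]
    simp only [iteratedDeriv_zero]
  rw [show s - 2 + 2 = s by omega]
  simp only [e]
  rw [integral_sub_mul_cell _ _ (hv.pd (s, 0)), integral_sub_mul_cell _ _ hv,
    integral_add_mul _ _ hv.smooth.continuous]
  have h4 := neg_one_pow_mul_self s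
  set I₁ := ∫ x in cell, f₁ x * (φ x.1 * trig k θ x.2)
  set I₂ := ∫ x in cell, f₂ x * (φ x.1 * trig k θ x.2)
  set I₃ := ∫ x in cell, toL2 (HPer s) h x * (φ x.1 * trig k θ x.2)
  linear_combination h3 + lam₁ * (2 * Real.pi * k) ^ (2 * s)
    * ((I₁ + I₂) * ((-1 : ℝ) ^ s * (-1) ^ s + 1) - I₃) * h4


end ToyProblem

end

theorem mainTheorem7 (s : ℕ) (hs : 5 ≤ s)
    (a : (ℝ × ℝ) × (ℝ × ℝ) → ℝ × ℝ)
    (ha : ContDiffOn ℝ (s + 1 : ℕ) a ((Set.Icc (0 : ℝ) 1 ×ˢ Set.univ) ×ˢ Set.univ))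
    (ha_per : ∀ x₁ ∈ Set.Icc (0 : ℝ) 1, ∀ (x₂ : ℝ) (z : ℝ × ℝ),
      a ((x₁, x₂ + 1), z) = a ((x₁, x₂), z))
    (lam₁ lam₂ : ℝ) (hlam₁ : 0 < lam₁) (hlam₂ : 0 < lam₂) :
    -- the operator `A` is well defined: `a(x, ∇w)` lies in `L²`, and it has weak derivatives in
    -- `L²` up to order `s - 1`
    (∀ w : ToyProblem.HPerZero s, ∃ G₁ G₂ : ToyProblem.HPer (s - 1),
      (fun x => (ToyProblem.field a hs w x).1)
          =ᵐ[ToyProblem.cellMeasure] ToyProblem.toL2 (ToyProblem.HPer (s - 1)) G₁ ∧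
      (fun x => (ToyProblem.field a hs w x).2)
          =ᵐ[ToyProblem.cellMeasure] ToyProblem.toL2 (ToyProblem.HPer (s - 1)) G₂) ∧
    -- `A w = f` in `V'` implies `div a(x, ∇w) = h`
    (∀ (w : ToyProblem.HPerZero s) (h : ToyProblem.HPer s),
      ToyProblem.opA a hs lam₁ lam₂ w = ToyProblem.injDual s (ToyProblem.rhs s lam₁ lam₂ h) →
      ToyProblem.divField a hs w = ToyProblem.toL2 (ToyProblem.HPer s) h) ∧
    -- the linear map is injective
    Function.Injective (ToyProblem.linMap s lam₁ lam₂) := by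
  refine ⟨fun w => ?_, fun w h heq => ?_, ToyProblem.linMap_injective hs hlam₁ hlam₂⟩
  · obtain ⟨⟨m₁, h₁⟩, m₂, h₂⟩ := ToyProblem.hasH_field hs ha ha_per w
    obtain ⟨G₁, hG₁⟩ := h₁.exists_hPer
    obtain ⟨G₂, hG₂⟩ := h₂.exists_hPer
    refine ⟨G₁, G₂, ?_, ?_⟩
    · rw [hG₁]
      exact (ToyProblem.coeFn_classL2 m₁).symm
    · rw [hG₂]
      exact (ToyProblem.coeFn_classL2 m₂).symm
  · obtain ⟨⟨-, h₁⟩, -, h₂⟩ := ToyProblem.hasH_field hs ha ha_per w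
    exact ToyProblem.divField_eq_of_opA_eq hs hlam₁ hlam₂ h₁ h₂ heq
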